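/- **Setting.** Let $\Gamma=\Gamma_1\sqcup\dots\sqcup\Gamma_k$ be a finite disjoint union of finite graphs of groups with trivial edge groups and non-trivial fundamental groups $H_i=\pi_1(\Gamma_i)$, each equipped with the splitting $H_i=G_{i,1}*\dots*G_{i,p_i}*F_{n_i}$ ($G_{i,j}\neq1$) given by the vertex groups. Let $\phi=(\sigma,\phi_1,\dots,\phi_k)\in\operatorname{Aut}(\Gamma)$: $\sigma$ is a permutation of $\{1,\dots,k\}$ and $\phi_i:H_i\to H_{\sigma(i)}$ is an isomorphism that maps each $G_{i,j}$ to a conjugate of some $G_{\sigma(i),j'}$. The outer space $\mathcal O(\Gamma)$ consists of the families $X=(X_1,\dots,X_k)$ in which $X_i$ is a minimal simplicial metric $H_i$-tree, with finite quotient, trivial edge stabilisers and no redundant (trivially stabilised, two-valent) vertices (universal covers of circles being admitted), whose non-trivial vertex stabilisers are exactly the conjugates of the $G_{i,j}$. Its simplicial bordification $\overline{\mathcal O(\Gamma)}$ consists of all families obtained from these by collapsing invariant sub-forests. The open simplex $\Delta_Y$ of $Y\in\overline{\mathcal O(\Gamma)}$ is the set of all choices of positive invariant edge lengths $L(e)$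 on $Y$. Its simplicial faces (finitary or at infinity) are obtained by letting the lengths of the edges in an invariant subgraph $A$ be zero, i.e. by collapsing $A$. All trees are the universal covers of the corresponding quotient graphs of groups, and all maps below are maps of trees. A *map representing $\phi$* on $X$ is a family $f=(f_i)$ of Lipschitz maps $f_i:X_i\to X_{\sigma(i)}$ with $f_i(gx)=\phi_i(g)f_i(x)$ for $g\in H_i$. Let $\operatorname{Lip}(f)$ be its best Lipschitz constant on all components. It is *straight* if it has constant speed on every edge. Its *tension graph* is the union of the edges that are stretched exactly by the factor $\operatorname{Lip}(f)$. Two germs of edges at a vertex $v$ are in the same *gate* if they have the same non-degenerate image germ at $f(v)$. A straight map $f$ representing $\phi$ is *optimal* if $\operatorname{Lip}(f)$ is the minimum of $\operatorname{Lip}$ over all maps representing $\phi$, and if at no vertex of the tension graph do all germs of tension edges form a single gate. For maps with values in the same forest, $d_\infty$ is the supremum of the pointwise distances, over all components. The *core* of a subgraph of a graph of groups is its maximal subgraph (without isolated vertices) all of whose leaves have non-trivial vertex group. An invariant subgraph $C$ of a forest $Y$ is *$\phi$-invariant* if some map $h:Y\to Y$ representing $\phi$ satisfies $h(C)\subseteq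 C$. **Theorem 7.1.** Let $X,Y\in\overline{\mathcal O(\Gamma)}$ and suppose that $\Delta_X$ is a (not necessarily proper) simplicial face of $\Delta_Y$, so that $X$ is obtained, as a graph, from $Y$ by collapsing a subgraph $A$. Suppose that $\operatorname{core}(A)$ is $\phi$-invariant. For $t\in[0,1]$ let $Y_t=(1-t)X+tY$ be the Euclidean segment from $X$ to $Y$, i.e. $Y$ with the edge lengths $(1-t)L_X(e)+tL_Y(e)$, where $L_X=0$ on $A$ (so $Y_0=X$, $Y_1=Y$). Let $\sigma_t:Y_t\to X$ be the map that collapses $A$ and linearly rescales the edges of $Y\setminus A$. Let $f:X\to X$ be an optimal map representing $\phi$. Then for every $\varepsilon>0$ there is $t_\varepsilon>0$ such that for every $t\in[0,1]$ with $t<t_\varepsilon$ there is an optimal map $g_t:Y_t\to Y_t$ representing $\phi$ with $$d_\infty(\sigma_t\circ g_t,\ f\circ\sigma_t)<\varepsilon .$$ -/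

import Mathlib

universe u

open scoped NNReal ENNReal

noncomputable section

/-! ### Splittings and automorphisms -/

/-- A splitting `H = G₁ * ⋯ * G_p * F_n` with non-trivial factor groups `G_j ≤ H`. -/
structure Splitting (H : Type u) [Group H] where
  p : ℕ
  n : ℕ
  factor : Fin p → Subgroup H
  factor_ne_bot : ∀ j, factor j ≠ ⊥
  isFreeProduct : ∃ free : FreeGroup (Fin n) →* H, Function.Bijective
    (Monoid.Coprod.lift (Monoid.CoprodI.lift fun j => (factor j).subtype) free)

/-- An element `(σ, φ₁, …, φ_k)` of `Aut(Γ)`, where `Γ = ⊔ Γ_i` and `Γ_i` has fundamental group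
`H i` with the splitting `Γ i`: a permutation `σ` of the components and isomorphisms
`φ_i : H_i → H_{σ(i)}` that map each factor group to a conjugate of a factor group. -/
structure AutGamma {ι : Type} {H : ι → Type u} [∀ i, Group (H i)]
    (Γ : ∀ i, Splitting (H i)) where
  perm : Equiv.Perm ι
  iso : ∀ i, H i ≃* H (perm i)
  map_factor : ∀ i (j : Fin (Γ i).p), ∃ (k : Fin (Γ (perm i)).p) (g : H (perm i)),
    ((Γ i).factor j).map (iso i).toMonoidHom
      = ((Γ (perm i)).factor k).map (MulAut.conj g).toMonoidHom

/-! ### Simplicial trees -/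

/-- A minimal simplicial `H`-tree with trivial edge stabilisers (in particular without
inversions), with finite quotient graph, and without redundant (that is, free and two-valent)
vertices.  As usual, the line on which an infinite cyclic group acts with a single orbit of
vertices (the universal cover of a circle) is admitted. -/
structure FreeTree (H : Type u) [Group H] where
  V : Type u
  [action : MulAction H V]
  graph : SimpleGraph V
  isTree : graph.IsTree
  smul_adj : ∀ (g : H) {v w : V}, graph.Adj v w → graph.Adj (g • v) (g • w)
  edge_stabilizer : ∀ (g : H) (v w : V), graph.Adj v w → s(g • v, g • w) = s(v, w) → g = 1
  cofinite : ∃ F : Finset (V × V), ∀ v w, graph.Adj v w → ∃ g : H, (g • v, g • w) ∈ F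
  minimal : ∀ S : Set V, S.Nonempty → (∀ (g : H), ∀ v ∈ S, g • v ∈ S) →
    (graph.induce S).Connected → S = Set.univ
  no_redundant : ∀ v : V, MulAction.stabilizer H v = ⊥ → (graph.neighborSet v).ncard = 2 →
    ∀ w : V, ∃ g : H, g • v = w

attribute [instance] FreeTree.action

namespace FreeTree

variable {H : Type u} [Group H]

/-- `Z` is (the combinatorial tree of) a point of the outer space of the splitting: every factor
group is the stabiliser of a vertex, and every non-trivial vertex stabiliser is conjugate to a
factor group. -/
def IsTreeOf (Z : FreeTree H) (Γ : Splitting H) : Prop :=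
  (∀ j, ∃ v : Z.V, MulAction.stabilizer H v = Γ.factor j) ∧
  ∀ v : Z.V, MulAction.stabilizer H v ≠ ⊥ →
    ∃ (g : H) (j : Fin Γ.p), MulAction.stabilizer H (g • v) = Γ.factor j

/-- The vertex map of an equivariant collapse `Z → Y = Z / A` of an invariant sub-forest `A`: edges
go to edges or to vertices, and the vertices of `Z` over a vertex of `Y` span a subtree. -/
structure IsCollapse (Z Y : FreeTree H) (p : Z.V → Y.V) : Prop where
  surjective : Function.Surjective p
  equivariant : ∀ (g : H) (v : Z.V), p (g • v) = g • p v
  adj : ∀ v w, Z.graph.Adj v w → p v = p w ∨ Y.graph.Adj (p v) (p w)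
  fiber_connected : ∀ y : Y.V, (Z.graph.induce (p ⁻¹' {y})).Connected

/-- `Y` is (the combinatorial tree of) a point of the simplicial bordification of the outer space
of the splitting: it is obtained by collapsing from a tree in the outer space. -/
def InBordification (Y : FreeTree H) (Γ : Splitting H) : Prop :=
  ∃ Z : FreeTree H, Z.IsTreeOf Γ ∧ ∃ p : Z.V → Y.V, IsCollapse Z Y p

/-- Edge lengths on the quotient graph `H \ Y`, i.e. invariant edge lengths on `Y`.  The positive
ones are the points of the open simplex of `Y`.  In general they are the points of its simplicial
closure: the edges of length zero are collapsed. -/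
structure Lengths (Y : FreeTree H) where
  len : Sym2 Y.V → ℝ
  nonneg : ∀ e, 0 ≤ len e
  invariant : ∀ (g : H) (v w : Y.V), len s(g • v, g • w) = len s(v, w)

/-- All edges have positive length. -/
def Lengths.Positive {Y : FreeTree H} (ℓ : Y.Lengths) : Prop := ∀ e ∈ Y.graph.edgeSet, 0 < ℓ.len e

/-- The point `(1 - t) X + t Y` of the Euclidean segment between two points of a simplex. -/
def Lengths.segment {Y : FreeTree H} (ℓX ℓY : Y.Lengths) (t : unitInterval) : Y.Lengths where
  len e := (1 - (t : ℝ)) * ℓX.len e + t * ℓY.len e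
  nonneg e := add_nonneg (mul_nonneg (sub_nonneg.2 t.2.2) (ℓX.nonneg e))
    (mul_nonneg t.2.1 (ℓY.nonneg e))
  invariant g v w := by rw [ℓX.invariant, ℓY.invariant]

/-! ### The metric tree defined by edge lengths -/

/-- The point at the fraction `pos` of the way from `src` to `tgt`, for vertices that are equal
or adjacent. -/
structure EdgePoint (Y : FreeTree H) (ℓ : Y.Lengths) where
  src : Y.V
  tgt : Y.V
  edge : src = tgt ∨ Y.graph.Adj src tgt
  pos : unitInterval

/-- The vertices on the far side of an oriented edge. -/
def side (Y : FreeTree H) (d : Y.graph.Dart) : Set Y.V :=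
  {v | (Y.graph.deleteEdges {d.edge}).Reachable d.snd v}

variable {Y : FreeTree H} {ℓ : Y.Lengths}

/-- The coordinate of a point along an oriented edge `d`: it is `0` before `d`, it is `1` past
`d`, and it is the fraction of `d` that has been travelled at a point of `d`. -/
def EdgePoint.coord (x : Y.EdgePoint ℓ) (d : Y.graph.Dart) : ℝ :=
  (1 - (x.pos : ℝ)) * (Y.side d).indicator 1 x.src
    + x.pos * (Y.side d).indicator 1 x.tgt

lemma finite_separating (Y : FreeTree H) (v w : Y.V) :
    {d : Y.graph.Dart | ¬ (v ∈ Y.side d ↔ w ∈ Y.side d)}.Finite := by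
  obtain ⟨q⟩ := Y.isTree.connected.preconnected v w
  induction q with
  | nil => simp
  | @cons a b c h q ih =>
    have h1 : {d : Y.graph.Dart | ¬ (a ∈ Y.side d ↔ b ∈ Y.side d)}.Finite := by
      let d0 : Y.graph.Dart := ⟨(a, b), h⟩
      refine Set.Finite.subset (Set.toFinite {d0, d0.symm}) ?_
      intro d hd
      by_contra hne
      apply hd
      have hne2 : d.edge ≠ s(a, b) := by
        intro he
        exact hne ((SimpleGraph.dart_edge_eq_iff d d0).1 he)
      have hadj : (Y.graph.deleteEdges {d.edge}).Adj a b := by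
        rw [SimpleGraph.deleteEdges_adj]
        exact ⟨h, fun h' => hne2 (Set.mem_singleton_iff.1 h').symm⟩
      exact ⟨fun h' => h'.trans hadj.reachable, fun h' => h'.trans hadj.symm.reachable⟩
    refine (h1.union ih).subset ?_
    intro d hd
    by_contra hcon
    simp only [Set.mem_union, Set.mem_ofPred_eq, not_or, not_not] at hcon
    exact hd (hcon.1.trans hcon.2)

lemma EdgePoint.finite_support (x y : Y.EdgePoint ℓ) :
    (Function.support fun d => ℓ.len d.edge * |x.coord d - y.coord d|).Finite := by
  refine (((finite_separating Y x.src x.tgt).union (finite_separating Y y.src y.tgt)).union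
    (finite_separating Y x.src y.src)).subset ?_
  intro d hd
  by_contra hcon
  simp only [Set.mem_union, Set.mem_ofPred_eq, not_or, not_not] at hcon
  apply hd
  obtain ⟨⟨h1, h2⟩, h3⟩ := hcon
  have hc : x.coord d = y.coord d := by
    classical
    simp only [EdgePoint.coord, Set.indicator_apply, Pi.one_apply, ← h1, ← h2, ← h3]
    ring
  simp [hc]

lemma EdgePoint.summable (x y : Y.EdgePoint ℓ) :
    Summable fun d => ℓ.len d.edge * |x.coord d - y.coord d| :=
  summable_of_hasFiniteSupport (x.finite_support y)

/-- The path distance: every edge contributes the length of the part of it that lies between the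
two points.  The sum is finite, and it counts every edge twice, once for each orientation. -/
instance : PseudoMetricSpace (Y.EdgePoint ℓ) where
  dist x y := (∑' d : Y.graph.Dart, ℓ.len d.edge * |x.coord d - y.coord d|) / 2
  dist_self x := by simp
  dist_comm x y := by simp only [abs_sub_comm]
  dist_triangle x y z := by
    rw [← add_div, ← (x.summable y).tsum_add (y.summable z)]
    refine div_le_div_of_nonneg_right ?_ zero_le_two
    refine (x.summable z).tsum_le_tsum (fun d => ?_) ((x.summable y).add (y.summable z))
    rw [← mul_add]
    exact mul_le_mul_of_nonneg_left (abs_sub_le _ _ _) (ℓ.nonneg _)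

lemma EdgePoint.dist_def (x y : Y.EdgePoint ℓ) :
    dist x y = (∑' d : Y.graph.Dart, ℓ.len d.edge * |x.coord d - y.coord d|) / 2 := rfl

lemma smul_adj_iff (g : H) (v w : Y.V) : Y.graph.Adj (g • v) (g • w) ↔ Y.graph.Adj v w :=
  ⟨fun h => by simpa using Y.smul_adj g⁻¹ h, fun h => Y.smul_adj g h⟩

/-- The action on oriented edges. -/
def smulDart (g : H) (d : Y.graph.Dart) : Y.graph.Dart :=
  ⟨(g • d.fst, g • d.snd), Y.smul_adj g d.adj⟩

/-- The action on oriented edges, as a bijection. -/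
def dartEquiv (Y : FreeTree H) (g : H) : Y.graph.Dart ≃ Y.graph.Dart where
  toFun := smulDart g
  invFun := smulDart g⁻¹
  left_inv d := by
    apply SimpleGraph.Dart.ext
    simp [smulDart]
  right_inv d := by
    apply SimpleGraph.Dart.ext
    simp [smulDart]

lemma smul_mem_side_of_mem (g : H) (v : Y.V) (d : Y.graph.Dart) (h : v ∈ Y.side d) :
    g • v ∈ Y.side (smulDart g d) := by
  let F : Y.graph.deleteEdges {d.edge} →g Y.graph.deleteEdges {(smulDart g d).edge} :=
    { toFun := fun v => g • v
      map_rel' := by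
        intro a b hab
        rw [SimpleGraph.deleteEdges_adj] at hab ⊢
        refine ⟨Y.smul_adj g hab.1, fun h' => hab.2 ?_⟩
        have h2 : Sym2.map (fun v => g • v) s(a, b) = Sym2.map (fun v => g • v) d.edge :=
          Set.mem_singleton_iff.1 h'
        exact Set.mem_singleton_iff.2 (Sym2.map.injective (MulAction.injective g) h2) }
  exact SimpleGraph.Reachable.map F h

lemma smul_mem_side_iff (g : H) (v : Y.V) (d : Y.graph.Dart) :
    g • v ∈ Y.side (smulDart g d) ↔ v ∈ Y.side d := by
  refine ⟨fun h => ?_, smul_mem_side_of_mem g v d⟩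
  have h2 := smul_mem_side_of_mem g⁻¹ _ _ h
  rw [inv_smul_smul] at h2
  have h3 : smulDart g⁻¹ (smulDart g d) = d := (Y.dartEquiv g).left_inv d
  rwa [h3] at h2

instance : MulAction H (Y.EdgePoint ℓ) where
  smul g x := ⟨g • x.src, g • x.tgt,
    x.edge.imp (fun h => by rw [h]) (fun h => Y.smul_adj g h), x.pos⟩
  one_smul x := by
    change EdgePoint.mk _ _ _ _ = x
    simp
  mul_smul g h x := by
    change EdgePoint.mk _ _ _ _ = EdgePoint.mk (g • h • x.src) (g • h • x.tgt) _ _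
    simp only [mul_smul]
    rfl

lemma EdgePoint.coord_smul (g : H) (x : Y.EdgePoint ℓ) (d : Y.graph.Dart) :
    (g • x).coord (smulDart g d) = x.coord d := by
  change (1 - (x.pos : ℝ)) * _ + x.pos * _ = _
  have h1 := smul_mem_side_iff g x.src d
  have h2 := smul_mem_side_iff g x.tgt d
  classical
  simp only [EdgePoint.coord, Set.indicator_apply]
  congr 2
  · exact if_congr h1 rfl rfl
  · exact if_congr h2 rfl rfl

instance : IsIsometricSMul H (Y.EdgePoint ℓ) where
  isometry_smul g := by
    refine Isometry.of_dist_eq fun x y => ?_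
    rw [EdgePoint.dist_def, EdgePoint.dist_def, ← (Y.dartEquiv g).tsum_eq]
    congr 1
    refine tsum_congr fun d => ?_
    change ℓ.len (smulDart g d).edge
      * |(g • x).coord (smulDart g d) - (g • y).coord (smulDart g d)| = _
    rw [EdgePoint.coord_smul, EdgePoint.coord_smul]
    congr 1
    exact ℓ.invariant g d.fst d.snd

/-- The metric `H`-tree with the given edge lengths: points at distance zero are identified, so
that the edges of length zero are collapsed. -/
abbrev Realization (Y : FreeTree H) (ℓ : Y.Lengths) : Type u := SeparationQuotient (Y.EdgePoint ℓ)

/-- The point of the metric tree at the fraction `s` of the way along an oriented edge. -/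
def point (ℓ : Y.Lengths) (d : Y.graph.Dart) (s : unitInterval) : Y.Realization ℓ :=
  SeparationQuotient.mk ⟨d.fst, d.snd, Or.inr d.adj, s⟩

/-- A vertex as a point of the metric tree. -/
def vertex (ℓ : Y.Lengths) (v : Y.V) : Y.Realization ℓ :=
  SeparationQuotient.mk ⟨v, v, Or.inl rfl, 0⟩

lemma EdgePoint.inseparable_of_le {ℓ₁ ℓ₂ : Y.Lengths}
    (h : ∀ e ∈ Y.graph.edgeSet, ℓ₁.len e = 0 → ℓ₂.len e = 0) (x y : Y.EdgePoint ℓ₁)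
    (hxy : Inseparable x y) :
    Inseparable (EdgePoint.mk (ℓ := ℓ₂) x.src x.tgt x.edge x.pos)
      (EdgePoint.mk y.src y.tgt y.edge y.pos) := by
  rw [Metric.inseparable_iff, EdgePoint.dist_def] at hxy ⊢
  have h0 : (∑' d : Y.graph.Dart, ℓ₁.len d.edge * |x.coord d - y.coord d|) = 0 := by linarith
  have hz := (hasSum_zero_iff_of_nonneg
    (fun d : Y.graph.Dart => mul_nonneg (ℓ₁.nonneg d.edge) (abs_nonneg (x.coord d - y.coord d)))).1
      (h0 ▸ (x.summable y).hasSum)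
  have hall : ∀ d : Y.graph.Dart, ℓ₂.len d.edge * |x.coord d - y.coord d| = 0 := by
    intro d
    rcases mul_eq_zero.1 (congrFun hz d) with h1 | h1
    · rw [h _ d.edge_mem h1, zero_mul]
    · rw [h1, mul_zero]
  have : (∑' d : Y.graph.Dart, ℓ₂.len d.edge * |x.coord d - y.coord d|) / 2 = 0 := by
    simp [hall]
  exact this

lemma Lengths.segment_eq_zero {ℓX ℓY : Y.Lengths} (hY : ℓY.Positive) (t : unitInterval) :
    ∀ e ∈ Y.graph.edgeSet, (ℓX.segment ℓY t).len e = 0 → ℓX.len e = 0 := by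
  intro e he h
  change (1 - (t : ℝ)) * ℓX.len e + t * ℓY.len e = 0 at h
  have h1 := mul_nonneg (sub_nonneg.2 t.2.2) (ℓX.nonneg e)
  have h2 := mul_nonneg t.2.1 (ℓY.nonneg e)
  have ht : (t : ℝ) = 0 := by
    have h3 : (t : ℝ) * ℓY.len e = 0 := by linarith
    exact (mul_eq_zero.1 h3).resolve_right (hY e he).ne'
  rw [ht] at h
  linarith

/-- The map `σ_t : Y_t → X` that collapses the edges of `X`-length zero and rescales all other
edges linearly: it keeps the fraction along each edge. -/
def sigma (ℓX ℓY : Y.Lengths) (hY : ℓY.Positive) (t : unitInterval) :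
    Y.Realization (ℓX.segment ℓY t) → Y.Realization ℓX :=
  SeparationQuotient.lift
    (fun x => SeparationQuotient.mk (EdgePoint.mk (ℓ := ℓX) x.src x.tgt x.edge x.pos))
    (fun x y hxy => SeparationQuotient.mk_eq_mk.2
      (EdgePoint.inseparable_of_le (Lengths.segment_eq_zero hY t) x y hxy))

/-! ### The core of a subgraph -/

/-- The edges of the core of the subgraph that consists of the edges in `A`.  A vertex of the quotient
graph of groups is a leaf with trivial vertex group exactly if its lifts are leaves in the tree, so
the core lifts to the largest subgraph without leaves (and without isolated vertices). -/
def coreEdges (Y : FreeTree H) (A : Set (Sym2 Y.V)) : Set (Sym2 Y.V) :=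
  ⋃₀ {C | C ⊆ A ∩ Y.graph.edgeSet ∧ ∀ v w, s(v, w) ∈ C → ∃ w', w' ≠ w ∧ s(v, w') ∈ C}

/-- The union of the edges in a set `C`, in the metric tree. -/
def subgraphSet (ℓ : Y.Lengths) (C : Set (Sym2 Y.V)) : Set (Y.Realization ℓ) :=
  {x | ∃ (d : Y.graph.Dart) (s : unitInterval), d.edge ∈ C ∧ point ℓ d s = x}

end FreeTree

/-! ### Optimal maps -/

section Maps

variable {ι : Type} {H : ι → Type u} [∀ i, Group (H i)] {Γ : ∀ i, Splitting (H i)}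

/-- Maps of the (possibly disconnected) metric forest that permute the components by `φ`. -/
abbrev ForestMap (φ : AutGamma Γ) {Y : ∀ i, FreeTree (H i)} (ℓ : ∀ i, (Y i).Lengths) : Type _ :=
  ∀ i, (Y i).Realization (ℓ i) → (Y (φ.perm i)).Realization (ℓ (φ.perm i))

variable {φ : AutGamma Γ} {Y : ∀ i, FreeTree (H i)} {ℓ : ∀ i, (Y i).Lengths}

namespace ForestMap

/-- The map is Lipschitz with constant `K` on every component. -/
def HasLip (f : ForestMap φ ℓ) (K : ℝ≥0) : Prop := ∀ i, LipschitzWith K (f i)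

/-- `f` is a Lipschitz map that represents `φ`: `f_i (g x) = φ_i(g) f_i(x)`. -/
def Represents (f : ForestMap φ ℓ) : Prop :=
  (∃ K, f.HasLip K) ∧ ∀ i (g : H i) x, f i (g • x) = φ.iso i g • f i x

/-- Constant speed on edges (an edge may be collapsed, with speed zero). -/
def Straight (f : ForestMap φ ℓ) : Prop :=
  ∀ i (d : (Y i).graph.Dart), ∃ c : ℝ≥0, ∀ s s' : unitInterval,
    dist (f i (FreeTree.point (ℓ i) d s)) (f i (FreeTree.point (ℓ i) d s'))
      = c * dist (FreeTree.point (ℓ i) d s) (FreeTree.point (ℓ i) d s')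

/-- The best Lipschitz constant of a Lipschitz map. -/
def lip (f : ForestMap φ ℓ) : ℝ≥0 := sInf {K | f.HasLip K}

/-- The displacement `Λ(X, φX)`: the least Lipschitz constant of a map that represents `φ`. -/
def displacement (φ : AutGamma Γ) (ℓ : ∀ i, (Y i).Lengths) : ℝ≥0 :=
  sInf {K | ∃ f : ForestMap φ ℓ, f.Represents ∧ f.HasLip K}

/-- The oriented edge `d` belongs to the tension graph: it is an edge of the metric tree (it is not
collapsed to a point there), and it is maximally stretched. -/
def InTension (f : ForestMap φ ℓ) (i : ι) (d : (Y i).graph.Dart) : Prop :=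
  0 < (ℓ i).len d.edge ∧
    dist (f i (FreeTree.vertex (ℓ i) d.fst)) (f i (FreeTree.vertex (ℓ i) d.snd))
      = f.lip * (ℓ i).len d.edge

/-- Two oriented edges from the same point `v` are in the same gate: they have the same
non-degenerate germ as image, i.e. their images share a point other than `f(v)`. -/
def SameGate (f : ForestMap φ ℓ) (i : ι) (d d' : (Y i).graph.Dart) : Prop :=
  ∃ s s' : unitInterval,
    f i (FreeTree.point (ℓ i) d s) = f i (FreeTree.point (ℓ i) d' s') ∧
    f i (FreeTree.point (ℓ i) d s) ≠ f i (FreeTree.vertex (ℓ i) d.fst)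

/-- `f` is an optimal map that represents `φ`: a straight map that realises the least Lipschitz
constant and whose tension graph has no one-gated vertex. -/
structure IsOptimal (f : ForestMap φ ℓ) : Prop where
  represents : f.Represents
  straight : f.Straight
  weakly_optimal : f.lip = displacement φ ℓ
  not_one_gated : ∀ i (d : (Y i).graph.Dart), f.InTension i d →
    ∃ d' : (Y i).graph.Dart, f.InTension i d' ∧
      FreeTree.vertex (ℓ i) d'.fst = FreeTree.vertex (ℓ i) d.fst ∧ ¬ f.SameGate i d d'

end ForestMap

/-- A subgraph, given by the set `C i` of its edges in each component, is `φ`-invariant: some map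
of the forest that represents `φ` maps it to itself. -/
def IsInvariantSubgraph (φ : AutGamma Γ) (ℓ : ∀ i, (Y i).Lengths)
    (C : ∀ i, Set (Sym2 (Y i).V)) : Prop :=
  ∃ h : ForestMap φ ℓ, h.Represents ∧
    ∀ i, Set.MapsTo (h i) (FreeTree.subgraphSet (ℓ i) (C i))
      (FreeTree.subgraphSet (ℓ (φ.perm i)) (C (φ.perm i)))

/-- The uniform distance of two families of maps. -/
def dInfty {ι : Type} {P Q : ι → Type*} [∀ i, MetricSpace (Q i)] (a b : ∀ i, P i → Q i) : ℝ≥0∞ :=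
  ⨆ i, ⨆ x, edist (a i x) (b i x)

end Maps

end

/-!
A map that represents `φ` and is straight on edges is the same thing as an equivariant map on the
vertices of the trees.  The only geometry of the target that is needed is that it is a geodesic
space with the four-point inequality on which the group acts isometrically and cocompactly, with
discrete distances between orbits, and such that a non-trivial element has at most one fixed point
(`FreeTree.isTreeAction`).  Write `Λ_t` for the displacement of `Y_t`, and `L` for that of `X`.

*Lower semicontinuity.*  As the tension graph of `f` has no one-gated vertex, it contains an infinite
legal path, whose image is a geodesic that is stretched by the factor `L`.  Any map on `Y_t` is at
bounded distance from `f` after the collapse, and it also has to stretch this path.  Hence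
`(1 - t) L ≤ Λ_t (1 - t + t κ)` for a constant `κ` (`ForestMap.exists_displacement_bound`).

*A lift of `f`.*  The values of `f` at the vertices lift to an equivariant map `F` on the vertices of
`Y` (`ForestMap.exists_lift`).  At a vertex with non-trivial stabiliser the lift exists because some
map of `Y` represents `φ`.  In `Y_t`, the image under `F` of an edge of length `ℓ` has length at most
`Λ_t ℓ + O(t)`; this is an absolute error, so that also the edges of length `O(t)` are harmless.

*Correction of the lift.*  Since the quotient is compact and distances are discrete, `Λ_t` is
attained, and among the maps on vertices that attain it there is one that is closest to `F`
(`FreeTree.exists_closest`).  Its distance from `F` is at most `O(t)` times the number of orbits of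
vertices, since otherwise it could be moved towards `F` (`FreeTree.dist_le_of_closest`).  Finally,
arbitrarily small moves in the direction of a gate remove the one-gated vertices, one after the other
(`FreeTree.exists_not_one_gated`).  The straight extension of the resulting map is optimal
(`ForestMap.exists_optimal_near`), and it is close to `f` at vertices, and therefore everywhere
(`dist_sigma_le`).  If `Λ_t = 0`, the maps in question are constant, with values the unique fixed
points of the groups.
-/

/-! ### Metric trees -/

/-- A metric tree: a geodesic metric space that satisfies the four-point inequality. -/
structure IsTreeMetric (T : Type*) [MetricSpace T] : Prop where
  four_point : ∀ p q a b : T, dist p q + dist a b ≤ max (dist p a + dist q b) (dist p b + dist q a)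
  geodesic : ∀ (a b : T) (r : ℝ), 0 ≤ r → r ≤ dist a b →
    ∃ c, dist a c = r ∧ dist c b = dist a b - r

section FourPoint

variable {T : Type*} [MetricSpace T]

lemma dist_le_max_of_between
    (h4 : ∀ p q a b : T, dist p q + dist a b ≤ max (dist p a + dist q b) (dist p b + dist q a))
    {a b q : T} (hq : dist a q + dist q b = dist a b) (p : T) :
    dist p q ≤ max (dist p a - dist a q) (dist p b - dist q b) := by
  have h := h4 p q a b
  rw [le_max_iff] at h ⊢
  rw [dist_comm q a] at h
  rcases h with h | h
  · left; linarith
  · right; linarith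

/-- Geodesics between consecutive points can be combined to a geodesic between the outer points, as
a tripod is spanned by any two of its sides. -/
lemma exists_between_trans
    (h4 : ∀ p q a b : T, dist p q + dist a b ≤ max (dist p a + dist q b) (dist p b + dist q a))
    {a b c : T}
    (hab : ∀ r, 0 ≤ r → r ≤ dist a b → ∃ x, dist a x = r ∧ dist x b = dist a b - r)
    (hbc : ∀ r, 0 ≤ r → r ≤ dist b c → ∃ x, dist b x = r ∧ dist x c = dist b c - r)
    (r : ℝ) (hr : 0 ≤ r) (hr' : r ≤ dist a c) :
    ∃ x, dist a x = r ∧ dist x c = dist a c - r := by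
  have t1 := dist_triangle a b c
  have t2 := dist_triangle a c b
  have t3 := dist_triangle b a c
  rw [dist_comm c b] at t2
  rw [dist_comm b a] at t3
  rcases le_total (2 * r) (dist a b + dist a c - dist b c) with h | h
  · obtain ⟨x, h1, h2⟩ := hab r hr (by linarith)
    refine ⟨x, h1, le_antisymm ?_ ?_⟩
    · have := dist_le_max_of_between h4 (a := a) (b := b) (q := x) (by linarith) c
      rw [dist_comm c x, dist_comm c a, dist_comm c b] at this
      refine this.trans (max_le ?_ ?_) <;> linarith
    · have := dist_triangle a x c
      linarith
  · obtain ⟨x, h1, h2⟩ := hbc (dist b c - (dist a c - r)) (by linarith) (by linarith)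
    have h3 : dist x c = dist a c - r := by linarith
    refine ⟨x, le_antisymm ?_ ?_, h3⟩
    · have := dist_le_max_of_between h4 (a := b) (b := c) (q := x) (by linarith) a
      refine this.trans (max_le ?_ ?_) <;> linarith
    · have := dist_triangle a x c
      linarith

end FourPoint

namespace IsTreeMetric

variable {T : Type*} [MetricSpace T] (hT : IsTreeMetric T)
include hT

lemma dist_le_max {a b q : T} (hq : dist a q + dist q b = dist a b) (p : T) :
    dist p q ≤ max (dist p a - dist a q) (dist p b - dist q b) :=
  dist_le_max_of_between hT.four_point hq p

lemma dist_eq_abs {a b c c' : T} (h : dist a c + dist c b = dist a b)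
    (h' : dist a c' + dist c' b = dist a b) : dist c c' = |dist a c - dist a c'| := by
  apply le_antisymm
  · have := hT.dist_le_max h' c
    rw [dist_comm c a] at this
    refine this.trans (max_le (le_abs_self _) ?_)
    rw [abs_sub_comm]
    exact le_trans (by linarith) (le_abs_self _)
  · rw [dist_comm a c, dist_comm a c']
    exact abs_dist_sub_le c c' a

lemma eq_of_between {a b c c' : T} (h : dist a c + dist c b = dist a b)
    (h' : dist a c' + dist c' b = dist a b) (he : dist a c = dist a c') : c = c' := by
  rw [← dist_eq_zero, hT.dist_eq_abs h h', he, sub_self, abs_zero]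

/-- Two geodesics with the same origin agree up to their Gromov product. -/
lemma between_of_between {o a b c : T} (h : dist o c + dist c a = dist o a)
    (hr : 2 * dist o c ≤ dist o a + dist o b - dist a b) : dist o c + dist c b = dist o b := by
  apply le_antisymm
  · have := hT.dist_le_max h b
    rw [dist_comm b c, dist_comm b o, dist_comm b a] at this
    rcases le_max_iff.1 this with h1 | h1 <;> linarith
  · exact dist_triangle _ _ _

/-- A path of geodesic segments without backtracking is geodesic. -/
lemma between_concat {x y z w : T} (h1 : dist x y + dist y z = dist x z)
    (h2 : dist y z + dist z w = dist y w) (hne : 0 < dist y z) :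
    dist x z + dist z w = dist x w := by
  have h := hT.four_point x z y w
  rw [dist_comm z y] at h
  apply le_antisymm
  · rcases le_max_iff.1 h with h | h <;> linarith
  · exact dist_triangle _ _ _

end IsTreeMetric

open Classical in
/-- The point at distance `r` from `a` on the geodesic from `a` to `b`. -/
noncomputable def geodPoint {T : Type*} [MetricSpace T] (a b : T) (r : ℝ) : T :=
  if h : ∃ c, dist a c = r ∧ dist c b = dist a b - r then h.choose else a

namespace IsTreeMetric

variable {T : Type*} [MetricSpace T] (hT : IsTreeMetric T)
include hT

lemma dist_geodPoint {a b : T} {r : ℝ} (h0 : 0 ≤ r) (h1 : r ≤ dist a b) :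
    dist a (geodPoint a b r) = r := by
  have h := hT.geodesic a b r h0 h1
  rw [geodPoint, dif_pos h]
  exact h.choose_spec.1

lemma geodPoint_dist {a b : T} {r : ℝ} (h0 : 0 ≤ r) (h1 : r ≤ dist a b) :
    dist (geodPoint a b r) b = dist a b - r := by
  have h := hT.geodesic a b r h0 h1
  rw [geodPoint, dif_pos h]
  exact h.choose_spec.2

lemma geodPoint_between {a b : T} {r : ℝ} (h0 : 0 ≤ r) (h1 : r ≤ dist a b) :
    dist a (geodPoint a b r) + dist (geodPoint a b r) b = dist a b := by
  rw [hT.dist_geodPoint h0 h1, hT.geodPoint_dist h0 h1]; ring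

lemma eq_geodPoint {a b c : T} (h : dist a c + dist c b = dist a b) :
    c = geodPoint a b (dist a c) := by
  have h0 : 0 ≤ dist c b := dist_nonneg
  exact hT.eq_of_between h (hT.geodPoint_between dist_nonneg (by linarith))
    (hT.dist_geodPoint dist_nonneg (by linarith)).symm

lemma smul_geodPoint {K : Type*} [Group K] [MulAction K T] [IsIsometricSMul K T] (k : K)
    {a b : T} {r : ℝ} (h0 : 0 ≤ r) (h1 : r ≤ dist a b) :
    k • geodPoint a b r = geodPoint (k • a) (k • b) r := by
  have h := hT.geodPoint_between h0 h1
  have h2 : dist (k • a) (k • geodPoint a b r) = r := by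
    rw [dist_smul, hT.dist_geodPoint h0 h1]
  conv_rhs => rw [← h2]
  apply hT.eq_geodPoint
  simpa only [dist_smul] using h

end IsTreeMetric

/-- An isometric action on a metric tree with the properties that it inherits from a cofinite
action with trivial edge stabilisers on a simplicial tree. -/
structure IsTreeAction (K T : Type*) [Group K] [MetricSpace T] [MulAction K T] : Prop
    extends IsTreeMetric T where
  fixed_unique : ∀ (k : K) (p q : T), k ≠ 1 → k • p = p → k • q = q → p = q
  cocompact : ∃ C : Set T, IsCompact C ∧ ∀ x : T, ∃ k : K, k • x ∈ C
  discrete : ∀ (x y : T) (R : ℝ), {r : ℝ | r ≤ R ∧ ∃ k : K, dist x (k • y) = r}.Finite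

/-! ### Half-trees -/

namespace FreeTree

variable {H : Type u} [Group H] {Y : FreeTree H} {ℓ : Y.Lengths}

lemma snd_mem_side (d : Y.graph.Dart) : d.snd ∈ Y.side d := SimpleGraph.Reachable.refl _

lemma fst_notMem_side (d : Y.graph.Dart) : d.fst ∉ Y.side d := by
  intro h
  have hb := (SimpleGraph.isAcyclic_iff_forall_adj_isBridge.1 Y.isTree.isAcyclic) d.adj
  rw [SimpleGraph.isBridge_iff] at hb
  exact hb h.symm

/-- Only the edge `d` itself joins the two half-trees of `d`. -/
lemma mem_side_iff_of_adj {d : Y.graph.Dart} {v w : Y.V} (h : v = w ∨ Y.graph.Adj v w)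
    (hne : s(v, w) ≠ d.edge) : v ∈ Y.side d ↔ w ∈ Y.side d := by
  rcases h with rfl | h
  · rfl
  have hadj : (Y.graph.deleteEdges {d.edge}).Adj v w := by
    rw [SimpleGraph.deleteEdges_adj]
    exact ⟨h, fun h' => hne (Set.mem_singleton_iff.1 h')⟩
  exact ⟨fun h' => h'.trans hadj.reachable, fun h' => h'.trans hadj.symm.reachable⟩

lemma edge_eq_of_mem_side {d : Y.graph.Dart} {v w : Y.V} (h : v = w ∨ Y.graph.Adj v w)
    (hv : v ∈ Y.side d) (hw : w ∉ Y.side d) : v = d.snd ∧ w = d.fst := by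
  have he : s(v, w) = d.edge := by
    by_contra hne
    exact hw ((mem_side_iff_of_adj h hne).1 hv)
  rcases Sym2.eq_iff.1 (he : s(v, w) = s(d.fst, d.snd)) with ⟨h1, h2⟩ | ⟨h1, h2⟩
  · exact absurd (h1 ▸ hv) (fst_notMem_side d)
  · exact ⟨h1, h2⟩

lemma mem_side_symm (d : Y.graph.Dart) (v : Y.V) : v ∈ Y.side d.symm ↔ v ∉ Y.side d := by
  constructor
  · intro h h'
    have h1 : (Y.graph.deleteEdges {d.edge}).Reachable d.fst v := by
      have h2 : (Y.graph.deleteEdges {d.symm.edge}).Reachable d.fst v := h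
      rwa [SimpleGraph.Dart.edge_symm] at h2
    exact fst_notMem_side d (SimpleGraph.Reachable.trans h' h1.symm)
  · obtain ⟨q⟩ := Y.isTree.connected.preconnected v d.snd
    generalize hw : d.snd = w at q
    intro hv
    induction q with
    | nil => exact absurd (hw ▸ snd_mem_side d) hv
    | @cons a b c h q ih =>
      by_cases hb : b ∈ Y.side d
      · have := (edge_eq_of_mem_side (Or.inr h.symm) hb hv).2
        rw [this]
        exact snd_mem_side d.symm
      · refine (mem_side_iff_of_adj (Or.inr h) ?_).2 (ih hw hb)
        intro he
        rw [SimpleGraph.Dart.edge_symm] at he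
        rcases Sym2.eq_iff.1 (he : s(a, b) = s(d.fst, d.snd)) with ⟨h1, h2⟩ | ⟨h1, h2⟩
        · exact hb (h2 ▸ snd_mem_side d)
        · exact hv (h1 ▸ snd_mem_side d)

/-- A half-tree that does not contain the edge `d'` lies on one side of `d'`. -/
lemma mem_side_iff_snd_mem {d d' : Y.graph.Dart} (h : d'.fst ∉ Y.side d) {v : Y.V}
    (hv : v ∈ Y.side d) : v ∈ Y.side d' ↔ d.snd ∈ Y.side d' := by
  suffices ∀ u w : Y.V, (Y.graph.deleteEdges {d.edge}).Walk u w → u ∈ Y.side d →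
      (w ∈ Y.side d' ↔ u ∈ Y.side d') by
    obtain ⟨q⟩ : (Y.graph.deleteEdges {d.edge}).Reachable d.snd v := hv
    exact this _ _ q (snd_mem_side d)
  intro u w q
  induction q with
  | nil => intro _; rfl
  | @cons a b c hab q ih =>
    intro ha
    have hb : b ∈ Y.side d := SimpleGraph.Reachable.trans ha hab.reachable
    rw [ih hb]
    rw [SimpleGraph.deleteEdges_adj] at hab
    refine (mem_side_iff_of_adj (Or.inr hab.1) ?_).symm
    intro he
    rcases Sym2.eq_iff.1 (he : s(a, b) = s(d'.fst, d'.snd)) with ⟨h1, h2⟩ | ⟨h1, h2⟩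
    · exact h (h1 ▸ ha)
    · exact h (h2 ▸ hb)

namespace EdgePoint

lemma coord_nonneg (x : Y.EdgePoint ℓ) (d : Y.graph.Dart) : 0 ≤ x.coord d := by
  have h1 := x.pos.2.1
  have h2 := x.pos.2.2
  unfold coord
  refine add_nonneg (mul_nonneg (by linarith) ?_) (mul_nonneg h1 ?_) <;>
    exact Set.indicator_nonneg (fun _ _ => zero_le_one) _

lemma coord_symm (x : Y.EdgePoint ℓ) (d : Y.graph.Dart) : x.coord d.symm = 1 - x.coord d := by
  classical
  simp only [coord, Set.indicator_apply, mem_side_symm, Pi.one_apply]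
  split_ifs <;> simp

lemma coord_le_one (x : Y.EdgePoint ℓ) (d : Y.graph.Dart) : x.coord d ≤ 1 := by
  have := x.coord_nonneg d.symm
  rw [coord_symm] at this
  linarith

lemma coord_eq_one {x : Y.EdgePoint ℓ} {d : Y.graph.Dart} (h1 : x.src ∈ Y.side d)
    (h2 : x.tgt ∈ Y.side d) : x.coord d = 1 := by
  simp [coord, h1, h2]

lemma coord_eq_zero {x : Y.EdgePoint ℓ} {d : Y.graph.Dart} (h1 : x.src ∉ Y.side d)
    (h2 : x.tgt ∉ Y.side d) : x.coord d = 0 := by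
  simp [coord, h1, h2]

lemma mem_or_mem_of_coord_pos {x : Y.EdgePoint ℓ} {d : Y.graph.Dart} (h : 0 < x.coord d) :
    x.src ∈ Y.side d ∨ x.tgt ∈ Y.side d := by
  by_contra! hc
  rw [coord_eq_zero hc.1 hc.2] at h
  exact lt_irrefl _ h

lemma edge_eq_of_coord {x : Y.EdgePoint ℓ} {d : Y.graph.Dart} (h0 : x.coord d ≠ 0)
    (h1 : x.coord d ≠ 1) : s(x.src, x.tgt) = d.edge := by
  by_contra hne
  have := mem_side_iff_of_adj x.edge hne
  by_cases h : x.src ∈ Y.side d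
  · exact h1 (coord_eq_one h (this.1 h))
  · exact h0 (coord_eq_zero h (fun h' => h (this.2 h')))

/-- Two edges are nested or disjoint, as seen from a vertex `o`. -/
lemma coord_nested {d d' : Y.graph.Dart} (hne : d.edge ≠ d'.edge) {o : Y.V} (ho : o ∉ Y.side d)
    (ho' : o ∉ Y.side d') :
    (∀ x : Y.EdgePoint ℓ, 0 < x.coord d → x.coord d' = 1) ∨
    (∀ x : Y.EdgePoint ℓ, 0 < x.coord d' → x.coord d = 1) ∨
    (∀ x : Y.EdgePoint ℓ, 0 < x.coord d → 0 < x.coord d' → False) := by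
  -- a point with a positive coordinate along an edge inside a half-tree lies in that half-tree
  have key : ∀ e e' : Y.graph.Dart, (∀ v ∈ Y.side e, v ∈ Y.side e') → e.fst ∈ Y.side e' →
      ∀ x : Y.EdgePoint ℓ, 0 < x.coord e → x.coord e' = 1 := by
    intro e e' hsub hfst x hx
    have hin : ∀ v w : Y.V, (v = w ∨ Y.graph.Adj v w) → v ∈ Y.side e → w ∈ Y.side e' := by
      intro v w hvw hv
      by_cases hw : w ∈ Y.side e
      · exact hsub w hw
      · rw [(edge_eq_of_mem_side hvw hv hw).2]; exact hfst
    rcases mem_or_mem_of_coord_pos hx with h | h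
    · exact coord_eq_one (hsub _ h) (hin _ _ x.edge h)
    · exact coord_eq_one (hin _ _ (x.edge.imp Eq.symm SimpleGraph.Adj.symm) h) (hsub _ h)
  by_cases h : d'.fst ∈ Y.side d
  · right; left
    refine key d' d (fun v hv => ?_) h
    by_contra hv2
    have h1 : d'.fst ∉ Y.side d.symm := by rw [mem_side_symm]; exact not_not.2 h
    have h2 := mem_side_iff_snd_mem h1 ((mem_side_symm d v).2 hv2)
    have h3 := mem_side_iff_snd_mem h1 ((mem_side_symm d o).2 ho)
    exact ho' (h3.2 (h2.1 hv))
  · by_cases hs : d.snd ∈ Y.side d'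
    · left
      refine key d d' (fun v hv => (mem_side_iff_snd_mem h hv).2 hs) ?_
      exact (mem_side_iff_of_adj (Or.inr d.adj) hne).2 hs
    · right; right
      have hdis : ∀ v ∈ Y.side d, v ∉ Y.side d' :=
        fun v hv hv' => hs ((mem_side_iff_snd_mem h hv).1 hv')
      have aux : ∀ v w : Y.V, (v = w ∨ Y.graph.Adj v w) → v ∈ Y.side d → w ∈ Y.side d' →
          False := by
        intro v w hvw hv hw
        have h1 := edge_eq_of_mem_side hvw hv (fun h' => hdis w h' hw)
        have h2 := edge_eq_of_mem_side (hvw.imp Eq.symm SimpleGraph.Adj.symm) hw (hdis v hv)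
        apply hne
        change s(d.fst, d.snd) = s(d'.fst, d'.snd)
        rw [← h1.1, ← h1.2, ← h2.1, ← h2.2, Sym2.eq_swap]
      intro x hx hx'
      rcases mem_or_mem_of_coord_pos hx with h1 | h1 <;>
        rcases mem_or_mem_of_coord_pos hx' with h2 | h2
      · exact hdis _ h1 h2
      · exact aux _ _ x.edge h1 h2
      · exact aux _ _ (x.edge.imp Eq.symm SimpleGraph.Adj.symm) h1 h2
      · exact hdis _ h1 h2

/-! ### The four-point inequality -/

/-- The vertex `v` as a point. -/
abbrev ofVertex (ℓ : Y.Lengths) (v : Y.V) : Y.EdgePoint ℓ := ⟨v, v, Or.inl rfl, 0⟩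

lemma coord_ofVertex_of_notMem {v : Y.V} {d : Y.graph.Dart} (h : v ∉ Y.side d) :
    (ofVertex ℓ v).coord d = 0 := coord_eq_zero h h

lemma coord_ofVertex_of_mem {v : Y.V} {d : Y.graph.Dart} (h : v ∈ Y.side d) :
    (ofVertex ℓ v).coord d = 1 := coord_eq_one h h

/-- The Gromov product of two points with respect to the vertex `o`, up to a factor. -/
lemma dist_add_dist_sub_dist (o : Y.V) (x y : Y.EdgePoint ℓ) :
    dist x (ofVertex ℓ o) + dist y (ofVertex ℓ o) - dist x y
      = ∑' d : Y.graph.Dart, ℓ.len d.edge *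
        min |x.coord d - (ofVertex ℓ o).coord d| |y.coord d - (ofVertex ℓ o).coord d| := by
  rw [dist_def, dist_def, dist_def, ← add_div, ← sub_div,
    ← (x.summable (ofVertex ℓ o)).tsum_add (y.summable (ofVertex ℓ o)),
    ← ((x.summable (ofVertex ℓ o)).add (y.summable (ofVertex ℓ o))).tsum_sub (x.summable y),
    ← tsum_div_const]
  refine tsum_congr fun d => ?_
  have hx0 := x.coord_nonneg d
  have hx1 := x.coord_le_one d
  have hy0 := y.coord_nonneg d
  have hy1 := y.coord_le_one d
  by_cases ho : o ∈ Y.side d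
  · rw [coord_ofVertex_of_mem ho, abs_of_nonpos (by linarith : x.coord d - 1 ≤ 0),
      abs_of_nonpos (by linarith : y.coord d - 1 ≤ 0)]
    rcases le_total (x.coord d) (y.coord d) with h | h
    · rw [abs_of_nonpos (by linarith), min_eq_right (by linarith)]; ring
    · rw [abs_of_nonneg (by linarith), min_eq_left (by linarith)]; ring
  · rw [coord_ofVertex_of_notMem ho, sub_zero, sub_zero, abs_of_nonneg hx0, abs_of_nonneg hy0]
    rcases le_total (x.coord d) (y.coord d) with h | h
    · rw [abs_of_nonpos (by linarith), min_eq_left (by linarith)]; ring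
    · rw [abs_of_nonneg (by linarith), min_eq_right (by linarith)]; ring

lemma summable_min (o : Y.V) (x y : Y.EdgePoint ℓ) :
    Summable fun d : Y.graph.Dart => ℓ.len d.edge *
        min |x.coord d - (ofVertex ℓ o).coord d| |y.coord d - (ofVertex ℓ o).coord d| := by
  refine Summable.of_nonneg_of_le (fun d => mul_nonneg (ℓ.nonneg _)
    (le_min (abs_nonneg _) (abs_nonneg _))) (fun d => ?_) (x.summable (ofVertex ℓ o))
  exact mul_le_mul_of_nonneg_left (min_le_left _ _) (ℓ.nonneg _)

/-- The parts of the segment from `o` to `y` that are shared with the segments to `x` and to `z` are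
both initial segments, so one contains the other. -/
lemma min_coord_total (o : Y.V) (x y z : Y.EdgePoint ℓ) :
    (∀ d, min |x.coord d - (ofVertex ℓ o).coord d| |y.coord d - (ofVertex ℓ o).coord d|
      ≤ min |y.coord d - (ofVertex ℓ o).coord d| |z.coord d - (ofVertex ℓ o).coord d|) ∨
    (∀ d, min |y.coord d - (ofVertex ℓ o).coord d| |z.coord d - (ofVertex ℓ o).coord d|
      ≤ min |x.coord d - (ofVertex ℓ o).coord d| |y.coord d - (ofVertex ℓ o).coord d|) := by
  have hsymm : ∀ (p : Y.EdgePoint ℓ) d, |p.coord d.symm - (ofVertex ℓ o).coord d.symm|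
      = |p.coord d - (ofVertex ℓ o).coord d| := by
    intro p d
    rw [coord_symm, coord_symm, ← abs_neg]
    congr 1; ring
  by_contra! hcon
  obtain ⟨⟨d, hd⟩, ⟨d', hd'⟩⟩ := hcon
  wlog ho : o ∉ Y.side d generalizing d
  · refine this d.symm ?_ ?_
    · rw [hsymm, hsymm, hsymm]; exact hd
    · rwa [mem_side_symm]
  wlog ho' : o ∉ Y.side d' generalizing d'
  · refine this d'.symm ?_ ?_
    · rw [hsymm, hsymm, hsymm]; exact hd'
    · rwa [mem_side_symm]
  have hne : d.edge ≠ d'.edge := by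
    intro he
    rcases (SimpleGraph.dart_edge_eq_iff d d').1 he with rfl | rfl
    · exact lt_asymm hd hd'
    · rw [hsymm, hsymm, hsymm] at hd
      exact lt_asymm hd hd'
  simp only [coord_ofVertex_of_notMem ho, coord_ofVertex_of_notMem ho', sub_zero,
    abs_of_nonneg (coord_nonneg _ _)] at hd hd'
  have hy1 := y.coord_le_one d
  have hy1' := y.coord_le_one d'
  have hz := z.coord_nonneg d
  have hx' := x.coord_nonneg d'
  have hy := y.coord_nonneg d
  have hy' := y.coord_nonneg d'
  obtain ⟨h1, h2⟩ := lt_min_iff.1 hd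
  obtain ⟨h3, h4⟩ := lt_min_iff.1 hd'
  have hzd : z.coord d < y.coord d := by
    rcases min_lt_iff.1 h2 with h | h
    · exact absurd h (lt_irrefl _)
    · exact h
  have hxd : x.coord d' < y.coord d' := by
    rcases min_lt_iff.1 h3 with h | h
    · exact h
    · exact absurd h (lt_irrefl _)
  have hxd0 : 0 < x.coord d := lt_of_le_of_lt (le_min hy hz) h1
  have hzd0 : 0 < z.coord d' := lt_of_le_of_lt (le_min hx' hy') h4
  rcases coord_nested (ℓ := ℓ) hne ho ho' with h | h | h
  · have := h x hxd0; linarith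
  · have := h z hzd0; linarith
  · exact h y (by linarith) (by linarith)

lemma gromov_ultrametric (o : Y.V) (x y z : Y.EdgePoint ℓ) :
    min (dist x (ofVertex ℓ o) + dist y (ofVertex ℓ o) - dist x y)
        (dist y (ofVertex ℓ o) + dist z (ofVertex ℓ o) - dist y z)
      ≤ dist x (ofVertex ℓ o) + dist z (ofVertex ℓ o) - dist x z := by
  rw [dist_add_dist_sub_dist, dist_add_dist_sub_dist, dist_add_dist_sub_dist]
  rcases min_coord_total o x y z with h | h
  · refine (min_le_left _ _).trans ((summable_min o x y).tsum_le_tsum (fun d => ?_)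
      (summable_min o x z))
    exact mul_le_mul_of_nonneg_left
      (le_min (min_le_left _ _) ((h d).trans (min_le_right _ _))) (ℓ.nonneg _)
  · refine (min_le_right _ _).trans ((summable_min o y z).tsum_le_tsum (fun d => ?_)
      (summable_min o x z))
    exact mul_le_mul_of_nonneg_left
      (le_min ((h d).trans (min_le_left _ _)) (min_le_right _ _)) (ℓ.nonneg _)

lemma four_point (p q a b : Y.EdgePoint ℓ) :
    dist p q + dist a b ≤ max (dist p a + dist q b) (dist p b + dist q a) := by
  let o := p.src
  have h1 := gromov_ultrametric o p a q
  have h2 := gromov_ultrametric o p b q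
  have h3 := gromov_ultrametric o a p b
  have h4 := gromov_ultrametric o a q b
  rw [dist_comm a q] at h1 h4
  rw [dist_comm b q] at h2
  rw [dist_comm a p] at h3
  rw [min_le_iff] at h1 h2 h3 h4
  rw [le_max_iff]
  by_contra! hc
  rcases h1 with h1 | h1 <;> rcases h2 with h2 | h2 <;> rcases h3 with h3 | h3 <;>
    rcases h4 with h4 | h4 <;> linarith [hc.1, hc.2]

end EdgePoint

end FreeTree

/-! ### The metric tree of edge lengths -/

namespace FreeTree

variable {H : Type u} [Group H] {Y : FreeTree H} {ℓ : Y.Lengths}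

namespace EdgePoint

lemma dist_eq_zero_of_coord {x y : Y.EdgePoint ℓ} (h : ∀ d, x.coord d = y.coord d) :
    dist x y = 0 := by
  rw [dist_def]; simp [h]

lemma dist_add_of_coord {x y z : Y.EdgePoint ℓ}
    (h : ∀ d, |x.coord d - y.coord d| = |x.coord d - z.coord d| + |z.coord d - y.coord d|) :
    dist x y = dist x z + dist z y := by
  rw [dist_def, dist_def, dist_def, ← add_div, ← (x.summable z).tsum_add (z.summable y)]
  congr 1
  refine tsum_congr fun d => ?_
  rw [h d, mul_add]

/-- Points on the oriented edge `d`. -/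
abbrev onDart (ℓ : Y.Lengths) (d : Y.graph.Dart) (s : unitInterval) : Y.EdgePoint ℓ :=
  ⟨d.fst, d.snd, Or.inr d.adj, s⟩

lemma coord_onDart_self (d : Y.graph.Dart) (s : unitInterval) :
    (onDart ℓ d s).coord d = s := by
  simp [coord, fst_notMem_side, snd_mem_side]

lemma coord_onDart_of_ne {d d' : Y.graph.Dart} (h : d.edge ≠ d'.edge) (s : unitInterval) :
    (onDart ℓ d s).coord d' = (ofVertex ℓ d.fst).coord d' := by
  have := mem_side_iff_of_adj (d := d') (Or.inr d.adj) h
  by_cases hm : d.fst ∈ Y.side d'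
  · rw [coord_ofVertex_of_mem hm, coord_eq_one hm (this.1 hm)]
  · rw [coord_ofVertex_of_notMem hm, coord_eq_zero hm (fun h' => hm (this.2 h'))]

lemma dist_onDart (d : Y.graph.Dart) (s s' : unitInterval) :
    dist (onDart ℓ d s) (onDart ℓ d s') = ℓ.len d.edge * |(s : ℝ) - s'| := by
  classical
  rw [dist_def, tsum_eq_sum (s := {d, d.symm})]
  · rw [Finset.sum_pair (SimpleGraph.Dart.symm_ne d).symm, SimpleGraph.Dart.edge_symm, coord_symm,
      coord_symm, coord_onDart_self, coord_onDart_self]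
    rw [show (1 - (s : ℝ) - (1 - (s' : ℝ))) = -((s : ℝ) - s') by ring, abs_neg]
    ring
  · intro b hb
    have hne : d.edge ≠ b.edge := by
      intro he
      rcases (SimpleGraph.dart_edge_eq_iff d b).1 he with h | h
      · simp [h] at hb
      · simp [h] at hb
    rw [coord_onDart_of_ne hne, coord_onDart_of_ne hne]
    simp

lemma coord_onDart_zero (d : Y.graph.Dart) (d' : Y.graph.Dart) :
    (onDart ℓ d 0).coord d' = (ofVertex ℓ d.fst).coord d' := by
  simp [coord]

lemma coord_onDart_one (d : Y.graph.Dart) (d' : Y.graph.Dart) :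
    (onDart ℓ d 1).coord d' = (ofVertex ℓ d.snd).coord d' := by
  simp [coord]

lemma coord_onDart_symm (d : Y.graph.Dart) (s : unitInterval) (d' : Y.graph.Dart) :
    (onDart ℓ d.symm (unitInterval.symm s)).coord d' = (onDart ℓ d s).coord d' := by
  simp [coord]; ring

/-- A path that leaves an edge does so through one of its endpoints. -/
lemma dist_onDart_of_coord_zero (d : Y.graph.Dart) (s : unitInterval) {y : Y.EdgePoint ℓ}
    (hy : y.coord d = 0) :
    dist (onDart ℓ d s) y = dist (onDart ℓ d s) (onDart ℓ d 0) + dist (onDart ℓ d 0) y := by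
  refine dist_add_of_coord fun d' => ?_
  by_cases he : d.edge = d'.edge
  · rcases (SimpleGraph.dart_edge_eq_iff d d').1 he with rfl | h
    · simp [coord_onDart_self, hy]
    · have : d' = d.symm := by rw [h, SimpleGraph.Dart.symm_symm]
      rw [this, coord_symm, coord_symm, coord_symm, coord_onDart_self, coord_onDart_self, hy]
      simp
  · rw [coord_onDart_of_ne he, coord_onDart_of_ne he]
    simp

lemma mk_eq_mk_of_coord {x y : Y.EdgePoint ℓ} (h : ∀ d, x.coord d = y.coord d) :
    (SeparationQuotient.mk x : Y.Realization ℓ) = SeparationQuotient.mk y := by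
  rw [SeparationQuotient.mk_eq_mk, Metric.inseparable_iff]
  exact dist_eq_zero_of_coord h

lemma dist_mk (x y : Y.EdgePoint ℓ) :
    dist (SeparationQuotient.mk x : Y.Realization ℓ) (SeparationQuotient.mk y) = dist x y :=
  SeparationQuotient.dist_mk x y

/-- Every point is a vertex or a point on an oriented edge. -/
lemma eq_vertex_or_onDart (x : Y.EdgePoint ℓ) :
    (x.src = x.tgt ∧ ∀ d, x.coord d = (ofVertex ℓ x.src).coord d) ∨
      ∃ h : Y.graph.Adj x.src x.tgt, x = onDart ℓ ⟨(x.src, x.tgt), h⟩ x.pos := by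
  rcases x with ⟨a, b, hab, s⟩
  rcases hab with rfl | h
  · left
    refine ⟨rfl, fun d => ?_⟩
    simp only [coord]
    ring
  · right; exact ⟨h, rfl⟩

end EdgePoint

open EdgePoint

lemma point_zero (d : Y.graph.Dart) : point ℓ d 0 = vertex ℓ d.fst :=
  mk_eq_mk_of_coord (coord_onDart_zero d)

lemma point_one (d : Y.graph.Dart) : point ℓ d 1 = vertex ℓ d.snd :=
  mk_eq_mk_of_coord (coord_onDart_one d)

lemma dist_point (d : Y.graph.Dart) (s s' : unitInterval) :
    dist (point ℓ d s) (point ℓ d s') = ℓ.len d.edge * |(s : ℝ) - s'| := by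
  rw [point, point, dist_mk]; exact dist_onDart d s s'

lemma dist_vertex_point (d : Y.graph.Dart) (s : unitInterval) :
    dist (vertex ℓ d.fst) (point ℓ d s) = ℓ.len d.edge * s := by
  rw [← point_zero, dist_point]
  simp [abs_of_nonneg s.2.1]

lemma dist_vertex_vertex (d : Y.graph.Dart) :
    dist (vertex ℓ d.fst) (vertex ℓ d.snd) = ℓ.len d.edge := by
  rw [← point_one, dist_vertex_point]; simp

lemma eq_vertex_or_point (p : Y.Realization ℓ) :
    (∃ v, p = vertex ℓ v) ∨ ∃ d s, p = point ℓ d s := by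
  obtain ⟨x, rfl⟩ := SeparationQuotient.surjective_mk p
  rcases eq_vertex_or_onDart x with ⟨-, h⟩ | ⟨h, hx⟩
  · exact Or.inl ⟨x.src, mk_eq_mk_of_coord h⟩
  · exact Or.inr ⟨_, x.pos, congrArg _ hx⟩

lemma smul_mk (g : H) (x : Y.EdgePoint ℓ) :
    g • (SeparationQuotient.mk x : Y.Realization ℓ) = SeparationQuotient.mk (g • x) := rfl

lemma smul_vertex (g : H) (v : Y.V) : g • vertex ℓ v = vertex ℓ (g • v) := rfl

lemma smul_point (g : H) (d : Y.graph.Dart) (s : unitInterval) :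
    g • point ℓ d s = point ℓ (smulDart g d) s := rfl

instance : IsIsometricSMul H (Y.Realization ℓ) where
  isometry_smul g := by
    refine Isometry.of_dist_eq fun p q => ?_
    obtain ⟨x, rfl⟩ := SeparationQuotient.surjective_mk p
    obtain ⟨y, rfl⟩ := SeparationQuotient.surjective_mk q
    rw [smul_mk, smul_mk, dist_mk, dist_mk, dist_smul]

lemma len_smulDart (ℓ : Y.Lengths) (g : H) (d : Y.graph.Dart) :
    ℓ.len (smulDart g d).edge = ℓ.len d.edge := ℓ.invariant g d.fst d.snd

/-! ### Geodesics -/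

lemma realization_four_point (p q a b : Y.Realization ℓ) :
    dist p q + dist a b ≤ max (dist p a + dist q b) (dist p b + dist q a) := by
  obtain ⟨p, rfl⟩ := SeparationQuotient.surjective_mk p
  obtain ⟨q, rfl⟩ := SeparationQuotient.surjective_mk q
  obtain ⟨a, rfl⟩ := SeparationQuotient.surjective_mk a
  obtain ⟨b, rfl⟩ := SeparationQuotient.surjective_mk b
  simp only [dist_mk]
  exact EdgePoint.four_point p q a b

lemma exists_between_vertex_point (d : Y.graph.Dart) (s : unitInterval) (r : ℝ) (h0 : 0 ≤ r)
    (h1 : r ≤ dist (vertex ℓ d.fst) (point ℓ d s)) :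
    ∃ c, dist (vertex ℓ d.fst) c = r ∧
      dist c (point ℓ d s) = dist (vertex ℓ d.fst) (point ℓ d s) - r := by
  rw [dist_vertex_point] at h1 ⊢
  have hl := ℓ.nonneg d.edge
  have hs := s.2.1
  have hs' := s.2.2
  rcases hl.eq_or_lt with h | h
  · refine ⟨vertex ℓ d.fst, ?_, ?_⟩
    · rw [dist_self]; rw [← h] at h1; linarith
    · rw [dist_vertex_point]; rw [← h] at h1 ⊢; linarith
  · have hr : r / ℓ.len d.edge ≤ s := by rw [div_le_iff₀ h]; linarith
    have hr0 : 0 ≤ r / ℓ.len d.edge := div_nonneg h0 hl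
    refine ⟨point ℓ d ⟨r / ℓ.len d.edge, hr0, hr.trans hs'⟩, ?_, ?_⟩
    · rw [dist_vertex_point]; field_simp
    · rw [dist_point, abs_sub_comm, abs_of_nonneg (by simpa using hr)]
      field_simp

lemma exists_between_symm {T : Type*} [MetricSpace T] {a b : T}
    (h : ∀ r, 0 ≤ r → r ≤ dist a b → ∃ x, dist a x = r ∧ dist x b = dist a b - r)
    (r : ℝ) (h0 : 0 ≤ r) (h1 : r ≤ dist b a) : ∃ x, dist b x = r ∧ dist x a = dist b a - r := by
  rw [dist_comm b a] at h1 ⊢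
  obtain ⟨x, h2, h3⟩ := h (dist a b - r) (by linarith) (by linarith)
  exact ⟨x, by rw [dist_comm, h3]; ring, by rw [dist_comm, h2]⟩

variable (Y ℓ) in
lemma isTreeMetric : IsTreeMetric (Y.Realization ℓ) where
  four_point := realization_four_point
  geodesic := by
    have hvv : ∀ (v w : Y.V) (r : ℝ), 0 ≤ r → r ≤ dist (vertex ℓ v) (vertex ℓ w) →
        ∃ c, dist (vertex ℓ v) c = r ∧
          dist c (vertex ℓ w) = dist (vertex ℓ v) (vertex ℓ w) - r := by
      intro v w
      obtain ⟨q⟩ := Y.isTree.connected.preconnected v w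
      induction q with
      | @nil v =>
        intro r h0 h1
        rw [dist_self] at h1
        exact ⟨vertex ℓ v, by rw [dist_self]; linarith, by rw [dist_self]; linarith⟩
      | @cons a b c h q ih =>
        refine exists_between_trans realization_four_point (b := vertex ℓ b) ?_ ih
        have := exists_between_vertex_point (ℓ := ℓ) ⟨(a, b), h⟩ 1
        rw [point_one] at this
        exact this
    have hvp : ∀ (p : Y.Realization ℓ), ∃ v, ∀ (r : ℝ), 0 ≤ r → r ≤ dist (vertex ℓ v) p →
        ∃ c, dist (vertex ℓ v) c = r ∧ dist c p = dist (vertex ℓ v) p - r := by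
      intro p
      rcases eq_vertex_or_point p with ⟨v, rfl⟩ | ⟨d, s, rfl⟩
      · exact ⟨v, hvv v v⟩
      · exact ⟨d.fst, exists_between_vertex_point d s⟩
    intro a b
    obtain ⟨v, hv⟩ := hvp a
    obtain ⟨w, hw⟩ := hvp b
    exact exists_between_trans realization_four_point
      (exists_between_trans realization_four_point (exists_between_symm hv) (hvv v w)) hw

/-! ### Lipschitz maps are recognised on edges -/

/-- A map on the points of a tree that is `K`-Lipschitz on every edge, and
compatible with the different representations of a point, is `K`-Lipschitz. -/
lemma dist_le_of_edgewise {M : Type*} [PseudoMetricSpace M] (U : Y.EdgePoint ℓ → M) {K : ℝ}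
    (hvert : ∀ x : Y.EdgePoint ℓ, x.src = x.tgt → dist (U (ofVertex ℓ x.src)) (U x) = 0)
    (hzero : ∀ d, dist (U (ofVertex ℓ d.fst)) (U (onDart ℓ d 0)) = 0)
    (hsymm : ∀ d s, dist (U (onDart ℓ d.symm (unitInterval.symm s))) (U (onDart ℓ d s)) = 0)
    (hedge : ∀ d s s', dist (U (onDart ℓ d s)) (U (onDart ℓ d s'))
      ≤ K * (ℓ.len d.edge * |(s : ℝ) - s'|)) (x y : Y.EdgePoint ℓ) :
    dist (U x) (U y) ≤ K * dist x y := by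
  have hedge' : ∀ d s s', dist (U (onDart ℓ d s)) (U (onDart ℓ d s'))
      ≤ K * dist (onDart ℓ d s) (onDart ℓ d s') := by
    intro d s s'; rw [dist_onDart]; exact hedge d s s'
  let E : Y.EdgePoint ℓ → Y.EdgePoint ℓ → Prop := fun x x' =>
    dist (U x) (U x') = 0 ∧ ∀ d, x.coord d = x'.coord d
  have hErefl : ∀ x, E x x := fun x => ⟨dist_self _, fun _ => rfl⟩
  have hEsymm : ∀ x x', E x x' → E x' x := fun x x' h =>
    ⟨by rw [dist_comm]; exact h.1, fun d => (h.2 d).symm⟩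
  have hEzero : ∀ d, E (ofVertex ℓ d.fst) (onDart ℓ d 0) := fun d =>
    ⟨hzero d, fun d' => (coord_onDart_zero d d').symm⟩
  have hEdart : ∀ d s, E (onDart ℓ d.symm (unitInterval.symm s)) (onDart ℓ d s) := fun d s =>
    ⟨hsymm d s, coord_onDart_symm d s⟩
  have hU : ∀ x x' y y' : Y.EdgePoint ℓ, E x x' → E y y' → dist (U x) (U y) ≤ K * dist x y →
      dist (U x') (U y') ≤ K * dist x' y' := by
    intro x x' y y' ⟨h1, hx⟩ ⟨h2, hy⟩ h
    have h3 : dist x y = dist x' y' := by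
      rw [dist_def, dist_def]; simp only [hx, hy]
    rw [← h3]
    refine le_trans ?_ h
    have t1 := dist_triangle4 (U x') (U x) (U y) (U y')
    rw [dist_comm (U x') (U x)] at t1
    linarith
  have hsplit : ∀ d s (z : Y.EdgePoint ℓ), z.coord d = 0 →
      dist (U (ofVertex ℓ d.fst)) (U z) ≤ K * dist (ofVertex ℓ d.fst) z →
      dist (U (onDart ℓ d s)) (U z) ≤ K * dist (onDart ℓ d s) z := by
    intro d s z hz h
    rw [dist_onDart_of_coord_zero d s hz, mul_add]
    refine (dist_triangle _ (U (onDart ℓ d 0)) _).trans (add_le_add (hedge' d s 0) ?_)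
    exact hU _ _ _ _ (hEzero d) (hErefl _) h
  have hsplit1 : ∀ d s (z : Y.EdgePoint ℓ), z.coord d = 1 →
      dist (U (ofVertex ℓ d.snd)) (U z) ≤ K * dist (ofVertex ℓ d.snd) z →
      dist (U (onDart ℓ d s)) (U z) ≤ K * dist (onDart ℓ d s) z := by
    intro d s z hz h
    refine hU _ _ _ _ (hEdart d s) (hErefl _)
      (hsplit d.symm (unitInterval.symm s) z ?_ h)
    rw [coord_symm, hz, sub_self]
  have hvv : ∀ v w, dist (U (ofVertex ℓ v)) (U (ofVertex ℓ w))
      ≤ K * dist (ofVertex ℓ v) (ofVertex ℓ w) := by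
    intro v w
    obtain ⟨q, hq, -⟩ := Y.isTree.existsUnique_path v w
    induction q with
    | nil => simp
    | @cons a b c h q ih =>
      rw [SimpleGraph.Walk.cons_isPath_iff] at hq
      let d : Y.graph.Dart := ⟨(a, b), h⟩
      have hc : c ∈ Y.side d := by
        suffices ∀ (u w : Y.V) (q : Y.graph.Walk u w), a ∉ q.support → u ∈ Y.side d →
            w ∈ Y.side d from this _ _ q hq.2 (snd_mem_side d)
        intro u w q
        induction q with
        | nil => intro _ h; exact h
        | @cons u u' w h' q ih' =>
          intro ha hu
          rw [SimpleGraph.Walk.support_cons, List.mem_cons, not_or] at ha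
          refine ih' ha.2 ?_
          by_contra hu'
          have h2 := (edge_eq_of_mem_side (Or.inr h') hu hu').2
          exact ha.2 (h2 ▸ q.start_mem_support)
      refine hU _ _ _ _ (hEsymm _ _ (hEzero d)) (hErefl _) (hsplit1 d 0 (ofVertex ℓ c) ?_ ?_)
      · exact coord_ofVertex_of_mem hc
      · exact ih hq.1
  have hvp : ∀ v (z : Y.EdgePoint ℓ), dist (U z) (U (ofVertex ℓ v)) ≤ K * dist z (ofVertex ℓ v) := by
    intro v z
    rcases eq_vertex_or_onDart z with ⟨h', h⟩ | ⟨h, hz⟩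
    · exact hU _ _ _ _ ⟨hvert z h', fun d => (h d).symm⟩ (hErefl _) (hvv z.src v)
    · rw [hz]
      by_cases hv : v ∈ Y.side ⟨(z.src, z.tgt), h⟩
      · exact hsplit1 _ _ _ (coord_ofVertex_of_mem hv) (hvv _ _)
      · exact hsplit _ _ _ (coord_ofVertex_of_notMem hv) (hvv _ _)
  rcases eq_vertex_or_onDart x with ⟨h', h⟩ | ⟨h, hx⟩
  · have := hvp x.src y
    rw [dist_comm, dist_comm y] at this
    exact hU _ _ _ _ ⟨hvert x h', fun d => (h d).symm⟩ (hErefl _) this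
  · have hvy : ∀ v, dist (U (ofVertex ℓ v)) (U y) ≤ K * dist (ofVertex ℓ v) y := by
      intro v
      rw [dist_comm, dist_comm _ y]
      exact hvp v y
    rw [hx]
    by_cases hy0 : y.coord ⟨(x.src, x.tgt), h⟩ = 0
    · exact hsplit _ _ _ hy0 (hvy _)
    by_cases hy1 : y.coord ⟨(x.src, x.tgt), h⟩ = 1
    · exact hsplit1 _ _ _ hy1 (hvy _)
    have he := edge_eq_of_coord hy0 hy1
    rcases eq_vertex_or_onDart y with ⟨h', -⟩ | ⟨h', hy⟩
    · exfalso
      rw [h'] at he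
      have := Sym2.eq_iff.1 (he : s(y.tgt, y.tgt) = s(x.src, x.tgt))
      rcases this with h1 | h1
      · exact h.ne (h1.1.symm.trans h1.2)
      · exact h.ne (h1.2.symm.trans h1.1)
    · rcases (SimpleGraph.dart_edge_eq_iff ⟨(y.src, y.tgt), h'⟩ ⟨(x.src, x.tgt), h⟩).1 he with h1 | h1
      · rw [h1] at hy
        rw [hy]
        exact hedge' _ _ _
      · rw [h1] at hy
        rw [hy]
        have := hEdart ⟨(x.src, x.tgt), h⟩ (unitInterval.symm y.pos)
        rw [unitInterval.symm_symm] at this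
        exact hU _ _ _ _ (hErefl _) (hEsymm _ _ this)
          (hedge' ⟨(x.src, x.tgt), h⟩ x.pos (unitInterval.symm y.pos))

lemma lipschitzWith_of_edgewise {M : Type*} [PseudoMetricSpace M] (U : Y.Realization ℓ → M)
    {K : ℝ≥0} (hedge : ∀ d s s', dist (U (point ℓ d s)) (U (point ℓ d s'))
      ≤ K * (ℓ.len d.edge * |(s : ℝ) - s'|)) : LipschitzWith K U := by
  refine LipschitzWith.of_dist_le_mul fun p q => ?_
  obtain ⟨x, rfl⟩ := SeparationQuotient.surjective_mk p
  obtain ⟨y, rfl⟩ := SeparationQuotient.surjective_mk q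
  rw [dist_mk]
  have hcoord : ∀ x y : Y.EdgePoint ℓ, (∀ d, x.coord d = y.coord d) →
      dist (U (SeparationQuotient.mk x)) (U (SeparationQuotient.mk y)) = 0 := fun x y h => by
    rw [mk_eq_mk_of_coord h, dist_self]
  refine dist_le_of_edgewise (fun x => U (SeparationQuotient.mk x)) (fun x h => hcoord _ _ ?_)
    (fun d => hcoord _ _ fun d' => (coord_onDart_zero d d').symm)
    (fun d s => hcoord _ _ (coord_onDart_symm d s)) hedge x y
  intro d
  rcases eq_vertex_or_onDart x with ⟨-, h'⟩ | ⟨h', -⟩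
  · exact (h' d).symm
  · exact absurd h h'.ne

end FreeTree

/-! ### The action on the metric tree -/

namespace FreeTree

variable {H : Type u} [Group H] {Y : FreeTree H} {ℓ : Y.Lengths}

open EdgePoint

/-- The coordinate along `d`, for a point of the metric tree. -/
noncomputable def outCoord (d : Y.graph.Dart) (p : Y.Realization ℓ) : ℝ := p.out.coord d

lemma len_mul_abs_coord_le (d : Y.graph.Dart) (x y : Y.EdgePoint ℓ) :
    ℓ.len d.edge * |x.coord d - y.coord d| ≤ dist x y := by
  classical
  rw [dist_def, le_div_iff₀ two_pos]
  have h := (x.summable y).sum_le_tsum {d, d.symm}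
    (fun i _ => mul_nonneg (ℓ.nonneg _) (abs_nonneg _))
  rw [Finset.sum_pair (SimpleGraph.Dart.symm_ne d).symm, SimpleGraph.Dart.edge_symm, coord_symm,
    coord_symm, show (1 - x.coord d - (1 - y.coord d)) = -(x.coord d - y.coord d) by ring,
    abs_neg] at h
  linarith

lemma mk_out (p : Y.Realization ℓ) : SeparationQuotient.mk p.out = p := Quotient.out_eq p

lemma len_mul_abs_outCoord_le (d : Y.graph.Dart) (p q : Y.Realization ℓ) :
    ℓ.len d.edge * |outCoord d p - outCoord d q| ≤ dist p q := by
  have := len_mul_abs_coord_le d p.out q.out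
  rw [← dist_mk, mk_out, mk_out] at this
  exact this

lemma realization_fixed_unique (k : H) (p q : Y.Realization ℓ) (hk : k ≠ 1) (hp : k • p = p)
    (hq : k • q = q) : p = q := by
  by_contra hne
  have hT := isTreeMetric Y ℓ
  -- an edge of positive length that separates the two points
  obtain ⟨d, hd⟩ : ∃ d : Y.graph.Dart,
      ℓ.len d.edge * |p.out.coord d - q.out.coord d| ≠ 0 := by
    by_contra! h
    apply hne
    rw [← dist_eq_zero, ← mk_out p, ← mk_out q, dist_mk, dist_def]
    simp [h]
  have hl : 0 < ℓ.len d.edge := (ℓ.nonneg _).lt_of_ne (fun h => hd (by rw [← h, zero_mul]))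
  have hpq : outCoord d p ≠ outCoord d q := by
    intro h
    apply hd
    rw [show p.out.coord d = q.out.coord d from h, sub_self, abs_zero, mul_zero]
  let γ : ℝ → Y.Realization ℓ := geodPoint p q
  have hcont : ContinuousOn (fun r => outCoord d (γ r)) (Set.Icc 0 (dist p q)) := by
    refine LipschitzOnWith.continuousOn (K := (1 / ℓ.len d.edge).toNNReal) ?_
    refine LipschitzOnWith.of_dist_le_mul fun r hr r' hr' => ?_
    rw [Real.coe_toNNReal _ (by positivity), Real.dist_eq, div_mul_eq_mul_div, one_mul,
      le_div_iff₀ hl, mul_comm]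
    refine (len_mul_abs_outCoord_le d _ _).trans (le_of_eq ?_)
    rw [hT.dist_eq_abs (hT.geodPoint_between hr.1 hr.2) (hT.geodPoint_between hr'.1 hr'.2),
      hT.dist_geodPoint hr.1 hr.2, hT.dist_geodPoint hr'.1 hr'.2, Real.dist_eq]
  have hγ0 : γ 0 = p := by
    rw [eq_comm, ← dist_eq_zero]; exact hT.dist_geodPoint le_rfl dist_nonneg
  have hγ1 : γ (dist p q) = q := by
    rw [← dist_eq_zero]; exact (hT.geodPoint_dist dist_nonneg le_rfl).trans (sub_self _)
  have hivt := intermediate_value_uIcc (a := 0) (b := dist p q)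
    (f := fun r => outCoord d (γ r)) (by rwa [Set.uIcc_of_le dist_nonneg])
  rw [Set.uIcc_of_le (dist_nonneg (x := p) (y := q))] at hivt
  simp only [hγ0, hγ1] at hivt
  obtain ⟨r, hr, hmid⟩ := hivt (show (outCoord d p + outCoord d q) / 2 ∈ _ by
    rw [Set.mem_uIcc]
    rcases le_total (outCoord d p) (outCoord d q) with h | h
    · left; constructor <;> linarith
    · right; constructor <;> linarith)
  have hfix : k • γ r = γ r := by
    change k • geodPoint p q r = geodPoint p q r
    rw [hT.smul_geodPoint k hr.1 hr.2, hp, hq]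
  set z := (γ r).out with hz
  have hzr : z.coord d = (outCoord d p + outCoord d q) / 2 := hmid
  have hp0 := p.out.coord_nonneg d
  have hp1 := p.out.coord_le_one d
  have hq0 := q.out.coord_nonneg d
  have hq1 := q.out.coord_le_one d
  have hz0 : z.coord d ≠ 0 := by
    intro h
    apply hpq
    rw [hzr] at h
    change p.out.coord d = q.out.coord d
    have h2 : p.out.coord d + q.out.coord d = 0 := by
      change outCoord d p + outCoord d q = 0; linarith
    linarith
  have hz1 : z.coord d ≠ 1 := by
    intro h
    apply hpq
    rw [hzr] at h
    change p.out.coord d = q.out.coord d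
    have h2 : p.out.coord d + q.out.coord d = 2 := by
      change outCoord d p + outCoord d q = 2; linarith
    linarith
  have hkz : (k • z).coord d = z.coord d := by
    have h1 : dist (k • z) z = 0 := by
      rw [← dist_mk, ← smul_mk, hz, mk_out, hfix, dist_self]
    have h2 := len_mul_abs_coord_le d (k • z) z
    rw [h1] at h2
    have h3 : |(k • z).coord d - z.coord d| ≤ 0 := by
      by_contra! h
      exact absurd h2 (not_le.2 (mul_pos hl h))
    exact sub_eq_zero.1 (abs_eq_zero.1 (le_antisymm h3 (abs_nonneg _)))
  have he := edge_eq_of_coord hz0 hz1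
  have he' := edge_eq_of_coord (x := k • z) (d := d) (by rwa [hkz]) (by rwa [hkz])
  have hadj : Y.graph.Adj z.src z.tgt := by
    rw [← SimpleGraph.mem_edgeSet, he]; exact d.edge_mem
  exact hk (Y.edge_stabilizer k z.src z.tgt hadj (he'.trans he.symm))

lemma continuous_point (d : Y.graph.Dart) : Continuous (point ℓ d) := by
  refine LipschitzWith.continuous (K := NNReal.mk (ℓ.len d.edge) (ℓ.nonneg _)) ?_
  refine LipschitzWith.of_dist_le_mul fun s s' => ?_
  rw [dist_point]; rfl

variable (Y) in
/-- Finitely many oriented edges represent all oriented edges. -/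
lemma exists_finite_darts : ∃ D : Set Y.graph.Dart, D.Finite ∧ ∀ d, ∃ g : H, smulDart g d ∈ D := by
  obtain ⟨F, hF⟩ := Y.cofinite
  refine ⟨{d | (d.fst, d.snd) ∈ F}, ?_, fun d => hF _ _ d.adj⟩
  refine Set.Finite.of_finite_image (f := fun d : Y.graph.Dart => d.toProd)
    (F.finite_toSet.subset ?_) (fun d _ d' _ h => SimpleGraph.Dart.ext d d' h)
  rintro _ ⟨d, hd, rfl⟩
  exact hd

lemma finite_range_of_invariant {β : Type*} {c : Y.graph.Dart → β}
    (hc : ∀ (g : H) d, c (smulDart g d) = c d) : (Set.range c).Finite := by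
  obtain ⟨D, hD, h⟩ := exists_finite_darts Y
  refine (hD.image c).subset ?_
  rintro _ ⟨d, rfl⟩
  obtain ⟨g, hg⟩ := h d
  exact ⟨_, hg, hc g d⟩

lemma exists_bound_of_invariant {c : Y.graph.Dart → ℝ} (hc : ∀ (g : H) d, c (smulDart g d) = c d) :
    ∃ C, 0 ≤ C ∧ ∀ d, c d ≤ C := by
  obtain ⟨C, hC⟩ := (finite_range_of_invariant hc).bddAbove
  exact ⟨max C 0, le_max_right _ _, fun d => (hC ⟨d, rfl⟩).trans (le_max_left _ _)⟩

lemma exists_pos_le_of_finite_range {α : Type*} {c : α → ℝ} (hc : (Set.range c).Finite) :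
    ∃ δ : ℝ, 0 < δ ∧ ∀ a, 0 < c a → δ ≤ c a := by
  have hfin2 : (Set.range c ∩ Set.Ioi 0).Finite := hc.subset Set.inter_subset_left
  rcases (Set.range c ∩ Set.Ioi 0).eq_empty_or_nonempty with he | he
  · refine ⟨1, one_pos, fun d hd => ?_⟩
    have : c d ∈ Set.range c ∩ Set.Ioi 0 := ⟨⟨d, rfl⟩, hd⟩
    rw [he] at this
    exact this.elim
  · obtain ⟨m, hm, hmin⟩ := Set.exists_min_image _ id hfin2 he
    exact ⟨m, hm.2, fun d hd => hmin _ ⟨⟨d, rfl⟩, hd⟩⟩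

lemma exists_pos_bound_of_invariant {c : Y.graph.Dart → ℝ}
    (hc : ∀ (g : H) d, c (smulDart g d) = c d) : ∃ δ : ℝ, 0 < δ ∧ ∀ d, 0 < c d → δ ≤ c d :=
  exists_pos_le_of_finite_range (finite_range_of_invariant hc)

lemma eq_or_exists_adj (o v : Y.V) : v = o ∨ ∃ w, Y.graph.Adj v w := by
  obtain ⟨q⟩ := Y.isTree.connected.preconnected v o
  cases q with
  | nil => exact Or.inl rfl
  | cons h _ => exact Or.inr ⟨_, h⟩

lemma realization_cocompact : ∃ C : Set (Y.Realization ℓ), IsCompact C ∧ ∀ x, ∃ k : H, k • x ∈ C := by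
  obtain ⟨D, hD, h⟩ := exists_finite_darts Y
  obtain ⟨o⟩ := Y.isTree.connected.nonempty
  refine ⟨{vertex ℓ o} ∪ ⋃ d ∈ D, Set.range (point ℓ d), ?_, fun x => ?_⟩
  · refine isCompact_singleton.union (hD.isCompact_biUnion fun d _ => ?_)
    exact isCompact_range (continuous_point d)
  · have hpt : ∀ d s, ∃ k : H, k • point ℓ d s ∈
        {vertex ℓ o} ∪ ⋃ d ∈ D, Set.range (point ℓ d) := by
      intro d s
      obtain ⟨g, hg⟩ := h d
      refine ⟨g, Or.inr ?_⟩
      rw [smul_point]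
      exact Set.mem_biUnion hg ⟨s, rfl⟩
    rcases eq_vertex_or_point x with ⟨v, rfl⟩ | ⟨d, s, rfl⟩
    · rcases eq_or_exists_adj o v with rfl | ⟨w, hw⟩
      · exact ⟨1, Or.inl (by rw [one_smul]; rfl)⟩
      · have := hpt ⟨(v, w), hw⟩ 0
        rwa [point_zero] at this
    · exact hpt d s

/-- Bounded sums of elements of a finite set of non-negative reals take finitely many values. -/
lemma finite_bounded_sums {α : Type*} (W : Set ℝ) (hW : W.Finite) (h0 : ∀ w ∈ W, 0 ≤ w) (R : ℝ) :
    {r : ℝ | r ≤ R ∧ ∃ (s : Finset α) (f : α → ℝ), (∀ a ∈ s, f a ∈ W) ∧ r = ∑ a ∈ s, f a}.Finite := by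
  classical
  have hcard : ∀ n : ℕ, {r : ℝ | ∃ (s : Finset α) (f : α → ℝ), s.card ≤ n ∧ (∀ a ∈ s, f a ∈ W) ∧
      r = ∑ a ∈ s, f a}.Finite := by
    intro n
    induction n with
    | zero =>
      refine (Set.finite_singleton (0 : ℝ)).subset ?_
      rintro r ⟨s, f, hs, -, rfl⟩
      rw [Finset.card_eq_zero.1 (Nat.le_zero.1 hs)]
      simp
    | succ n ih =>
      refine ((ih.union (Set.Finite.image2 (fun a b => a + b) hW ih))).subset ?_
      rintro r ⟨s, f, hs, hf, rfl⟩
      rcases s.eq_empty_or_nonempty with rfl | ⟨a, ha⟩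
      · exact Or.inl ⟨∅, f, by simp, by simp, rfl⟩
      · refine Or.inr ⟨f a, hf a ha, ∑ x ∈ s.erase a, f x, ⟨s.erase a, f, ?_, ?_, rfl⟩, ?_⟩
        · rw [Finset.card_erase_of_mem ha]; omega
        · exact fun b hb => hf b (Finset.mem_of_mem_erase hb)
        · exact Finset.add_sum_erase s f ha
  obtain ⟨m, hm, hmW⟩ : ∃ m : ℝ, 0 < m ∧ ∀ w ∈ W, w ≠ 0 → m ≤ w := by
    rcases (W \ {0}).eq_empty_or_nonempty with he | he
    · refine ⟨1, one_pos, fun w hw hw0 => ?_⟩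
      have : w ∈ W \ {0} := ⟨hw, hw0⟩
      rw [he] at this
      exact this.elim
    · obtain ⟨m, hm, hmin⟩ := Set.exists_min_image _ id (hW.subset Set.sdiff_subset) he
      exact ⟨m, (h0 m hm.1).lt_of_ne (fun h => hm.2 h.symm), fun w hw hw0 => hmin w ⟨hw, hw0⟩⟩
  refine (hcard ⌊R / m⌋₊).subset ?_
  rintro r ⟨hr, s, f, hf, rfl⟩
  refine ⟨s.filter (fun a => f a ≠ 0), f, ?_, fun a ha => hf a (Finset.mem_filter.1 ha).1,
    (Finset.sum_filter_ne_zero s).symm⟩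
  apply Nat.le_floor
  rw [le_div_iff₀ hm]
  refine le_trans ?_ hr
  rw [← Finset.sum_filter_ne_zero s, ← nsmul_eq_mul]
  exact Finset.card_nsmul_le_sum _ _ _
    (fun a ha => hmW _ (hf a (Finset.mem_filter.1 ha).1) (Finset.mem_filter.1 ha).2)

lemma coord_mem (x : Y.EdgePoint ℓ) (d : Y.graph.Dart) :
    x.coord d ∈ ({0, 1, (x.pos : ℝ), 1 - (x.pos : ℝ)} : Set ℝ) := by
  classical
  simp only [coord, Set.indicator_apply, Pi.one_apply]
  split_ifs <;> simp

lemma realization_discrete (p q : Y.Realization ℓ) (R : ℝ) :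
    {r : ℝ | r ≤ R ∧ ∃ k : H, dist p (k • q) = r}.Finite := by
  obtain ⟨x, rfl⟩ := SeparationQuotient.surjective_mk p
  obtain ⟨y, rfl⟩ := SeparationQuotient.surjective_mk q
  let W : Set ℝ := Set.image2 (fun l c => l * c) (Set.range fun d : Y.graph.Dart => ℓ.len d.edge)
    (Set.image2 (fun a b => |a - b|) {0, 1, (x.pos : ℝ), 1 - (x.pos : ℝ)}
      {0, 1, (y.pos : ℝ), 1 - (y.pos : ℝ)})
  have hW : W.Finite := by
    refine Set.Finite.image2 _ (finite_range_of_invariant fun g d => len_smulDart ℓ g d) ?_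
    exact Set.Finite.image2 _ (Set.toFinite _) (Set.toFinite _)
  have h0 : ∀ w ∈ W, 0 ≤ w := by
    rintro _ ⟨_, ⟨d, rfl⟩, _, ⟨a, -, b, -, rfl⟩, rfl⟩
    exact mul_nonneg (ℓ.nonneg _) (abs_nonneg _)
  have hfin := (finite_bounded_sums (α := Y.graph.Dart) W hW h0 (2 * R)).image (fun r => r / 2)
  refine hfin.subset ?_
  rintro r ⟨hr, k, hk⟩
  rw [smul_mk, dist_mk, dist_def] at hk
  refine ⟨2 * r, ⟨by linarith, (x.finite_support (k • y)).toFinset,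
    fun d => ℓ.len d.edge * |x.coord d - (k • y).coord d|, ?_, ?_⟩, by ring⟩
  · intro d _
    exact ⟨_, ⟨d, rfl⟩, _, ⟨_, coord_mem x d, _, coord_mem (k • y) d, rfl⟩, rfl⟩
  · rw [tsum_eq_sum (s := (x.finite_support (k • y)).toFinset)
      (fun d hd => by rwa [Set.Finite.mem_toFinset, Function.notMem_support] at hd)] at hk
    linarith

variable (Y ℓ) in
/-- This holds for arbitrary non-negative edge lengths, in particular for collapsed trees. -/
theorem isTreeAction : IsTreeAction H (Y.Realization ℓ) where
  toIsTreeMetric := isTreeMetric Y ℓ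
  fixed_unique := realization_fixed_unique
  cocompact := realization_cocompact
  discrete := realization_discrete

end FreeTree

/-! ### Equivariant maps on vertices -/

/-- The map `P` is equivariant along the isomorphism `θ`. -/
def IsEquivariant {G K V T : Type*} [Group G] [Group K] [MulAction G V] [MulAction K T]
    (θ : G ≃* K) (P : V → T) : Prop := ∀ (g : G) (v : V), P (g • v) = θ g • P v

namespace FreeTree

open MulAction Filter Topology

variable {G : Type u} [Group G] {Z : FreeTree G}

variable (Z) in
/-- The orbits of vertices. -/
abbrev Orb : Type u := orbitRel.Quotient G Z.V

/-- The orbit of a vertex. -/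
abbrev orb (v : Z.V) : Z.Orb := Quotient.mk'' v

lemma exists_smul_out (v : Z.V) : ∃ g : G, g • (orb v).out = v := by
  have h : (orb v).out ∈ orbit G v := Quotient.exact (Quotient.out_eq (orb v))
  obtain ⟨g, hg⟩ := h
  exact ⟨g⁻¹, by rw [← hg, inv_smul_smul]⟩

lemma orb_smul (g : G) (v : Z.V) : orb (g • v) = orb v := orbitRel.Quotient.quotient_smul_eq

instance : Finite Z.Orb := by
  obtain ⟨D, hD, h⟩ := exists_finite_darts Z
  obtain ⟨o⟩ := Z.isTree.connected.nonempty
  have hfin : ({orb o} ∪ (fun d : Z.graph.Dart => orb d.fst) '' D).Finite :=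
    (Set.finite_singleton _).union (hD.image _)
  refine Set.finite_univ_iff.1 (hfin.subset fun x _ => ?_)
  induction x using Quotient.inductionOn' with
  | h v =>
    rcases eq_or_exists_adj o v with rfl | ⟨w, hw⟩
    · exact Or.inl rfl
    · obtain ⟨g, hg⟩ := h ⟨(v, w), hw⟩
      exact Or.inr ⟨_, hg, orb_smul g v⟩

lemma finite_range_of_invariant_vertex {β : Type*} {c : Z.V → β}
    (hc : ∀ (g : G) v, c (g • v) = c v) : (Set.range c).Finite := by
  refine (Set.finite_range fun x : Z.Orb => c x.out).subset ?_
  rintro _ ⟨v, rfl⟩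
  obtain ⟨g, hg⟩ := exists_smul_out v
  exact ⟨orb v, by rw [← hg, hc, hg]⟩

variable {K : Type*} [Group K] {θ : G ≃* K} {T : Type*} [MulAction K T]

/-- An equivariant map is determined by its values on representatives of the orbits, and these are
arbitrary points that are fixed by the stabilisers. -/
lemma exists_equivariant (θ : G ≃* K) (q : Z.Orb → T)
    (hq : ∀ o, ∀ g ∈ stabilizer G o.out, θ g • q o = q o) :
    ∃ P : Z.V → T, IsEquivariant θ P ∧ ∀ o : Z.Orb, P o.out = q o := by
  choose m hm using fun v : Z.V => exists_smul_out v
  have key : ∀ (v : Z.V) (g : G), g • (orb v).out = v → θ (m v) • q (orb v) = θ g • q (orb v) := by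
    intro v g hg
    have h1 : g⁻¹ * m v ∈ stabilizer G (orb v).out := by
      rw [mem_stabilizer_iff, mul_smul, hm, ← hg, orb_smul, inv_smul_smul]
      congr 1
      exact (Quotient.out_eq (orb v)).symm
    have h2 := hq _ _ h1
    rw [map_mul, mul_smul, map_inv, inv_smul_eq_iff] at h2
    exact h2
  refine ⟨fun v => θ (m v) • q (orb v), fun g v => ?_, fun o => ?_⟩
  · have h1 := key (g • v) (g * m v) (by rw [orb_smul, mul_smul, hm])
    change θ (m (g • v)) • q (orb (g • v)) = θ g • θ (m v) • q (orb v)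
    rw [h1, map_mul, mul_smul, orb_smul]
  · have ho : orb o.out = o := Quotient.out_eq o
    have := key o.out 1 (by rw [ho, one_smul])
    change θ (m o.out) • q (orb o.out) = q o
    rw [this, map_one, one_smul, ho]

variable [MetricSpace T]

/-- The image of a vertex with non-trivial stabiliser is determined. -/
lemma eq_of_stabilizer_ne_bot (hT : IsTreeAction K T) {P Q : Z.V → T} (hP : IsEquivariant θ P)
    (hQ : IsEquivariant θ Q) {v : Z.V} (hv : stabilizer G v ≠ ⊥) : P v = Q v := by
  obtain ⟨⟨g, hg⟩, hg1⟩ := Subgroup.ne_bot_iff_exists_ne_one.1 hv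
  replace hg1 : g ≠ 1 := fun h => hg1 (Subtype.ext h)
  rw [mem_stabilizer_iff] at hg
  refine hT.fixed_unique (θ g) _ _ ?_ ?_ ?_
  · rwa [Ne, map_eq_one_iff θ θ.injective]
  · rw [← hP, hg]
  · rw [← hQ, hg]

variable [IsIsometricSMul K T]

lemma dist_smul_smul_of_equivariant {P Q : Z.V → T} (hP : IsEquivariant θ P)
    (hQ : IsEquivariant θ Q) (g : G) (v w : Z.V) :
    dist (P (g • v)) (Q (g • w)) = dist (P v) (Q w) := by
  rw [hP, hQ, dist_smul]

/-! ### Compactness of the space of equivariant maps -/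

lemma tendsto_min_dist {α : Type*} {l : Filter α} {p q p' q' : α → T} {R x : ℝ}
    (hp : Tendsto (fun n => dist (p n) (p' n)) l (𝓝 0))
    (hq : Tendsto (fun n => dist (q n) (q' n)) l (𝓝 0))
    (h : ∀ n, min (dist (p' n) (q' n)) R = x) :
    Tendsto (fun n => min (dist (p n) (q n)) R) l (𝓝 x) := by
  rw [tendsto_iff_dist_tendsto_zero]
  refine squeeze_zero (fun _ => dist_nonneg) (fun n => ?_) (by simpa using hp.add hq)
  rw [← h n, Real.dist_eq]
  calc |min (dist (p n) (q n)) R - min (dist (p' n) (q' n)) R|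
      ≤ max |dist (p n) (q n) - dist (p' n) (q' n)| |R - R| := abs_min_sub_min_le_max _ _ _ _
    _ ≤ dist (p n) (p' n) + dist (q n) (q' n) := by
        rw [sub_self, abs_zero]
        refine max_le ?_ (by positivity)
        rw [← Real.dist_eq]
        exact dist_dist_dist_le _ _ _ _

/-- Modulo the group, the images of the orbit representatives subconverge.  The values of the
distance functions on the orbits of the limits are discrete, so that a single equivariant map
realises the limits of all distances. -/
lemma exists_limit (hT : IsTreeAction K T) (P : ℕ → Z.V → T) (hP : ∀ n, IsEquivariant θ (P n))
    {F : Z.V → T} (hF : IsEquivariant θ F) (R : ℝ) :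
    ∃ Q : Z.V → T, IsEquivariant θ Q ∧ ∃ ψ : ℕ → ℕ, StrictMono ψ ∧
      (∀ d : Z.graph.Dart, Tendsto (fun n => min (dist (P (ψ n) d.fst) (P (ψ n) d.snd)) R) atTop
        (𝓝 (min (dist (Q d.fst) (Q d.snd)) R))) ∧
      ∀ v, Tendsto (fun n => min (dist (P (ψ n) v) (F v)) R) atTop
        (𝓝 (min (dist (Q v) (F v)) R)) := by
  classical
  obtain ⟨C, hC, hCT⟩ := hT.cocompact
  choose k hk using fun (n : ℕ) (o : Z.Orb) => hCT (P n o.out)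
  obtain ⟨b, -, ψ₁, hψ₁, hb⟩ := (isCompact_univ_pi fun _ : Z.Orb => hC).tendsto_subseq
    (x := fun n o => k n o • P n o.out) (fun n o _ => hk n o)
  rw [tendsto_pi_nhds] at hb
  let B : Z.Orb → T := fun o => if stabilizer G o.out = ⊥ then b o else F o.out
  let κ : ℕ → Z.Orb → K := fun n o => if stabilizer G o.out = ⊥ then (k (ψ₁ n) o)⁻¹ else 1
  have hext : ∀ n, ∃ P' : Z.V → T, IsEquivariant θ P' ∧ ∀ o : Z.Orb, P' o.out = κ n o • B o := by
    intro n
    refine exists_equivariant θ _ fun o g hg => ?_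
    by_cases ho : stabilizer G o.out = ⊥
    · rw [ho, Subgroup.mem_bot] at hg
      rw [hg, map_one, one_smul]
    · simp only [κ, B, if_neg ho, one_smul]
      rw [← hF, mem_stabilizer_iff.1 hg]
  choose P' hP' hP'o using hext
  -- the modified maps are asymptotic to the given ones
  have hasym : ∀ v, Tendsto (fun n => dist (P (ψ₁ n) v) (P' n v)) atTop (𝓝 0) := by
    intro v
    obtain ⟨g, hg⟩ := exists_smul_out v
    rw [← hg]
    simp only [dist_smul_smul_of_equivariant (hP _) (hP' _)]
    by_cases ho : stabilizer G (orb v).out = ⊥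
    · have := hb (orb v)
      rw [tendsto_iff_dist_tendsto_zero] at this
      refine this.congr fun n => ?_
      rw [hP'o]
      simp only [κ, B, if_pos ho, Function.comp]
      rw [← dist_smul (k (ψ₁ n) (orb v)) (P (ψ₁ n) (orb v).out), smul_inv_smul]
    · refine tendsto_const_nhds.congr fun n => ?_
      rw [eq_of_stabilizer_ne_bot hT (hP _) (hP' n) ho, dist_self]
  -- the distances that occur lie in finite sets
  have horb : ∀ v, ∃ x : T, ∀ n, ∃ h : K, P' n v = h • x := by
    intro v
    obtain ⟨g, hg⟩ := exists_smul_out v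
    refine ⟨B (orb v), fun n => ⟨θ g * κ n (orb v), ?_⟩⟩
    rw [← hg, hP', hP'o, mul_smul, hg]
  have hfin : ∀ (x y : T) (p q : ℕ → T), (∀ n, ∃ h : K, p n = h • x) → (∀ n, ∃ h : K, q n = h • y) →
      (Set.range fun n => min (dist (p n) (q n)) R).Finite := by
    intro x y p q hp hq
    refine ((hT.discrete x y R).insert R).subset ?_
    rintro _ ⟨n, rfl⟩
    rcases le_total (dist (p n) (q n)) R with h | h
    · refine Or.inr ⟨min_le_right _ _, ?_⟩
      obtain ⟨h1, hh1⟩ := hp n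
      obtain ⟨h2, hh2⟩ := hq n
      refine ⟨h1⁻¹ * h2, ?_⟩
      change _ = min (dist (p n) (q n)) R
      rw [min_eq_left h, hh1, hh2, mul_smul, ← dist_smul h1, smul_inv_smul]
    · exact Or.inl (min_eq_right h)
  obtain ⟨D, hD, hDd⟩ := exists_finite_darts Z
  have := hD.to_subtype
  let Φ : ℕ → (D ⊕ Z.Orb → ℝ) := fun n => Sum.elim
    (fun d => min (dist (P' n d.1.fst) (P' n d.1.snd)) R)
    (fun o => min (dist (P' n o.out) (F o.out)) R)
  have hΦ : (Set.range Φ).Finite := by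
    refine (Set.Finite.pi (t := fun j => Set.range fun n => Φ n j) fun j => ?_).subset ?_
    · rcases j with d | o
      · obtain ⟨x, hx⟩ := horb d.1.fst
        obtain ⟨y, hy⟩ := horb d.1.snd
        exact hfin x y _ _ hx hy
      · obtain ⟨x, hx⟩ := horb o.out
        exact hfin x (F o.out) _ (fun _ => F o.out) hx (fun _ => ⟨1, (one_smul _ _).symm⟩)
    · rintro _ ⟨n, rfl⟩ j _
      exact ⟨n, rfl⟩
  obtain ⟨c, hc⟩ : ∃ c, ∃ᶠ n in atTop, Φ n = c := by
    by_contra! h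
    have h1 : ∀ᶠ n in atTop, ∀ c ∈ Set.range Φ, Φ n ≠ c :=
      (eventually_all_finite hΦ).2 fun c _ => h c
    obtain ⟨n, hn⟩ := h1.exists
    exact hn _ ⟨n, rfl⟩ rfl
  obtain ⟨ψ₂, hψ₂, hψc⟩ := extraction_of_frequently_atTop hc
  have hasym2 : ∀ v, Tendsto (fun n => dist (P (ψ₁ (ψ₂ n)) v) (P' (ψ₂ n) v)) atTop (𝓝 0) :=
    fun v => (hasym v).comp hψ₂.tendsto_atTop
  refine ⟨P' (ψ₂ 0), hP' _, ψ₁ ∘ ψ₂, hψ₁.comp hψ₂, fun d => ?_, fun v => ?_⟩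
  · refine tendsto_min_dist (hasym2 _) (hasym2 _) fun n => ?_
    obtain ⟨g, hg⟩ := hDd d
    have h1 : Φ (ψ₂ n) (Sum.inl ⟨_, hg⟩) = Φ (ψ₂ 0) (Sum.inl ⟨_, hg⟩) := by rw [hψc, hψc]
    simp only [Φ, Sum.elim_inl, smulDart, dist_smul_smul_of_equivariant (hP' _) (hP' _)] at h1
    exact h1
  · refine tendsto_min_dist (q := fun _ => F v) (q' := fun _ => F v) (hasym2 _) (by simp)
      fun n => ?_
    obtain ⟨g, hg⟩ := exists_smul_out v
    have h1 : Φ (ψ₂ n) (Sum.inr (orb v)) = Φ (ψ₂ 0) (Sum.inr (orb v)) := by rw [hψc, hψc]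
    simp only [Φ, Sum.elim_inr] at h1
    rw [← hg, dist_smul_smul_of_equivariant (hP' _) hF, dist_smul_smul_of_equivariant (hP' _) hF]
    exact h1

/-- The map `P` stretches every edge at most by the factor `L`. -/
def EdgeLip (ℓ : Z.Lengths) (P : Z.V → T) (L : ℝ) : Prop :=
  ∀ d : Z.graph.Dart, dist (P d.fst) (P d.snd) ≤ L * ℓ.len d.edge

lemma exists_edgeLip_of_forall_gt (hT : IsTreeAction K T) {ℓ : Z.Lengths} {L : ℝ} (hL : 0 ≤ L)
    (h : ∀ L' > L, ∃ P : Z.V → T, IsEquivariant θ P ∧ EdgeLip ℓ P L') :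
    ∃ P : Z.V → T, IsEquivariant θ P ∧ EdgeLip ℓ P L := by
  have hn : ∀ n : ℕ, L < L + 1 / ((n : ℝ) + 1) := fun n => by
    have := Nat.one_div_pos_of_nat (α := ℝ) (n := n); linarith
  choose P hP hPL using fun n : ℕ => h _ (hn n)
  obtain ⟨C, hC0, hC⟩ := exists_bound_of_invariant (c := fun d => ℓ.len d.edge) (len_smulDart ℓ)
  obtain ⟨Q, hQ, ψ, hψ, hd, -⟩ := exists_limit hT P hP (hP 0) (L * C + 1)
  refine ⟨Q, hQ, fun d => ?_⟩
  have h1 : min (dist (Q d.fst) (Q d.snd)) (L * C + 1) ≤ L * ℓ.len d.edge := by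
    refine le_of_tendsto_of_tendsto (hd d) (g := fun n => (L + 1 / ((ψ n : ℝ) + 1)) * ℓ.len d.edge)
      ?_ (Eventually.of_forall fun n => (min_le_left _ _).trans (hPL _ d))
    refine Tendsto.mul_const _ ?_
    have := (tendsto_one_div_add_atTop_nhds_zero_nat (𝕜 := ℝ)).comp hψ.tendsto_atTop
    simpa using this.const_add L
  rcases min_le_iff.1 h1 with h2 | h2
  · exact h2
  · have := mul_le_mul_of_nonneg_left (hC d) hL
    linarith

/-- Among the maps with a given stretching factor there is one that is closest to `F`, as measured
by the sum of the distances over the orbits of vertices. -/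
lemma exists_closest [Fintype Z.Orb] (hT : IsTreeAction K T) {ℓ : Z.Lengths} {L : ℝ} (hL : 0 ≤ L)
    {F : Z.V → T} (hF : IsEquivariant θ F)
    (h : ∃ P : Z.V → T, IsEquivariant θ P ∧ EdgeLip ℓ P L) :
    ∃ P : Z.V → T, IsEquivariant θ P ∧ EdgeLip ℓ P L ∧
      ∀ P' : Z.V → T, IsEquivariant θ P' → EdgeLip ℓ P' L →
        ∑ o : Z.Orb, dist (P o.out) (F o.out) ≤ ∑ o : Z.Orb, dist (P' o.out) (F o.out) := by
  let a : (Z.V → T) → ℝ := fun P => ∑ o : Z.Orb, dist (P o.out) (F o.out)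
  let S : Set ℝ := {x | ∃ P : Z.V → T, IsEquivariant θ P ∧ EdgeLip ℓ P L ∧ a P = x}
  have hS0 : ∀ x ∈ S, 0 ≤ x := by
    rintro _ ⟨P, -, -, rfl⟩
    exact Finset.sum_nonneg fun _ _ => dist_nonneg
  have hSb : BddBelow S := ⟨0, hS0⟩
  have hSne : S.Nonempty := by
    obtain ⟨P, hP, hPL⟩ := h
    exact ⟨_, P, hP, hPL, rfl⟩
  have hA0 : 0 ≤ sInf S := le_csInf hSne hS0
  have hn : ∀ n : ℕ, sInf S < sInf S + 1 / ((n : ℝ) + 1) := fun n => by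
    have := Nat.one_div_pos_of_nat (α := ℝ) (n := n); linarith
  choose x hx hxn using fun n => exists_lt_of_csInf_lt hSne (hn n)
  choose P hP hPL hPx using hx
  obtain ⟨C, hC0, hC⟩ := exists_bound_of_invariant (c := fun d => ℓ.len d.edge) (len_smulDart ℓ)
  have hLC : 0 ≤ L * C := mul_nonneg hL hC0
  set R := L * C + sInf S + 2 with hR
  obtain ⟨Q, hQ, ψ, hψ, hd, hv⟩ := exists_limit hT P hP hF R
  have hQL : EdgeLip ℓ Q L := by
    intro d
    have h1 : min (dist (Q d.fst) (Q d.snd)) R ≤ L * ℓ.len d.edge :=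
      le_of_tendsto' (hd d) fun n => (min_le_left _ _).trans (hPL _ d)
    rcases min_le_iff.1 h1 with h2 | h2
    · exact h2
    · have := mul_le_mul_of_nonneg_left (hC d) hL
      linarith
  have hsum : ∑ o : Z.Orb, min (dist (Q o.out) (F o.out)) R ≤ sInf S := by
    refine le_of_tendsto_of_tendsto (tendsto_finsetSum _ fun o _ => hv o.out)
      (g := fun n => sInf S + 1 / ((ψ n : ℝ) + 1)) ?_ (Eventually.of_forall fun n => ?_)
    · have := (tendsto_one_div_add_atTop_nhds_zero_nat (𝕜 := ℝ)).comp hψ.tendsto_atTop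
      simpa using this.const_add (sInf S)
    · refine le_trans (Finset.sum_le_sum fun o _ => min_le_left _ _) ?_
      exact (hPx (ψ n)).trans_le (hxn _).le
  have hR0 : 0 ≤ R := by linarith
  have hmin : ∀ o : Z.Orb, min (dist (Q o.out) (F o.out)) R = dist (Q o.out) (F o.out) := by
    intro o
    rw [min_eq_left_iff]
    by_contra! hlt
    have h1 := Finset.single_le_sum (f := fun o : Z.Orb => min (dist (Q o.out) (F o.out)) R)
      (fun o _ => le_min dist_nonneg hR0) (Finset.mem_univ o)
    simp only [min_eq_right hlt.le] at h1
    linarith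
  simp only [hmin] at hsum
  exact ⟨Q, hQ, hQL, fun P' hP' hPL' => hsum.trans (csInf_le hSb ⟨P', hP', hPL', rfl⟩)⟩

end FreeTree

/-! ### Moving the images of vertices -/

namespace FreeTree

open MulAction Filter Topology

variable {G : Type u} [Group G] {Z : FreeTree G} {K : Type*} [Group K] {θ : G ≃* K}
  {T : Type*} [MetricSpace T] [MulAction K T]

/-- Twice the Gromov product of `Q d.fst` and `P d.snd` at `P d.fst`.  It is positive if, at the
origin of `d`, the direction from `P` to `Q` is the initial direction of the image of `d`. -/
def towards (P Q : Z.V → T) (d : Z.graph.Dart) : ℝ :=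
  dist (P d.fst) (Q d.fst) + dist (P d.fst) (P d.snd) - dist (Q d.fst) (P d.snd)

lemma towards_of_eq {P Q : Z.V → T} {d : Z.graph.Dart} (h : P d.fst = Q d.fst) :
    towards P Q d = 0 := by
  rw [towards, ← h, dist_self]; ring

variable [IsIsometricSMul K T]

lemma towards_smulDart {P Q : Z.V → T} (hP : IsEquivariant θ P) (hQ : IsEquivariant θ Q) (g : G)
    (d : Z.graph.Dart) : towards P Q (smulDart g d) = towards P Q d := by
  simp only [towards, smulDart, dist_smul_smul_of_equivariant hP hQ,
    dist_smul_smul_of_equivariant hP hP, dist_smul_smul_of_equivariant hQ hP]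

lemma dist_smulDart {P : Z.V → T} (hP : IsEquivariant θ P) (g : G) (d : Z.graph.Dart) :
    dist (P (smulDart g d).fst) (P (smulDart g d).snd) = dist (P d.fst) (P d.snd) :=
  dist_smul_smul_of_equivariant hP hP g _ _

/-- A small move of `P` in the direction of `Q` does not lengthen the image of any maximally
stretched edge if, for each such edge with a moving endpoint, one endpoint moves into the image of
the edge. -/
lemma exists_move (hT : IsTreeAction K T) {ℓ : Z.Lengths} (hpos : ℓ.Positive) {L : ℝ} (hL : 0 < L)
    {P Q : Z.V → T} (hP : IsEquivariant θ P) (hQ : IsEquivariant θ Q) (hPL : EdgeLip ℓ P L)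
    (htight : ∀ d : Z.graph.Dart, dist (P d.fst) (P d.snd) = L * ℓ.len d.edge →
      P d.fst ≠ Q d.fst → 0 < towards P Q d ∨ (P d.snd ≠ Q d.snd ∧ 0 < towards P Q d.symm))
    {η : ℝ} (hη : 0 < η) :
    ∃ M : Z.V → T, IsEquivariant θ M ∧ EdgeLip ℓ M L ∧ (∀ v, P v = Q v → M v = P v) ∧
      (∀ v, P v ≠ Q v → dist (M v) (Q v) < dist (P v) (Q v)) ∧ (∀ v, dist (P v) (M v) ≤ η) ∧
      (∀ d : Z.graph.Dart, dist (P d.fst) (P d.snd) < L * ℓ.len d.edge →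
        dist (M d.fst) (M d.snd) < L * ℓ.len d.edge) ∧
      (∀ d : Z.graph.Dart, dist (P d.fst) (P d.snd) = L * ℓ.len d.edge → 0 < towards P Q d →
        (P d.snd = Q d.snd ∨ 0 < towards P Q d.symm) →
        dist (M d.fst) (M d.snd) < L * ℓ.len d.edge) := by
  obtain ⟨δ₁, hδ₁, h₁⟩ := exists_pos_le_of_finite_range
    (finite_range_of_invariant_vertex (c := fun v : Z.V => dist (P v) (Q v))
      fun g v => dist_smul_smul_of_equivariant hP hQ g v v)
  obtain ⟨δ₂, hδ₂, h₂⟩ := exists_pos_le_of_finite_range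
    (finite_range_of_invariant (c := towards P Q) (towards_smulDart hP hQ))
  obtain ⟨δ₃, hδ₃, h₃⟩ := exists_pos_le_of_finite_range
    (finite_range_of_invariant
      (c := fun d : Z.graph.Dart => L * ℓ.len d.edge - dist (P d.fst) (P d.snd))
      fun g d => by rw [dist_smulDart hP, len_smulDart])
  obtain ⟨δ₄, hδ₄, h₄⟩ := exists_pos_le_of_finite_range
    (finite_range_of_invariant (c := fun d : Z.graph.Dart => L * ℓ.len d.edge)
      fun g d => by rw [len_smulDart])
  obtain ⟨δ, hδ, hδη, hδ1, hδ2, hδ3, hδ4⟩ : ∃ δ : ℝ, 0 < δ ∧ δ ≤ η ∧ δ ≤ δ₁ ∧ δ ≤ δ₂ / 2 ∧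
      δ ≤ δ₃ / 3 ∧ δ ≤ δ₄ / 2 := by
    refine ⟨min η (min δ₁ (min (δ₂ / 2) (min (δ₃ / 3) (δ₄ / 2)))), ?_, ?_⟩
    · simp only [lt_min_iff]; refine ⟨hη, hδ₁, ?_, ?_, ?_⟩ <;> positivity
    · simp
  let M : Z.V → T := fun v => geodPoint (P v) (Q v) (min δ (dist (P v) (Q v)))
  have hr0 : ∀ v, 0 ≤ min δ (dist (P v) (Q v)) := fun v => le_min hδ.le dist_nonneg
  have hr1 : ∀ v, min δ (dist (P v) (Q v)) ≤ dist (P v) (Q v) := fun v => min_le_right _ _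
  have hM : IsEquivariant θ M := by
    intro g v
    change geodPoint _ _ _ = θ g • geodPoint _ _ _
    rw [hT.smul_geodPoint _ (hr0 v) (hr1 v), dist_smul_smul_of_equivariant hP hQ, hP, hQ]
  have hPM : ∀ v, dist (P v) (M v) = min δ (dist (P v) (Q v)) :=
    fun v => hT.dist_geodPoint (hr0 v) (hr1 v)
  have hMQ : ∀ v, dist (M v) (Q v) = dist (P v) (Q v) - min δ (dist (P v) (Q v)) :=
    fun v => hT.geodPoint_dist (hr0 v) (hr1 v)
  have hPMle : ∀ v, dist (P v) (M v) ≤ δ := fun v => (hPM v).trans_le (min_le_left _ _)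
  have hstay : ∀ v, P v = Q v → M v = P v := by
    intro v hv
    rw [eq_comm, ← dist_eq_zero, hPM, hv, dist_self]
    exact min_eq_right hδ.le
  have hmoved : ∀ v, P v ≠ Q v → min δ (dist (P v) (Q v)) = δ := fun v hv =>
    min_eq_left (hδ1.trans (h₁ v (dist_pos.2 hv)))
  have hto : ∀ d : Z.graph.Dart, 0 < towards P Q d →
      dist (P d.fst) (M d.fst) = δ ∧ dist (M d.fst) (P d.snd) = dist (P d.fst) (P d.snd) - δ := by
    intro d hd
    have hne : P d.fst ≠ Q d.fst := fun h => hd.ne' (towards_of_eq h)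
    have e1 : dist (P d.fst) (M d.fst) = δ := by rw [hPM, hmoved _ hne]
    refine ⟨e1, ?_⟩
    have h2 := h₂ d hd
    have := hT.between_of_between (o := P d.fst) (a := Q d.fst) (b := P d.snd) (c := M d.fst)
      (hT.geodPoint_between (hr0 _) (hr1 _)) (by rw [e1]; unfold towards at h2; linarith)
    linarith
  have hstrict : ∀ d : Z.graph.Dart, dist (P d.fst) (P d.snd) < L * ℓ.len d.edge →
      dist (M d.fst) (M d.snd) < L * ℓ.len d.edge := by
    intro d hd
    have h3 := h₃ d (sub_pos.2 hd)
    have t := dist_triangle4 (M d.fst) (P d.fst) (P d.snd) (M d.snd)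
    rw [dist_comm (M d.fst) (P d.fst)] at t
    have := hPMle d.fst
    have := hPMle d.snd
    linarith
  have hsymm : ∀ d : Z.graph.Dart, dist (P d.symm.fst) (P d.symm.snd) = dist (P d.fst) (P d.snd) :=
    fun d => dist_comm _ _
  have hle : ∀ d : Z.graph.Dart, 0 < towards P Q d →
      dist (M d.fst) (M d.snd) ≤ dist (P d.fst) (P d.snd) := by
    intro d h
    have := (hto d h).2
    have t := dist_triangle (M d.fst) (P d.snd) (M d.snd)
    have := hPMle d.snd
    linarith
  have hle' : ∀ d : Z.graph.Dart, 0 < towards P Q d.symm →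
      dist (M d.fst) (M d.snd) ≤ dist (P d.fst) (P d.snd) := by
    intro d h
    rw [dist_comm (M d.fst), dist_comm (P d.fst)]
    exact hle d.symm h
  refine ⟨M, hM, fun d => ?_, hstay, fun v hv => ?_, fun v => (hPMle v).trans hδη, hstrict,
    fun d hd h1 h2 => ?_⟩
  · rcases (hPL d).lt_or_eq with h | h
    · exact (hstrict d h).le
    rw [← h]
    by_cases hf : P d.fst = Q d.fst
    · by_cases hs : P d.snd = Q d.snd
      · rw [hstay _ hf, hstay _ hs]
      · rcases htight d.symm (by rw [hsymm, SimpleGraph.Dart.edge_symm, h]) hs with h' | ⟨h', -⟩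
        · exact hle' d h'
        · exact absurd hf h'
    · rcases htight d h hf with h' | ⟨-, h'⟩
      · exact hle d h'
      · exact hle' d h'
  · rw [hMQ, hmoved v hv]; linarith
  · rw [← hd]
    obtain ⟨e1, e2⟩ := hto d h1
    have h4 := h₄ d (mul_pos hL (hpos _ d.edge_mem))
    rcases h2 with h2 | h2
    · rw [hstay _ h2]; linarith
    · obtain ⟨e3, e4⟩ := hto d.symm h2
      change dist (P d.snd) (M d.snd) = δ at e3
      change dist (M d.snd) (P d.fst) = dist (P d.snd) (P d.fst) - δ at e4
      rw [dist_comm (M d.snd), dist_comm (P d.snd)] at e4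
      rw [dist_comm (P d.snd)] at e3
      rw [hT.dist_eq_abs (a := P d.fst) (b := P d.snd) (by linarith) (by linarith), e1, e4, abs_lt]
      constructor <;> linarith

/-! ### Distance to the maps with a smaller stretching factor -/

/-- If `F` stretches each edge by an amount `ε` more than allowed at most, then the closest map with
the required stretching factor is at distance at most `ε` times the number of orbits of vertices.
Otherwise there is a gap of more than `ε` between the distances of `P` and `F` at different
vertices, and `P` can be moved towards `F` at all vertices above the gap. -/
lemma dist_le_of_closest [Fintype Z.Orb] (hT : IsTreeAction K T) {ℓ : Z.Lengths}
    (hpos : ℓ.Positive) {L : ℝ} (hL : 0 < L) {P F : Z.V → T} (hP : IsEquivariant θ P)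
    (hF : IsEquivariant θ F) (hPL : EdgeLip ℓ P L)
    (hmin : ∀ P' : Z.V → T, IsEquivariant θ P' → EdgeLip ℓ P' L →
        ∑ o : Z.Orb, dist (P o.out) (F o.out) ≤ ∑ o : Z.Orb, dist (P' o.out) (F o.out))
    {ε : ℝ} (hε : 0 ≤ ε)
    (hFL : ∀ d : Z.graph.Dart, dist (F d.fst) (F d.snd) ≤ L * ℓ.len d.edge + ε) (v : Z.V) :
    dist (P v) (F v) ≤ Fintype.card Z.Orb * ε := by
  classical
  by_contra! hv
  set a : Z.V → ℝ := fun v => dist (P v) (F v) with ha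
  have hainv : ∀ (g : G) v, a (g • v) = a v :=
    fun g v => dist_smul_smul_of_equivariant hP hF g v v
  have haorb : ∀ v, a (orb v).out = a v := fun v => by
    obtain ⟨g, hg⟩ := exists_smul_out v
    rw [← hainv g, hg]
  obtain ⟨c, hεc, hcv, hgap⟩ : ∃ c, ε ≤ c ∧ c < a v ∧ ∀ w, a w ≤ c → a w ≤ c - ε := by
    by_contra! hcon
    have hk : ∀ k : Fin (Fintype.card Z.Orb), ((k : ℝ) + 1) * ε ≤ Fintype.card Z.Orb * ε := by
      intro k
      refine mul_le_mul_of_nonneg_right ?_ hε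
      exact_mod_cast k.2
    have h2 : ∀ k : Fin (Fintype.card Z.Orb), ∃ w, a w ≤ ((k : ℝ) + 1) * ε ∧ (k : ℝ) * ε < a w := by
      intro k
      obtain ⟨w, h1, h2⟩ := hcon (((k : ℝ) + 1) * ε)
        (by nlinarith [(Nat.cast_nonneg (k : ℕ) : (0 : ℝ) ≤ (k : ℕ))]) ((hk k).trans_lt hv)
      exact ⟨w, h1, by linarith⟩
    choose w hw1 hw2 using h2
    have hinj : Function.Injective fun k => orb (w k) := by
      intro k k' h
      have h3 : a (w k) = a (w k') := by
        rw [← haorb (w k), ← haorb (w k')]; exact congrArg (fun o : Z.Orb => a o.out) h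
      have key : ∀ i j : Fin (Fintype.card Z.Orb), a (w i) = a (w j) → ¬ i < j := by
        intro i j hij hlt
        have h5 : ((i : ℝ) + 1) * ε ≤ (j : ℝ) * ε :=
          mul_le_mul_of_nonneg_right (by exact_mod_cast hlt) hε
        have := hw1 i
        have := hw2 j
        linarith
      exact le_antisymm (not_lt.1 (key _ _ h3.symm)) (not_lt.1 (key _ _ h3))
    have hsurj := ((Fintype.bijective_iff_injective_and_card _).2 ⟨hinj, Fintype.card_fin _⟩).2
    obtain ⟨k, hk'⟩ := hsurj (orb v)
    have h3 : a (w k) = a v := by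
      rw [← haorb (w k), ← haorb v]; exact congrArg (fun o : Z.Orb => a o.out) hk'
    have := hw1 k
    have := hk k
    rw [h3] at *
    linarith
  let Q : Z.V → T := fun w => if c < a w then F w else P w
  have hQ : IsEquivariant θ Q := by
    intro g w
    simp only [Q, hainv]
    split_ifs
    · exact hF g w
    · exact hP g w
  have hmv : ∀ w, P w ≠ Q w ↔ c < a w := by
    intro w
    by_cases h : c < a w
    · simp only [Q, if_pos h, h, iff_true]
      exact dist_pos.1 (lt_of_le_of_lt (hε.trans hεc) h)
    · simp [Q, if_neg h, h]
  have hQF : ∀ w, c < a w → Q w = F w := fun w h => if_pos h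
  have htight : ∀ d : Z.graph.Dart, dist (P d.fst) (P d.snd) = L * ℓ.len d.edge →
      P d.fst ≠ Q d.fst → 0 < towards P Q d ∨ (P d.snd ≠ Q d.snd ∧ 0 < towards P Q d.symm) := by
    intro d hd hm
    have hx := (hmv _).1 hm
    have hFd := hFL d
    rw [← hd] at hFd
    by_cases hy : c < a d.snd
    · by_contra! hcon
      have h1 := hcon.1
      have h2 := hcon.2 ((hmv _).2 hy)
      rw [towards, hQF _ hx] at h1
      rw [towards] at h2
      change dist (P d.snd) (Q d.snd) + dist (P d.snd) (P d.fst) - dist (Q d.snd) (P d.fst) ≤ 0 at h2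
      rw [hQF _ hy] at h2
      have hx' : dist (P d.fst) (F d.fst) = a d.fst := rfl
      have hy' : dist (P d.snd) (F d.snd) = a d.snd := rfl
      have hD : 0 < dist (P d.fst) (P d.snd) := by
        rw [hd]; exact mul_pos hL (hpos _ d.edge_mem)
      have t1 := dist_triangle (F d.fst) (P d.fst) (P d.snd)
      have t2 := dist_triangle (F d.snd) (P d.snd) (P d.fst)
      have e1 := dist_comm (F d.fst) (P d.fst)
      have e2 := dist_comm (F d.snd) (P d.snd)
      have e3 := dist_comm (P d.snd) (P d.fst)
      have e4 := dist_comm (F d.snd) (P d.fst)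
      have := hT.between_concat (x := F d.fst) (y := P d.fst) (z := P d.snd) (w := F d.snd)
        (by linarith) (by linarith) hD
      linarith
    · left
      have hy2 := hgap _ (not_lt.1 hy)
      have t := dist_triangle (F d.fst) (F d.snd) (P d.snd)
      rw [dist_comm (F d.snd)] at t
      rw [towards, hQF _ hx]
      have hx' : dist (P d.fst) (F d.fst) = a d.fst := rfl
      have hy' : dist (P d.snd) (F d.snd) = a d.snd := rfl
      linarith
  obtain ⟨M, hM, hML, hstay, hcl, -, -, -⟩ := exists_move hT hpos hL hP hQ hPL htight one_pos
  refine absurd (hmin M hM hML) (not_le.2 ?_)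
  refine Finset.sum_lt_sum (fun o _ => ?_) ⟨orb v, Finset.mem_univ _, ?_⟩
  · by_cases h : c < a o.out
    · have := hcl _ ((hmv _).2 h)
      rw [hQF _ h] at this
      exact this.le
    · rw [hstay _ (not_not.1 (fun h' => h ((hmv _).1 h')))]
  · have h : c < a (orb v).out := by rwa [haorb]
    have := hcl _ ((hmv _).2 h)
    rwa [hQF _ h] at this

/-! ### Removing one-gated vertices -/

/-- The maximally stretched edges at a vertex with non-trivial stabiliser have different
images under the stabiliser. -/
lemma exists_dist_eq_add_of_stabilizer (hT : IsTreeAction K T) {P : Z.V → T}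
    (hP : IsEquivariant θ P) {d : Z.graph.Dart} (hs : stabilizer G d.fst ≠ ⊥) :
    ∃ g : G, g • d.fst = d.fst ∧ dist (P d.snd) (P (g • d.snd))
      = dist (P d.fst) (P d.snd) + dist (P d.fst) (P (g • d.snd)) := by
  obtain ⟨⟨g, hg⟩, hg1⟩ := Subgroup.ne_bot_iff_exists_ne_one.1 hs
  replace hg1 : g ≠ 1 := fun h => hg1 (Subtype.ext h)
  rw [mem_stabilizer_iff] at hg
  refine ⟨g, hg, ?_⟩
  have hfix : θ g • P d.fst = P d.fst := by rw [← hP, hg]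
  have hD : dist (P d.fst) (P (g • d.snd)) = dist (P d.fst) (P d.snd) := by
    conv_lhs => rw [hP, ← hfix, dist_smul]
  have t := dist_triangle (P d.snd) (P d.fst) (P (g • d.snd))
  rw [dist_comm (P d.snd) (P d.fst)] at t
  refine le_antisymm t ?_
  by_contra! hlt
  set r := (dist (P d.fst) (P d.snd) + dist (P d.fst) (P (g • d.snd))
    - dist (P d.snd) (P (g • d.snd))) / 2 with hr
  have hr0 : 0 < r := by linarith
  have hr1 : r ≤ dist (P d.fst) (P d.snd) := by
    have := dist_nonneg (x := P d.snd) (y := P (g • d.snd)); linarith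
  set c := geodPoint (P d.fst) (P d.snd) r with hc
  have hcr : dist (P d.fst) c = r := hT.dist_geodPoint hr0.le hr1
  have h1 := hT.between_of_between (b := P (g • d.snd)) (hT.geodPoint_between hr0.le hr1)
    (by rw [← hc, hcr]; linarith)
  have h2 := hT.eq_geodPoint h1
  rw [← hc, hcr] at h2
  have h3 : θ g • c = c := by
    conv_lhs => rw [hc, hT.smul_geodPoint _ hr0.le hr1, hfix, ← hP, ← h2]
  have h4 := hT.fixed_unique (θ g) _ _ (by rwa [Ne, map_eq_one_iff θ θ.injective]) hfix h3
  rw [← h4, dist_self] at hcr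
  exact hr0.ne hcr

/-- At a one-gated vertex of the tension graph, a small move in the direction of the gate
removes edges from the tension graph, and does not add any. -/
lemma exists_move_of_one_gated (hT : IsTreeAction K T) {ℓ : Z.Lengths} (hpos : ℓ.Positive) {L : ℝ}
    (hL : 0 < L) {P : Z.V → T} (hP : IsEquivariant θ P) (hPL : EdgeLip ℓ P L) {d₀ : Z.graph.Dart}
    (hd₀ : dist (P d₀.fst) (P d₀.snd) = L * ℓ.len d₀.edge)
    (hgate : ∀ d : Z.graph.Dart, dist (P d.fst) (P d.snd) = L * ℓ.len d.edge → d.fst = d₀.fst →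
      dist (P d₀.snd) (P d.snd) ≠ dist (P d₀.fst) (P d₀.snd) + dist (P d₀.fst) (P d.snd))
    {η : ℝ} (hη : 0 < η) :
    ∃ M : Z.V → T, IsEquivariant θ M ∧ EdgeLip ℓ M L ∧ (∀ v, dist (P v) (M v) ≤ η) ∧
      (∀ d : Z.graph.Dart, dist (M d.fst) (M d.snd) = L * ℓ.len d.edge →
        dist (P d.fst) (P d.snd) = L * ℓ.len d.edge) ∧
      dist (M d₀.fst) (M d₀.snd) ≠ L * ℓ.len d₀.edge := by
  classical
  have hfree : stabilizer G d₀.fst = ⊥ := by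
    by_contra hs
    obtain ⟨g, hg, h⟩ := exists_dist_eq_add_of_stabilizer hT hP hs
    exact hgate (smulDart g d₀) (by rw [dist_smulDart hP, len_smulDart, hd₀]) hg h
  have huniq : ∀ g g' : G, g • d₀.fst = g' • d₀.fst → g = g' := by
    intro g g' h
    have : g'⁻¹ * g ∈ stabilizer G d₀.fst := by
      rw [mem_stabilizer_iff, mul_smul, h, inv_smul_smul]
    rw [hfree, Subgroup.mem_bot] at this
    exact (inv_mul_eq_one.1 this).symm
  let Q : Z.V → T := fun u =>
    if h : ∃ g : G, g • d₀.fst = u then P (h.choose • d₀.snd) else P u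
  have hQg : ∀ g : G, Q (g • d₀.fst) = P (g • d₀.snd) := by
    intro g
    have h : ∃ g' : G, g' • d₀.fst = g • d₀.fst := ⟨g, rfl⟩
    simp only [Q, dif_pos h]
    rw [huniq _ _ h.choose_spec]
  have hQn : ∀ u, (¬ ∃ g : G, g • d₀.fst = u) → Q u = P u := fun u h => dif_neg h
  have hQ : IsEquivariant θ Q := by
    intro g u
    by_cases h : ∃ g' : G, g' • d₀.fst = u
    · obtain ⟨g', rfl⟩ := h
      rw [← mul_smul, hQg, hQg, mul_smul, hP]
    · rw [hQn u h, hQn, hP]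
      rintro ⟨g', hg'⟩
      exact h ⟨g⁻¹ * g', by rw [mul_smul, hg', inv_smul_smul]⟩
  have hto : ∀ d : Z.graph.Dart, dist (P d.fst) (P d.snd) = L * ℓ.len d.edge →
      P d.fst ≠ Q d.fst → 0 < towards P Q d := by
    intro d hd hm
    have h : ∃ g : G, g • d₀.fst = d.fst := by
      by_contra h
      exact hm (hQn _ h).symm
    obtain ⟨g, hg⟩ := h
    rw [← towards_smulDart hP hQ g⁻¹]
    have hfst : (smulDart g⁻¹ d).fst = d₀.fst := by
      change g⁻¹ • d.fst = d₀.fst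
      rw [← hg, inv_smul_smul]
    have h1 := hgate (smulDart g⁻¹ d) (by rw [dist_smulDart hP, len_smulDart, hd]) hfst
    have h2 := hQg 1
    rw [one_smul, one_smul] at h2
    rw [towards, hfst, h2]
    have t := dist_triangle (P d₀.snd) (P d₀.fst) (P (smulDart g⁻¹ d).snd)
    rw [dist_comm (P d₀.snd) (P d₀.fst)] at t
    have := lt_of_le_of_ne t h1
    linarith
  obtain ⟨M, hM, hML, -, -, hMη, hstrict, hless⟩ := exists_move hT hpos hL hP hQ hPL
    (fun d hd hm => Or.inl (hto d hd hm)) hη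
  refine ⟨M, hM, hML, hMη, fun d hd => ?_, ?_⟩
  · by_contra hne
    exact (hstrict d (lt_of_le_of_ne (hPL d) hne)).ne hd
  · refine (hless d₀ hd₀ (hto d₀ hd₀ ?_) ?_).ne
    · have h2 := hQg 1
      rw [one_smul, one_smul] at h2
      rw [h2, ← dist_pos, hd₀]
      exact mul_pos hL (hpos _ d₀.edge_mem)
    · by_cases hs : P d₀.snd = Q d₀.snd
      · exact Or.inl hs
      · refine Or.inr (hto d₀.symm ?_ hs)
        rw [SimpleGraph.Dart.edge_symm, ← hd₀]
        exact dist_comm _ _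

/-- Arbitrarily close to a map there is a map with the same bound on the stretching factor, whose
tension graph has no one-gated vertex. -/
lemma exists_not_one_gated (hT : IsTreeAction K T) {ℓ : Z.Lengths} (hpos : ℓ.Positive) {L : ℝ}
    (hL : 0 < L) {P : Z.V → T} (hP : IsEquivariant θ P) (hPL : EdgeLip ℓ P L) {η : ℝ}
    (hη : 0 < η) :
    ∃ M : Z.V → T, IsEquivariant θ M ∧ EdgeLip ℓ M L ∧ (∀ v, dist (P v) (M v) ≤ η) ∧
      ∀ d : Z.graph.Dart, dist (M d.fst) (M d.snd) = L * ℓ.len d.edge →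
        ∃ d' : Z.graph.Dart, dist (M d'.fst) (M d'.snd) = L * ℓ.len d'.edge ∧ d'.fst = d.fst ∧
          dist (M d.snd) (M d'.snd) = dist (M d.fst) (M d.snd) + dist (M d.fst) (M d'.snd) := by
  obtain ⟨D, hD, hDd⟩ := exists_finite_darts Z
  let tight : (Z.V → T) → Set Z.graph.Dart :=
    fun P => {d | d ∈ D ∧ dist (P d.fst) (P d.snd) = L * ℓ.len d.edge}
  have hfin : ∀ P, (tight P).Finite := fun P => hD.subset fun d hd => hd.1
  induction hn : (tight P).ncard using Nat.strong_induction_on generalizing P η with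
  | _ n ih =>
    by_cases hgood : ∀ d : Z.graph.Dart, dist (P d.fst) (P d.snd) = L * ℓ.len d.edge →
        ∃ d' : Z.graph.Dart, dist (P d'.fst) (P d'.snd) = L * ℓ.len d'.edge ∧ d'.fst = d.fst ∧
          dist (P d.snd) (P d'.snd) = dist (P d.fst) (P d.snd) + dist (P d.fst) (P d'.snd)
    · exact ⟨P, hP, hPL, fun v => by rw [dist_self]; exact hη.le, hgood⟩
    · push Not at hgood
      obtain ⟨d₀, hd₀, hgate⟩ := hgood
      obtain ⟨M, hM, hML, hMη, hsub, hne⟩ :=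
        exists_move_of_one_gated hT hpos hL hP hPL hd₀ hgate (half_pos hη)
      have hlt : (tight M).ncard < n := by
        rw [← hn]
        refine Set.ncard_lt_ncard ⟨fun d hd => ⟨hd.1, hsub d hd.2⟩, fun hcon => ?_⟩ (hfin P)
        obtain ⟨g, hg⟩ := hDd d₀
        have h1 := (hcon ⟨hg, by rw [dist_smulDart hP, len_smulDart, hd₀]⟩).2
        rw [dist_smulDart hM, len_smulDart] at h1
        exact hne h1
      obtain ⟨M', hM', hML', hMη', hM'g⟩ := ih _ hlt hM hML (half_pos hη) rfl
      refine ⟨M', hM', hML', fun v => ?_, hM'g⟩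
      have := dist_triangle (P v) (M v) (M' v)
      have := hMη v
      have := hMη' v
      linarith

end FreeTree

/-! ### Straight maps -/

namespace FreeTree

variable {G : Type u} [Group G] {Z : FreeTree G} {K : Type*} [Group K] {θ : G ≃* K}
  {T : Type*} [MetricSpace T]

/-- The point at the fraction `s` of the way from `a` to `b`. -/
noncomputable def geodFraction (a b : T) (s : ℝ) : T := geodPoint a b (s * dist a b)

lemma fraction_mem (a b : T) (s : unitInterval) :
    0 ≤ (s : ℝ) * dist a b ∧ (s : ℝ) * dist a b ≤ dist a b :=
  ⟨mul_nonneg s.2.1 dist_nonneg, mul_le_of_le_one_left dist_nonneg s.2.2⟩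

lemma dist_geodFraction_left (hT : IsTreeMetric T) (a b : T) (s : unitInterval) :
    dist a (geodFraction a b s) = s * dist a b :=
  hT.dist_geodPoint (fraction_mem a b s).1 (fraction_mem a b s).2

lemma dist_geodFraction_right (hT : IsTreeMetric T) (a b : T) (s : unitInterval) :
    dist (geodFraction a b s) b = (1 - s) * dist a b := by
  rw [geodFraction, hT.geodPoint_dist (fraction_mem a b s).1 (fraction_mem a b s).2]; ring

lemma geodFraction_between (hT : IsTreeMetric T) (a b : T) (s : unitInterval) :
    dist a (geodFraction a b s) + dist (geodFraction a b s) b = dist a b := by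
  rw [dist_geodFraction_left hT, dist_geodFraction_right hT]; ring

lemma dist_geodFraction (hT : IsTreeMetric T) (a b : T) (s s' : unitInterval) :
    dist (geodFraction a b s) (geodFraction a b s') = |(s : ℝ) - s'| * dist a b := by
  rw [hT.dist_eq_abs (geodFraction_between hT a b s) (geodFraction_between hT a b s'),
    dist_geodFraction_left hT, dist_geodFraction_left hT, ← sub_mul, abs_mul,
    abs_of_nonneg (dist_nonneg (x := a))]

lemma geodFraction_zero (hT : IsTreeMetric T) (a b : T) : geodFraction a b 0 = a := by
  rw [eq_comm, ← dist_eq_zero]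
  simpa using dist_geodFraction_left hT a b 0

lemma geodFraction_self (hT : IsTreeMetric T) (a : T) (s : unitInterval) :
    geodFraction a a s = a := by
  rw [eq_comm, ← dist_eq_zero, dist_geodFraction_left hT, dist_self, mul_zero]

lemma geodFraction_symm (hT : IsTreeMetric T) (a b : T) (s : unitInterval) :
    geodFraction b a (unitInterval.symm s) = geodFraction a b s := by
  have h1 := geodFraction_between hT b a (unitInterval.symm s)
  refine hT.eq_of_between (a := a) (b := b) ?_ (geodFraction_between hT a b s) ?_
  · rw [dist_comm a, dist_comm _ b, dist_comm a b]; linarith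
  · rw [dist_comm a, dist_geodFraction_right hT, dist_geodFraction_left hT, dist_comm b a]
    simp

lemma smul_geodFraction [MulAction K T] [IsIsometricSMul K T] (hT : IsTreeMetric T) (k : K)
    (a b : T) (s : unitInterval) :
    k • geodFraction a b s = geodFraction (k • a) (k • b) s := by
  rw [geodFraction, hT.smul_geodPoint k (fraction_mem a b s).1 (fraction_mem a b s).2,
    geodFraction, dist_smul]

open EdgePoint in
/-- The straight extension of a map that is defined on the vertices. -/
lemma exists_extension (hT : IsTreeMetric T) {ℓ : Z.Lengths} {L : ℝ≥0} {P : Z.V → T}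
    (hPL : EdgeLip ℓ P L) : ∃ U : Z.Realization ℓ → T, LipschitzWith L U ∧
      ∀ x : Z.EdgePoint ℓ, U (SeparationQuotient.mk x) = geodFraction (P x.src) (P x.tgt) x.pos := by
  have hlip : ∀ x y : Z.EdgePoint ℓ, dist (geodFraction (P x.src) (P x.tgt) x.pos)
      (geodFraction (P y.src) (P y.tgt) y.pos) ≤ L * dist x y := by
    refine dist_le_of_edgewise (fun x : Z.EdgePoint ℓ => geodFraction (P x.src) (P x.tgt) x.pos)
      (fun x hx => ?_) (fun d => ?_) (fun d s => ?_) (fun d s s' => ?_)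
    · rw [dist_eq_zero]
      change geodFraction _ _ ((0 : unitInterval) : ℝ) = _
      rw [← hx, geodFraction_self hT, geodFraction_self hT]
    · rw [dist_eq_zero]
      change geodFraction _ _ ((0 : unitInterval) : ℝ) = geodFraction _ _ ((0 : unitInterval) : ℝ)
      rw [Set.Icc.coe_zero, geodFraction_zero hT, geodFraction_zero hT]
    · rw [dist_eq_zero]
      exact geodFraction_symm hT (P d.fst) (P d.snd) s
    · change dist (geodFraction (P d.fst) (P d.snd) s) (geodFraction (P d.fst) (P d.snd) s') ≤ _
      rw [dist_geodFraction hT, mul_comm, ← mul_assoc]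
      exact mul_le_mul_of_nonneg_right (hPL d) (abs_nonneg _)
  refine ⟨SeparationQuotient.lift (fun x : Z.EdgePoint ℓ => geodFraction (P x.src) (P x.tgt) x.pos)
    (fun x y hxy => ?_), LipschitzWith.of_dist_le_mul fun p q => ?_, fun x => rfl⟩
  · rw [Metric.inseparable_iff] at hxy
    have := hlip x y
    rw [hxy, mul_zero] at this
    exact dist_eq_zero.1 (le_antisymm this dist_nonneg)
  · obtain ⟨x, rfl⟩ := SeparationQuotient.surjective_mk p
    obtain ⟨y, rfl⟩ := SeparationQuotient.surjective_mk q
    rw [dist_mk]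
    exact hlip x y

lemma exists_edgeLip [MulAction K T] [IsIsometricSMul K T] {ℓ : Z.Lengths} (hpos : ℓ.Positive)
    {P : Z.V → T} (hP : IsEquivariant θ P) : ∃ L : ℝ≥0, EdgeLip ℓ P L := by
  obtain ⟨C, hC0, hC⟩ := exists_bound_of_invariant
    (c := fun d : Z.graph.Dart => dist (P d.fst) (P d.snd) / ℓ.len d.edge)
    (fun g d => by rw [dist_smulDart hP, len_smulDart])
  refine ⟨NNReal.mk C hC0, fun d => ?_⟩
  exact (div_le_iff₀ (hpos _ d.edge_mem)).1 (hC d)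

end FreeTree

/-! ### Optimal maps from maps on vertices -/

section Optimal

open FreeTree

variable {ι : Type} {H : ι → Type u} [∀ i, Group (H i)] {Γ : ∀ i, Splitting (H i)}
  {φ : AutGamma Γ} {Y : ∀ i, FreeTree (H i)} {ℓ : ∀ i, (Y i).Lengths}

/-- Maps from the vertices of a forest to the metric forest that permute the components by `φ`. -/
abbrev VertexMap (φ : AutGamma Γ) (ℓ : ∀ i, (Y i).Lengths) : Type _ :=
  ∀ i, (Y i).V → (Y (φ.perm i)).Realization (ℓ (φ.perm i))

namespace ForestMap

lemma hasLip_lip {f : ForestMap φ ℓ} (h : ∃ K, f.HasLip K) : f.HasLip f.lip := by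
  intro i
  refine LipschitzWith.of_dist_le_mul fun x y => ?_
  rcases (dist_nonneg (x := x) (y := y)).eq_or_lt with h0 | h0
  · obtain ⟨K, hK⟩ := h
    have := (hK i).dist_le_mul x y
    rw [← h0, mul_zero] at this ⊢
    exact this
  · rw [← div_le_iff₀ h0]
    have h1 : NNReal.mk (dist (f i x) (f i y) / dist x y) (by positivity) ≤ f.lip := by
      refine le_csInf h fun K hK => ?_
      change dist (f i x) (f i y) / dist x y ≤ K
      rw [div_le_iff₀ h0]
      exact (hK i).dist_le_mul x y
    exact h1

lemma lip_le {f : ForestMap φ ℓ} {K : ℝ≥0} (h : f.HasLip K) : f.lip ≤ K :=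
  csInf_le (OrderBot.bddBelow _) h

lemma displacement_le {f : ForestMap φ ℓ} (hf : f.Represents) : displacement φ ℓ ≤ f.lip :=
  csInf_le (OrderBot.bddBelow _) ⟨f, hf, hasLip_lip hf.1⟩

lemma edgeLip_of_hasLip {f : ForestMap φ ℓ} {K : ℝ≥0} (hf : f.HasLip K) (i : ι) :
    EdgeLip (ℓ i) (fun v => f i (vertex (ℓ i) v)) K := by
  intro d
  have := (hf i).dist_le_mul (vertex (ℓ i) d.fst) (vertex (ℓ i) d.snd)
  rwa [dist_vertex_vertex] at this

lemma isEquivariant_of_represents {f : ForestMap φ ℓ} (hf : f.Represents) (i : ι) :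
    IsEquivariant (φ.iso i) (fun v => f i (vertex (ℓ i) v)) := by
  intro g v
  change f i (vertex (ℓ i) (g • v)) = _
  rw [← smul_vertex, hf.2]

/-- The straight map that extends a map on vertices. -/
lemma exists_straight_extension {P : VertexMap φ ℓ} (hP : ∀ i, IsEquivariant (φ.iso i) (P i))
    {L : ℝ≥0} (hPL : ∀ i, EdgeLip (ℓ i) (P i) L) :
    ∃ g : ForestMap φ ℓ, g.Represents ∧ g.HasLip L ∧ ∀ i (x : (Y i).EdgePoint (ℓ i)),
      g i (SeparationQuotient.mk x) = geodFraction (P i x.src) (P i x.tgt) x.pos := by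
  choose g hgL hg using fun i => exists_extension (isTreeMetric (Y (φ.perm i)) _) (hPL i)
  refine ⟨g, ⟨⟨L, hgL⟩, fun i a x => ?_⟩, hgL, hg⟩
  obtain ⟨x, rfl⟩ := SeparationQuotient.surjective_mk x
  rw [smul_mk, hg, hg, smul_geodFraction (isTreeMetric (Y (φ.perm i)) _), ← hP i, ← hP i]
  rfl

lemma exists_edgeLip_displacement (hne : ∃ f : ForestMap φ ℓ, f.Represents) (i : ι) :
    ∃ P : (Y i).V → (Y (φ.perm i)).Realization (ℓ (φ.perm i)),
      IsEquivariant (φ.iso i) P ∧ EdgeLip (ℓ i) P (displacement φ ℓ) := by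
  refine exists_edgeLip_of_forall_gt (isTreeAction _ _) (displacement φ ℓ).2 fun L' hL' => ?_
  obtain ⟨f, hf⟩ := hne
  lift L' to ℝ≥0 using (displacement φ ℓ).2.trans hL'.le
  obtain ⟨K, ⟨f, hf, hK⟩, hKL⟩ := exists_lt_of_csInf_lt
    (s := {K | ∃ f : ForestMap φ ℓ, f.Represents ∧ f.HasLip K})
    ⟨_, f, hf, hasLip_lip hf.1⟩ (b := L') (by exact_mod_cast hL')
  refine ⟨_, isEquivariant_of_represents hf i, fun d => (edgeLip_of_hasLip hK i d).trans ?_⟩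
  exact mul_le_mul_of_nonneg_right (by exact_mod_cast hKL.le) ((ℓ i).nonneg _)

/-- A map on vertices that realises the displacement extends to an optimal map if its tension graph
has no one-gated vertices. -/
lemma exists_optimal_extension (hpos : ∀ i, (ℓ i).Positive) {P : VertexMap φ ℓ}
    (hP : ∀ i, IsEquivariant (φ.iso i) (P i)) (hPL : ∀ i, EdgeLip (ℓ i) (P i) (displacement φ ℓ))
    (hgate : displacement φ ℓ = 0 ∨ ∀ i (d : (Y i).graph.Dart),
      dist (P i d.fst) (P i d.snd) = displacement φ ℓ * (ℓ i).len d.edge →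
        ∃ d' : (Y i).graph.Dart,
          dist (P i d'.fst) (P i d'.snd) = displacement φ ℓ * (ℓ i).len d'.edge ∧
          d'.fst = d.fst ∧ dist (P i d.snd) (P i d'.snd)
            = dist (P i d.fst) (P i d.snd) + dist (P i d.fst) (P i d'.snd)) :
    ∃ g : ForestMap φ ℓ, g.IsOptimal ∧ ∀ i (x : (Y i).EdgePoint (ℓ i)),
      g i (SeparationQuotient.mk x) = geodFraction (P i x.src) (P i x.tgt) x.pos := by
  obtain ⟨g, hgr, hgL, hg⟩ := exists_straight_extension hP hPL
  have hT : ∀ i, IsTreeMetric ((Y i).Realization (ℓ i)) := fun i => isTreeMetric _ _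
  have hlip : g.lip = displacement φ ℓ := le_antisymm (lip_le hgL) (displacement_le hgr)
  have hgv : ∀ i v, g i (vertex (ℓ i) v) = P i v := by
    intro i v
    refine (hg i _).trans ?_
    exact geodFraction_self (hT _) _ 0
  have hgp : ∀ i d s, g i (point (ℓ i) d s) = geodFraction (P i d.fst) (P i d.snd) s :=
    fun i d s => hg i _
  refine ⟨g, ⟨hgr, fun i d => ?_, hlip, fun i d hd => ?_⟩, hg⟩
  · have hl : 0 < (ℓ i).len d.edge := hpos i _ d.edge_mem
    refine ⟨NNReal.mk (dist (P i d.fst) (P i d.snd) / (ℓ i).len d.edge) (by positivity), fun s s' => ?_⟩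
    rw [hgp, hgp, dist_geodFraction (hT _), dist_point, NNReal.coe_mk]
    field_simp
  · rcases hgate with h0 | hgate
    · refine ⟨d, hd, rfl, ?_⟩
      rintro ⟨s, s', -, hne⟩
      apply hne
      have := (hgL i).dist_le_mul (point (ℓ i) d s) (vertex (ℓ i) d.fst)
      rw [h0, NNReal.coe_zero, zero_mul] at this
      exact dist_eq_zero.1 (le_antisymm this dist_nonneg)
    · have hd2 := hd.2
      rw [hgv, hgv, hlip] at hd2
      obtain ⟨d', h1, h2, h3⟩ := hgate i d hd2
      refine ⟨d', ⟨hpos i _ d'.edge_mem, by rw [hgv, hgv, hlip, h1]⟩, by rw [h2], ?_⟩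
      rintro ⟨s, s', he, hne⟩
      rw [hgp, hgp] at he
      rw [hgp, hgv] at hne
      have b1 := geodFraction_between (hT _) (P i d.fst) (P i d.snd) s
      have b2 := geodFraction_between (hT _) (P i d'.fst) (P i d'.snd) s'
      rw [← he, h2] at b2
      have hp := dist_pos.2 hne
      rw [dist_comm] at hp
      have t := dist_triangle (P i d.snd) (geodFraction (P i d.fst) (P i d.snd) s) (P i d'.snd)
      rw [dist_comm (P i d.snd) (geodFraction _ _ _)] at t
      linarith

/-- Near a map whose stretching of the edges exceeds the displacement only a little there is an
optimal map. -/
lemma exists_optimal_near (hpos : ∀ i, (ℓ i).Positive) {F : VertexMap φ ℓ}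
    (hF : ∀ i, IsEquivariant (φ.iso i) (F i)) (hne : ∃ f : ForestMap φ ℓ, f.Represents)
    (h0 : 0 < displacement φ ℓ) {ε η : ℝ} (hε : 0 ≤ ε) (hη : 0 < η)
    (hFL : ∀ i (d : (Y i).graph.Dart),
      dist (F i d.fst) (F i d.snd) ≤ displacement φ ℓ * (ℓ i).len d.edge + ε) :
    ∃ g : ForestMap φ ℓ, g.IsOptimal ∧ ∃ P : VertexMap φ ℓ,
      (∀ i v, dist (P i v) (F i v) ≤ Nat.card (Y i).Orb * ε + η) ∧
      ∀ i (x : (Y i).EdgePoint (ℓ i)),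
        g i (SeparationQuotient.mk x) = geodFraction (P i x.src) (P i x.tgt) x.pos := by
  have h0' : 0 < (displacement φ ℓ : ℝ) := h0
  have key : ∀ i, ∃ P : (Y i).V → (Y (φ.perm i)).Realization (ℓ (φ.perm i)),
      IsEquivariant (φ.iso i) P ∧ EdgeLip (ℓ i) P (displacement φ ℓ) ∧
      (∀ v, dist (P v) (F i v) ≤ Nat.card (Y i).Orb * ε + η) ∧ ∀ d : (Y i).graph.Dart,
      dist (P d.fst) (P d.snd) = displacement φ ℓ * (ℓ i).len d.edge →
        ∃ d' : (Y i).graph.Dart,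
          dist (P d'.fst) (P d'.snd) = displacement φ ℓ * (ℓ i).len d'.edge ∧
          d'.fst = d.fst ∧ dist (P d.snd) (P d'.snd)
            = dist (P d.fst) (P d.snd) + dist (P d.fst) (P d'.snd) := by
    intro i
    have := Fintype.ofFinite (Y i).Orb
    obtain ⟨P, hP, hPL, hmin⟩ := exists_closest (isTreeAction _ _) h0'.le (hF i)
      (exists_edgeLip_displacement hne i)
    have hd := dist_le_of_closest (isTreeAction _ _) (hpos i) h0' hP (hF i) hPL hmin hε (hFL i)
    obtain ⟨M, hM, hML, hMη, hMg⟩ := exists_not_one_gated (isTreeAction _ _) (hpos i) h0' hP hPL hη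
    refine ⟨M, hM, hML, fun v => ?_, hMg⟩
    have h1 := hd v
    have h2 := hMη v
    have t := dist_triangle (M v) (P v) (F i v)
    rw [dist_comm (M v) (P v)] at t
    rw [Nat.card_eq_fintype_card]
    linarith
  choose P hP hPL hPF hPg using key
  obtain ⟨g, hg, hgx⟩ := exists_optimal_extension hpos hP hPL (Or.inr hPg)
  exact ⟨g, hg, P, hPF, hgx⟩

end ForestMap

end Optimal

/-! ### Changing the edge lengths -/

namespace FreeTree

variable {G : Type u} [Group G] {Y : FreeTree G} {ℓ₁ ℓ₂ ℓ₃ : Y.Lengths}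

/-- The same combinatorial point, for other edge lengths. -/
def EdgePoint.recast (ℓ₂ : Y.Lengths) (x : Y.EdgePoint ℓ₁) : Y.EdgePoint ℓ₂ :=
  ⟨x.src, x.tgt, x.edge, x.pos⟩

/-- The map between metric trees that keeps the fraction along every edge, if all edges that are
collapsed in the source are collapsed in the target. -/
noncomputable def recast (h : ∀ e ∈ Y.graph.edgeSet, ℓ₁.len e = 0 → ℓ₂.len e = 0) :
    Y.Realization ℓ₁ → Y.Realization ℓ₂ :=
  SeparationQuotient.lift (fun x => SeparationQuotient.mk (x.recast ℓ₂))
    (fun x y hxy => SeparationQuotient.mk_eq_mk.2 (EdgePoint.inseparable_of_le h x y hxy))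

lemma recast_mk (h : ∀ e ∈ Y.graph.edgeSet, ℓ₁.len e = 0 → ℓ₂.len e = 0) (x : Y.EdgePoint ℓ₁) :
    recast h (SeparationQuotient.mk x) = SeparationQuotient.mk (x.recast ℓ₂) := rfl

lemma recast_smul (h : ∀ e ∈ Y.graph.edgeSet, ℓ₁.len e = 0 → ℓ₂.len e = 0) (g : G)
    (p : Y.Realization ℓ₁) : recast h (g • p) = g • recast h p := by
  obtain ⟨x, rfl⟩ := SeparationQuotient.surjective_mk p
  rfl

lemma recast_recast (h : ∀ e ∈ Y.graph.edgeSet, ℓ₁.len e = 0 → ℓ₂.len e = 0)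
    (h' : ∀ e ∈ Y.graph.edgeSet, ℓ₂.len e = 0 → ℓ₃.len e = 0) (p : Y.Realization ℓ₁) :
    recast h' (recast h p) = recast (fun e he h1 => h' e he (h e he h1)) p := by
  obtain ⟨x, rfl⟩ := SeparationQuotient.surjective_mk p
  rfl

lemma recast_surjective (h : ∀ e ∈ Y.graph.edgeSet, ℓ₁.len e = 0 → ℓ₂.len e = 0) :
    Function.Surjective (recast h) := by
  intro p
  obtain ⟨x, rfl⟩ := SeparationQuotient.surjective_mk p
  exact ⟨SeparationQuotient.mk (x.recast ℓ₁), rfl⟩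

lemma Lengths.Positive.zero_imp (h : ℓ₁.Positive) (ℓ₂ : Y.Lengths) :
    ∀ e ∈ Y.graph.edgeSet, ℓ₁.len e = 0 → ℓ₂.len e = 0 :=
  fun e he h0 => absurd h0 (h e he).ne'

lemma sigma_eq_recast {ℓX ℓY : Y.Lengths} (hY : ℓY.Positive) (t : unitInterval) :
    sigma ℓX ℓY hY t = recast (Lengths.segment_eq_zero hY t) := rfl

/-- Distances are affine along segments of edge lengths. -/
lemma dist_segment {ℓX ℓY : Y.Lengths} (t : unitInterval) (x y : Y.EdgePoint (ℓX.segment ℓY t)) :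
    dist x y = (1 - (t : ℝ)) * dist (x.recast ℓX) (y.recast ℓX)
      + t * dist (x.recast ℓY) (y.recast ℓY) := by
  rw [EdgePoint.dist_def, EdgePoint.dist_def, EdgePoint.dist_def, ← mul_div_assoc, ← mul_div_assoc,
    ← add_div, ← tsum_mul_left, ← tsum_mul_left,
    ← (((x.recast ℓX).summable (y.recast ℓX)).mul_left _).tsum_add
      (((x.recast ℓY).summable (y.recast ℓY)).mul_left _)]
  congr 1
  refine tsum_congr fun d => ?_
  change ((1 - (t : ℝ)) * ℓX.len d.edge + t * ℓY.len d.edge) * |x.coord d - y.coord d|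
    = (1 - (t : ℝ)) * (ℓX.len d.edge * |x.coord d - y.coord d|)
      + t * (ℓY.len d.edge * |x.coord d - y.coord d|)
  ring

lemma mul_dist_sigma_le {ℓX ℓY : Y.Lengths} (hY : ℓY.Positive) (t : unitInterval)
    (p q : Y.Realization (ℓX.segment ℓY t)) :
    (1 - (t : ℝ)) * dist (sigma ℓX ℓY hY t p) (sigma ℓX ℓY hY t q) ≤ dist p q := by
  obtain ⟨x, rfl⟩ := SeparationQuotient.surjective_mk p
  obtain ⟨y, rfl⟩ := SeparationQuotient.surjective_mk q
  rw [sigma_eq_recast, recast_mk, recast_mk, EdgePoint.dist_mk, EdgePoint.dist_mk, dist_segment]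
  have := mul_nonneg t.2.1 (dist_nonneg (x := x.recast ℓY) (y := y.recast ℓY))
  linarith

lemma dist_recast_segment {ℓX ℓY : Y.Lengths} (hY : ℓY.Positive) (t : unitInterval)
    (p q : Y.Realization ℓY) :
    dist (recast (hY.zero_imp (ℓX.segment ℓY t)) p) (recast (hY.zero_imp (ℓX.segment ℓY t)) q)
      = (1 - (t : ℝ)) * dist (recast (hY.zero_imp ℓX) p) (recast (hY.zero_imp ℓX) q)
        + t * dist p q := by
  obtain ⟨x, rfl⟩ := SeparationQuotient.surjective_mk p
  obtain ⟨y, rfl⟩ := SeparationQuotient.surjective_mk q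
  simp only [recast_mk, EdgePoint.dist_mk]
  exact dist_segment t _ _

lemma dist_vertex_segment {ℓX ℓY : Y.Lengths} (t : unitInterval) (v w : Y.V) :
    dist (vertex (ℓX.segment ℓY t) v) (vertex (ℓX.segment ℓY t) w)
      = (1 - (t : ℝ)) * dist (vertex ℓX v) (vertex ℓX w) + t * dist (vertex ℓY v) (vertex ℓY w) := by
  simp only [vertex, EdgePoint.dist_mk]
  exact dist_segment t _ _

lemma Lengths.Positive.segment {ℓX ℓY : Y.Lengths} (hY : ℓY.Positive) {t : unitInterval}
    (ht : 0 < (t : ℝ)) : (ℓX.segment ℓY t).Positive := fun e he =>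
  add_pos_of_nonneg_of_pos (mul_nonneg (sub_nonneg.2 t.2.2) (ℓX.nonneg e)) (mul_pos ht (hY e he))

end FreeTree

/-! ### Legal paths of optimal maps -/

namespace ForestMap

open FreeTree

variable {ι : Type} {H : ι → Type u} [∀ i, Group (H i)] {Γ : ∀ i, Splitting (H i)}
  {φ : AutGamma Γ} {Y : ∀ i, FreeTree (H i)} {ℓ : ∀ i, (Y i).Lengths}

lemma Straight.dist_point {f : ForestMap φ ℓ} (hf : f.Straight) (i : ι) (d : (Y i).graph.Dart)
    (s s' : unitInterval) : dist (f i (point (ℓ i) d s)) (f i (point (ℓ i) d s'))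
      = |(s : ℝ) - s'| * dist (f i (vertex (ℓ i) d.fst)) (f i (vertex (ℓ i) d.snd)) := by
  obtain ⟨c, hc⟩ := hf i d
  have h := hc 0 1
  rw [point_zero, point_one, dist_vertex_vertex] at h
  rw [hc, h, FreeTree.dist_point]
  ring

/-- A point on an edge divides the image of the edge in the same ratio. -/
lemma Straight.dist_vertex_point {f : ForestMap φ ℓ} (hf : f.Straight) (i : ι)
    (d : (Y i).graph.Dart) (s : unitInterval) :
    dist (f i (vertex (ℓ i) d.fst)) (f i (point (ℓ i) d s))
      = s * dist (f i (vertex (ℓ i) d.fst)) (f i (vertex (ℓ i) d.snd)) ∧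
    dist (f i (point (ℓ i) d s)) (f i (vertex (ℓ i) d.snd))
      = (1 - s) * dist (f i (vertex (ℓ i) d.fst)) (f i (vertex (ℓ i) d.snd)) := by
  constructor
  · have := hf.dist_point i d 0 s
    rw [point_zero] at this
    rw [this]
    simp [abs_of_nonneg s.2.1]
  · have := hf.dist_point i d s 1
    rw [point_one] at this
    rw [this, abs_sub_comm, Set.Icc.coe_one, abs_of_nonneg (sub_nonneg.2 s.2.2)]

/-- The Lipschitz constant of a straight map is attained on some edge. -/
lemma exists_inTension [Fintype ι] {f : ForestMap φ ℓ} (hf : f.Represents) (hs : f.Straight)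
    (h0 : 0 < f.lip) : ∃ i d, f.InTension i d := by
  by_contra! hcon
  have hL := hasLip_lip hf.1
  have hle := fun i => edgeLip_of_hasLip hL i
  have key : ∀ i, ∃ K : ℝ≥0, K < f.lip ∧ EdgeLip (ℓ i) (fun v => f i (vertex (ℓ i) v)) K := by
    intro i
    have heq := isEquivariant_of_represents hf i
    obtain ⟨δ, hδ, h⟩ := exists_pos_le_of_finite_range (finite_range_of_invariant
      (c := fun d : (Y i).graph.Dart => (f.lip : ℝ) - dist (f i (vertex (ℓ i) d.fst))
        (f i (vertex (ℓ i) d.snd)) / (ℓ i).len d.edge)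
      (fun g d => by rw [len_smulDart]; congr 2; exact dist_smulDart heq g d))
    refine ⟨((f.lip : ℝ) - δ).toNNReal, ?_, fun d => ?_⟩
    · have h0' : (0 : ℝ) < f.lip := h0
      rw [← NNReal.coe_lt_coe, Real.coe_toNNReal', max_lt_iff]
      exact ⟨by linarith, h0'⟩
    · change dist (f i (vertex (ℓ i) d.fst)) (f i (vertex (ℓ i) d.snd)) ≤ _
      rcases ((ℓ i).nonneg d.edge).eq_or_lt with hl | hl
      · have := hle i d
        rw [← hl, mul_zero] at this ⊢
        exact this
      · have h1 : dist (f i (vertex (ℓ i) d.fst)) (f i (vertex (ℓ i) d.snd))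
            < f.lip * (ℓ i).len d.edge :=
          lt_of_le_of_ne (hle i d) fun h => hcon i d ⟨hl, h⟩
        have h2 := h d (sub_pos.2 ((div_lt_iff₀ hl).2 h1))
        rw [← div_le_iff₀ hl]
        refine le_trans ?_ (Real.le_coe_toNNReal _)
        linarith
  choose K hK hKe using key
  have hsup : Finset.univ.sup K < f.lip := (Finset.sup_lt_iff h0).2 fun i _ => hK i
  refine absurd (lip_le (f := f) (K := Finset.univ.sup K) fun i => ?_) (not_le.2 hsup)
  refine (lipschitzWith_of_edgewise (f i) (K := K i) fun d s s' => ?_).weaken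
    (Finset.le_sup (Finset.mem_univ i))
  rw [hs.dist_point, mul_comm, ← mul_assoc]
  exact mul_le_mul_of_nonneg_right (hKe i d) (abs_nonneg _)

lemma inTension_smulDart {f : ForestMap φ ℓ} (hf : f.Represents) {i : ι} (g : H i)
    {d : (Y i).graph.Dart} (h : f.InTension i d) : f.InTension i (smulDart g d) := by
  refine ⟨by rw [len_smulDart]; exact h.1, ?_⟩
  rw [len_smulDart]
  exact (dist_smulDart (isEquivariant_of_represents hf i) g d).trans h.2

lemma inTension_symm {f : ForestMap φ ℓ} {i : ι} {d : (Y i).graph.Dart} (h : f.InTension i d) :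
    f.InTension i d.symm := by
  refine ⟨by rw [SimpleGraph.Dart.edge_symm]; exact h.1, ?_⟩
  rw [SimpleGraph.Dart.edge_symm, ← h.2]
  exact dist_comm _ _

/-- The images of two edges in different gates form a geodesic. -/
lemma dist_add_of_not_sameGate {f : ForestMap φ ℓ} (hs : f.Straight) {i : ι}
    {d d' : (Y i).graph.Dart} (hv : vertex (ℓ i) d'.fst = vertex (ℓ i) d.fst)
    (hgate : ¬ f.SameGate i d d') :
    dist (f i (vertex (ℓ i) d.snd)) (f i (vertex (ℓ i) d.fst))
      + dist (f i (vertex (ℓ i) d.fst)) (f i (vertex (ℓ i) d'.snd))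
      = dist (f i (vertex (ℓ i) d.snd)) (f i (vertex (ℓ i) d'.snd)) := by
  have hT := isTreeMetric (Y (φ.perm i)) (ℓ (φ.perm i))
  set o := f i (vertex (ℓ i) d.fst) with ho
  set a := f i (vertex (ℓ i) d.snd) with ha
  set b := f i (vertex (ℓ i) d'.snd) with hb
  have t := dist_triangle a o b
  refine le_antisymm ?_ t
  by_contra! hlt
  rw [dist_comm a o] at hlt
  set r := (dist o a + dist o b - dist a b) / 2 with hr
  have t1 := dist_triangle o a b
  have t2 := dist_triangle o b a
  rw [dist_comm b a] at t2
  have hr0 : 0 < r := by linarith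
  have hra : r ≤ dist o a := by linarith
  have hrb : r ≤ dist o b := by linarith
  have hoa : 0 < dist o a := hr0.trans_le hra
  have hob : 0 < dist o b := hr0.trans_le hrb
  let s : unitInterval := ⟨r / dist o a, by positivity, (div_le_one hoa).2 hra⟩
  let s' : unitInterval := ⟨r / dist o b, by positivity, (div_le_one hob).2 hrb⟩
  obtain ⟨e1, e2⟩ := hs.dist_vertex_point i d s
  obtain ⟨e3, e4⟩ := hs.dist_vertex_point i d' s'
  rw [hv] at e3 e4
  have f1 : (s : ℝ) * dist o a = r := div_mul_cancel₀ _ hoa.ne'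
  have f3 : (s' : ℝ) * dist o b = r := div_mul_cancel₀ _ hob.ne'
  rw [← ho, ← ha] at e1 e2
  rw [← ho, ← hb] at e3 e4
  rw [f1] at e1
  rw [f3] at e3
  rw [sub_mul, f1, one_mul] at e2
  rw [sub_mul, f3, one_mul] at e4
  have h1 := hT.between_of_between (o := o) (a := a) (b := b) (c := f i (point (ℓ i) d s))
    (by linarith) (by linarith)
  have h2 := hT.eq_of_between h1 (c' := f i (point (ℓ i) d' s')) (by linarith) (by rw [e1, e3])
  refine hgate ⟨s, s', h2, fun h => ?_⟩
  rw [h, dist_self] at e1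
  exact hr0.ne e1

/-- In the tension graph of an optimal map, every edge continues to a legal path.  The bound `J`
refers to other edge lengths, for which the two edges need not have a common endpoint. -/
lemma exists_legal_continuation {f : ForestMap φ ℓ} (hf : f.IsOptimal) (i : ι)
    (ℓ' : (Y i).Lengths) : ∃ J : ℝ, 0 ≤ J ∧ ∀ d, f.InTension i d → ∃ d', f.InTension i d' ∧
      vertex (ℓ i) d'.fst = vertex (ℓ i) d.snd ∧
      dist (vertex ℓ' d.snd) (vertex ℓ' d'.fst) ≤ J ∧
      dist (f i (vertex (ℓ i) d.fst)) (f i (vertex (ℓ i) d.snd))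
        + dist (f i (vertex (ℓ i) d.snd)) (f i (vertex (ℓ i) d'.snd))
        = dist (f i (vertex (ℓ i) d.fst)) (f i (vertex (ℓ i) d'.snd)) := by
  obtain ⟨D, hD, hDd⟩ := exists_finite_darts (Y i)
  have h1 : ∀ d : (Y i).graph.Dart, ∃ J : ℝ, f.InTension i d → ∃ d', f.InTension i d' ∧
      vertex (ℓ i) d'.fst = vertex (ℓ i) d.snd ∧
      dist (vertex ℓ' d.snd) (vertex ℓ' d'.fst) ≤ J ∧
      dist (f i (vertex (ℓ i) d.fst)) (f i (vertex (ℓ i) d.snd))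
        + dist (f i (vertex (ℓ i) d.snd)) (f i (vertex (ℓ i) d'.snd))
        = dist (f i (vertex (ℓ i) d.fst)) (f i (vertex (ℓ i) d'.snd)) := by
    intro d
    by_cases hd : f.InTension i d
    · obtain ⟨d', hd', hv, hg⟩ := hf.not_one_gated i d.symm (inTension_symm hd)
      exact ⟨_, fun _ => ⟨d', hd', hv, le_rfl, dist_add_of_not_sameGate hf.straight hv hg⟩⟩
    · exact ⟨0, fun h => absurd h hd⟩
  choose J hJ using h1
  obtain ⟨C, hC⟩ := (hD.image J).bddAbove
  refine ⟨max C 0, le_max_right _ _, fun d hd => ?_⟩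
  obtain ⟨g, hg⟩ := hDd d
  obtain ⟨d', hd', hv, hJd, hdist⟩ := hJ _ (inTension_smulDart hf.represents g hd)
  have heq := isEquivariant_of_represents hf.represents i
  have hinv : ∀ v, f i (vertex (ℓ i) (g⁻¹ • v)) = φ.iso i g⁻¹ • f i (vertex (ℓ i) v) :=
    fun v => heq g⁻¹ v
  have hsnd : d.snd = g⁻¹ • (smulDart g d).snd := (inv_smul_smul g d.snd).symm
  have hfst : d.fst = g⁻¹ • (smulDart g d).fst := (inv_smul_smul g d.fst).symm
  refine ⟨smulDart g⁻¹ d', inTension_smulDart hf.represents _ hd', ?_, ?_, ?_⟩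
  · change vertex (ℓ i) (g⁻¹ • d'.fst) = _
    rw [← smul_vertex, hv, smul_vertex, ← hsnd]
  · change dist _ (vertex ℓ' (g⁻¹ • d'.fst)) ≤ _
    rw [hsnd, ← smul_vertex, ← smul_vertex, dist_smul]
    exact hJd.trans ((hC ⟨_, hg, rfl⟩).trans (le_max_left _ _))
  · change _ + dist _ (f i (vertex (ℓ i) (g⁻¹ • d'.snd)))
      = dist _ (f i (vertex (ℓ i) (g⁻¹ • d'.snd)))
    rw [hsnd, hfst, hinv, hinv, hinv, dist_smul, dist_smul, dist_smul]
    exact hdist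

/-- The displacement is lower semicontinuous at `X`: an infinite legal path of an optimal map on `X`
is stretched almost as much by any map for nearby edge lengths, as the images stay close in `X`. -/
lemma exists_displacement_bound [Fintype ι] {ℓX ℓY : ∀ i, (Y i).Lengths}
    (hpos : ∀ i, (ℓY i).Positive) {f : ForestMap φ ℓX} (hf : f.IsOptimal) :
    ∃ κ : ℝ, 0 ≤ κ ∧ ∀ t : unitInterval, (t : ℝ) < 1 →
      ∀ g : ForestMap φ (fun i => (ℓX i).segment (ℓY i) t), g.Represents → ∀ K : ℝ≥0, g.HasLip K →
        (1 - t) * (f.lip : ℝ) ≤ K * ((1 - t) + t * κ) := by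
  rcases (zero_le (a := f.lip)).eq_or_lt with h0 | h0
  · refine ⟨0, le_rfl, fun t ht g _ K _ => ?_⟩
    rw [← h0, NNReal.coe_zero, mul_zero, mul_zero, add_zero]
    exact mul_nonneg K.2 (by linarith)
  obtain ⟨i, d₀, hd₀⟩ := exists_inTension hf.represents hf.straight h0
  obtain ⟨J, hJ0, hJ⟩ := exists_legal_continuation hf i (ℓY i)
  obtain ⟨M, hM0, hM⟩ := exists_bound_of_invariant (c := fun d => (ℓY i).len d.edge)
    (len_smulDart (ℓY i))
  obtain ⟨m, hm, hml⟩ := exists_pos_bound_of_invariant (c := fun d => (ℓX i).len d.edge)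
    (len_smulDart (ℓX i))
  choose! nxt hn1 hn2 hn3 hn4 using hJ
  let e : ℕ → (Y i).graph.Dart := fun n => nxt^[n] d₀
  have he1 : ∀ n, e (n + 1) = nxt (e n) := fun n => Function.iterate_succ_apply' nxt n d₀
  have hte : ∀ n, f.InTension i (e n) := by
    intro n
    induction n with
    | zero => exact hd₀
    | succ n ih => rw [he1]; exact hn1 _ ih
  let v : ℕ → (Y i).V := fun n => (e n).fst
  let S : ℕ → ℝ := fun N => ∑ k ∈ Finset.range N, (ℓX i).len (e k).edge
  have hvX : ∀ n, vertex (ℓX i) (v (n + 1)) = vertex (ℓX i) (e n).snd := by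
    intro n
    change vertex (ℓX i) (e (n + 1)).fst = _
    rw [he1]; exact hn2 _ (hte n)
  -- the image of the legal path is geodesic
  have hstep : ∀ n, dist (f i (vertex (ℓX i) (v n))) (f i (vertex (ℓX i) (v (n + 1))))
      = f.lip * (ℓX i).len (e n).edge := by
    intro n; rw [hvX]; exact (hte n).2
  have hturn : ∀ n, dist (f i (vertex (ℓX i) (v n))) (f i (vertex (ℓX i) (v (n + 1))))
      + dist (f i (vertex (ℓX i) (v (n + 1)))) (f i (vertex (ℓX i) (v (n + 2))))
      = dist (f i (vertex (ℓX i) (v n))) (f i (vertex (ℓX i) (v (n + 2)))) := by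
    intro n
    rw [hvX n, hvX (n + 1), he1]
    exact hn4 _ (hte n)
  have hgeo : ∀ n, dist (f i (vertex (ℓX i) (v 0))) (f i (vertex (ℓX i) (v n)))
      + dist (f i (vertex (ℓX i) (v n))) (f i (vertex (ℓX i) (v (n + 1))))
      = dist (f i (vertex (ℓX i) (v 0))) (f i (vertex (ℓX i) (v (n + 1)))) := by
    intro n
    induction n with
    | zero => simp
    | succ n ih =>
      refine (isTreeMetric (Y (φ.perm i)) (ℓX (φ.perm i))).between_concat ih (hturn n) ?_
      rw [hstep]
      exact mul_pos h0 (hte n).1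
  have hS : ∀ n, dist (f i (vertex (ℓX i) (v 0))) (f i (vertex (ℓX i) (v n))) = f.lip * S n := by
    intro n
    induction n with
    | zero => simp [S]
    | succ n ih =>
      rw [← hgeo, ih, hstep]
      simp only [S, Finset.sum_range_succ]
      ring
  have hNm : ∀ n : ℕ, n * m ≤ S n := by
    intro n
    induction n with
    | zero => simp [S]
    | succ n ih =>
      simp only [S, Finset.sum_range_succ] at ih ⊢
      have := hml _ (hte n).1
      push_cast
      linarith
  refine ⟨(M + J) / m, by positivity, fun t ht g hg K hK => ?_⟩
  have ht0 := t.2.1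
  -- the length of the path for the new edge lengths
  have hlen : ∀ n : ℕ, dist (vertex ((ℓX i).segment (ℓY i) t) (v 0))
      (vertex ((ℓX i).segment (ℓY i) t) (v n)) ≤ (1 - t) * S n + t * (n * (M + J)) := by
    intro n
    induction n with
    | zero => simp [S]
    | succ n ih =>
      have t1 := dist_triangle4 (vertex ((ℓX i).segment (ℓY i) t) (v 0))
        (vertex ((ℓX i).segment (ℓY i) t) (v n)) (vertex ((ℓX i).segment (ℓY i) t) (e n).snd)
        (vertex ((ℓX i).segment (ℓY i) t) (v (n + 1)))
      have e1 : dist (vertex ((ℓX i).segment (ℓY i) t) (v n))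
          (vertex ((ℓX i).segment (ℓY i) t) (e n).snd)
          = (1 - t) * (ℓX i).len (e n).edge + t * (ℓY i).len (e n).edge := dist_vertex_vertex _
      have e2 : dist (vertex ((ℓX i).segment (ℓY i) t) (e n).snd)
          (vertex ((ℓX i).segment (ℓY i) t) (v (n + 1))) ≤ t * J := by
        rw [dist_vertex_segment, hvX, dist_self, mul_zero, zero_add]
        refine mul_le_mul_of_nonneg_left ?_ ht0
        change dist _ (vertex (ℓY i) (e (n + 1)).fst) ≤ J
        rw [he1]
        exact hn3 _ (hte n)
      have e3 := mul_le_mul_of_nonneg_left (hM (e n)) ht0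
      have e4 : S (n + 1) = S n + (ℓX i).len (e n).edge := Finset.sum_range_succ _ _
      rw [e4]
      push_cast
      linarith
  -- the two maps have bounded distance
  obtain ⟨B, hB⟩ := (finite_range_of_invariant_vertex
    (c := fun w : (Y i).V => dist (sigma (ℓX (φ.perm i)) (ℓY (φ.perm i)) (hpos (φ.perm i)) t
      (g i (vertex ((ℓX i).segment (ℓY i) t) w))) (f i (vertex (ℓX i) w)))
    (fun a w => by
      have e1 : g i (vertex ((ℓX i).segment (ℓY i) t) (a • w))
          = φ.iso i a • g i (vertex ((ℓX i).segment (ℓY i) t) w) :=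
        isEquivariant_of_represents hg i a w
      have e2 : f i (vertex (ℓX i) (a • w)) = φ.iso i a • f i (vertex (ℓX i) w) :=
        isEquivariant_of_represents hf.represents i a w
      rw [e1, e2, sigma_eq_recast, recast_smul, dist_smul])).bddAbove
  have hB' := fun w => hB ⟨w, rfl⟩
  have hmain : ∀ n : ℕ, (1 - (t : ℝ)) * (f.lip * S n - 2 * B)
      ≤ K * ((1 - (t : ℝ)) * S n + t * (n * (M + J))) := by
    intro n
    have a1 := (hK i).dist_le_mul (vertex ((ℓX i).segment (ℓY i) t) (v 0))
      (vertex ((ℓX i).segment (ℓY i) t) (v n))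
    have a2 := mul_dist_sigma_le (ℓX := ℓX (φ.perm i)) (hpos (φ.perm i)) t
      (g i (vertex ((ℓX i).segment (ℓY i) t) (v 0))) (g i (vertex ((ℓX i).segment (ℓY i) t) (v n)))
    have a3 := dist_triangle4 (f i (vertex (ℓX i) (v 0)))
      (sigma (ℓX (φ.perm i)) (ℓY (φ.perm i)) (hpos (φ.perm i)) t
        (g i (vertex ((ℓX i).segment (ℓY i) t) (v 0))))
      (sigma (ℓX (φ.perm i)) (ℓY (φ.perm i)) (hpos (φ.perm i)) t
        (g i (vertex ((ℓX i).segment (ℓY i) t) (v n)))) (f i (vertex (ℓX i) (v n)))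
    rw [hS, dist_comm (f i (vertex (ℓX i) (v 0)))] at a3
    have b1 := hB' (v 0)
    have b2 := hB' (v n)
    simp only at b1 b2
    have a4 := mul_le_mul_of_nonneg_left (hlen n) K.2
    refine le_trans ?_ (a2.trans (a1.trans a4))
    exact mul_le_mul_of_nonneg_left (by linarith) (by linarith)
  by_contra! hlt
  obtain ⟨n, hn⟩ := exists_nat_gt ((1 - t) * (2 * B)
    / (m * ((1 - t) * (f.lip : ℝ) - K * ((1 - t) + t * ((M + J) / m)))))
  rw [div_lt_iff₀ (mul_pos hm (sub_pos.2 hlt))] at hn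
  have c1 := mul_le_mul_of_nonneg_right (hNm n) (sub_pos.2 hlt).le
  have c2 := hmain n
  have c3 : (K : ℝ) * (t * (n * (M + J))) ≤ K * (t * (S n * ((M + J) / m))) := by
    refine mul_le_mul_of_nonneg_left (mul_le_mul_of_nonneg_left ?_ ht0) K.2
    rw [← mul_div_assoc, le_div_iff₀ hm]
    have := mul_le_mul_of_nonneg_right (hNm n) (add_nonneg hM0 hJ0)
    linarith
  nlinarith

end ForestMap

/-! ### Lifting a map on the collapsed forest -/

section Lift

open FreeTree MulAction

variable {ι : Type} {H : ι → Type u} [∀ i, Group (H i)] {Γ : ∀ i, Splitting (H i)}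
  {φ : AutGamma Γ} {Y : ∀ i, FreeTree (H i)} {ℓX ℓY : ∀ i, (Y i).Lengths}

/-- The images of the vertices under a map on the collapsed forest can be lifted equivariantly.  At a
vertex with non-trivial stabiliser, the lift is the fixed point that some map of the original forest
provides. -/
lemma ForestMap.exists_lift (hpos : ∀ i, (ℓY i).Positive) {h : ForestMap φ ℓY}
    (hh : h.Represents) {f : ForestMap φ ℓX} (hf : f.Represents) (i : ι) :
    ∃ F : (Y i).V → (Y (φ.perm i)).Realization (ℓY (φ.perm i)), IsEquivariant (φ.iso i) F ∧
      ∀ v, recast ((hpos (φ.perm i)).zero_imp (ℓX (φ.perm i))) (F v) = f i (vertex (ℓX i) v) := by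
  classical
  set ρ := recast ((hpos (φ.perm i)).zero_imp (ℓX (φ.perm i))) with hρ
  have hfe := ForestMap.isEquivariant_of_represents hf i
  have hhe := ForestMap.isEquivariant_of_represents hh i
  have hT := isTreeAction (Y (φ.perm i)) (ℓX (φ.perm i))
  choose q hq using fun v : (Y i).V => recast_surjective
    ((hpos (φ.perm i)).zero_imp (ℓX (φ.perm i))) (f i (vertex (ℓX i) v))
  have hρh : IsEquivariant (φ.iso i) (fun v => ρ (h i (vertex (ℓY i) v))) := by
    intro g v
    have := hhe g v
    simp only at this
    change ρ (h i (vertex (ℓY i) (g • v))) = φ.iso i g • ρ (h i (vertex (ℓY i) v))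
    rw [this, hρ, recast_smul]
  obtain ⟨F, hF, hFo⟩ := exists_equivariant (Z := Y i) (φ.iso i)
    (fun o => if stabilizer (H i) o.out = ⊥ then q o.out else h i (vertex (ℓY i) o.out))
    (fun o g hg => by
      by_cases ho : stabilizer (H i) o.out = ⊥
      · rw [ho, Subgroup.mem_bot] at hg
        rw [hg, map_one, one_smul]
      · rw [if_neg ho]
        have := hhe g o.out
        rw [mem_stabilizer_iff.1 hg] at this
        exact this.symm)
  refine ⟨F, hF, fun v => ?_⟩
  have key : ∀ o : (Y i).Orb, ρ (F o.out) = f i (vertex (ℓX i) o.out) := by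
    intro o
    rw [hFo]
    by_cases ho : stabilizer (H i) o.out = ⊥
    · rw [if_pos ho]; exact hq _
    · rw [if_neg ho]
      exact eq_of_stabilizer_ne_bot hT hρh hfe ho
  obtain ⟨g, hg⟩ := exists_smul_out v
  rw [← hg]
  have h1 : f i (vertex (ℓX i) (g • (orb v).out)) = φ.iso i g • f i (vertex (ℓX i) (orb v).out) :=
    hfe g _
  rw [hF, hρ, recast_smul, ← hρ, key, h1]

lemma exists_uniform_bound [Fintype ι] {α : ι → Type*} {c : ∀ i, α i → ℝ}
    (h : ∀ i, ∃ C, 0 ≤ C ∧ ∀ a, c i a ≤ C) : ∃ C, 0 ≤ C ∧ ∀ i a, c i a ≤ C := by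
  choose C hC0 hC using h
  exact ⟨∑ i, C i, Finset.sum_nonneg fun i _ => hC0 i, fun i a => (hC i a).trans
    (Finset.single_le_sum (fun i _ => hC0 i) (Finset.mem_univ i))⟩

lemma FreeTree.Lengths.segment_zero {G : Type u} [Group G] {Z : FreeTree G} (ℓ₀ ℓ₁ : Z.Lengths) :
    ℓ₀.segment ℓ₁ 0 = ℓ₀ := by
  cases ℓ₀
  simp [Lengths.segment]

end Lift

/-! ### Nearby optimal maps -/

section Nearby

open FreeTree

variable {ι : Type} {H : ι → Type u} [∀ i, Group (H i)] {Γ : ∀ i, Splitting (H i)}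
  {φ : AutGamma Γ} {Y : ∀ i, FreeTree (H i)} {ℓX ℓY : ∀ i, (Y i).Lengths}

lemma exists_sigma_eq_self (hpos : ∀ i, (ℓY i).Positive) {f : ForestMap φ ℓX} (hf : f.IsOptimal)
    {t : unitInterval} (ht : t = 0) :
    ∃ g : ForestMap φ (fun i => (ℓX i).segment (ℓY i) t), g.IsOptimal ∧ ∀ i x,
      sigma (ℓX (φ.perm i)) (ℓY (φ.perm i)) (hpos (φ.perm i)) t (g i x)
        = f i (sigma (ℓX i) (ℓY i) (hpos i) t x) := by
  subst ht
  have key : ∀ ℓ₀ : ∀ i, (Y i).Lengths, ℓ₀ = ℓX → ∀ h : ∀ i, ∀ e ∈ (Y i).graph.edgeSet,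
      (ℓ₀ i).len e = 0 → (ℓX i).len e = 0, ∃ g : ForestMap φ ℓ₀, g.IsOptimal ∧ ∀ i x,
        recast (h (φ.perm i)) (g i x) = f i (recast (h i) x) := by
    rintro _ rfl h
    have hid : ∀ i x, recast (h i) x = x := by
      intro i x
      obtain ⟨x, rfl⟩ := SeparationQuotient.surjective_mk x
      rfl
    exact ⟨f, hf, fun i x => by rw [hid, hid]⟩
  exact key _ (funext fun i => Lengths.segment_zero _ _) fun i => Lengths.segment_eq_zero (hpos i) 0

/-- If the displacement of `Y_t` vanishes then the optimal maps on `X` and `Y_t` are constant with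
values the unique fixed points of the groups. -/
lemma exists_optimal_of_displacement_eq_zero [∀ i, Nontrivial (H i)]
    (hpos : ∀ i, (ℓY i).Positive) {f : ForestMap φ ℓX} (hf : f.IsOptimal) (hf0 : f.lip = 0)
    {t : unitInterval} (ht : 0 < (t : ℝ))
    (hne : ∃ g : ForestMap φ (fun i => (ℓX i).segment (ℓY i) t), g.Represents)
    (h0 : ForestMap.displacement φ (fun i => (ℓX i).segment (ℓY i) t) = 0) :
    ∃ g : ForestMap φ (fun i => (ℓX i).segment (ℓY i) t), g.IsOptimal ∧ ∀ i x,
      sigma (ℓX (φ.perm i)) (ℓY (φ.perm i)) (hpos (φ.perm i)) t (g i x)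
        = f i (sigma (ℓX i) (ℓY i) (hpos i) t x) := by
  choose P hP hPL using ForestMap.exists_edgeLip_displacement hne
  obtain ⟨g, hg, -⟩ := ForestMap.exists_optimal_extension (fun i => (hpos i).segment ht) hP hPL
    (Or.inl h0)
  have hconst : ∀ {ℓ : ∀ i, (Y i).Lengths} (f : ForestMap φ ℓ), f.Represents → f.lip = 0 →
      ∀ i x y, f i x = f i y := by
    intro ℓ f hf h i x y
    have := (ForestMap.hasLip_lip hf.1 i).dist_le_mul x y
    rw [h, NNReal.coe_zero, zero_mul] at this
    exact dist_eq_zero.1 (le_antisymm this dist_nonneg)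
  refine ⟨g, hg, fun i x => ?_⟩
  obtain ⟨a, ha⟩ := exists_ne (1 : H i)
  refine realization_fixed_unique (φ.iso i a) _ _ (by rwa [Ne, map_eq_one_iff _ (φ.iso i).injective])
    ?_ ?_
  · rw [sigma_eq_recast, ← recast_smul, ← hg.represents.2,
      hconst g hg.represents (hg.weakly_optimal.trans h0) i (a • x) x]
  · rw [← hf.represents.2, hconst f hf.represents hf0 i _ _]

/-- An optimal map on `Y_t` whose values at the vertices are close to a lift of `f` is close to
`f` everywhere after the collapse. -/
lemma dist_sigma_le (hpos : ∀ i, (ℓY i).Positive) {f : ForestMap φ ℓX} (hf : f.Straight)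
    {t : unitInterval} (ht : (t : ℝ) ≤ 1 / 2)
    {F : VertexMap φ ℓY} (hFf : ∀ i v,
      recast ((hpos (φ.perm i)).zero_imp (ℓX (φ.perm i))) (F i v) = f i (vertex (ℓX i) v))
    {C : ℝ} (hC0 : 0 ≤ C) (hC : ∀ i (d : (Y i).graph.Dart), dist (F i d.fst) (F i d.snd) ≤ C)
    {g : ForestMap φ (fun i => (ℓX i).segment (ℓY i) t)}
    {P : VertexMap φ (fun i => (ℓX i).segment (ℓY i) t)}
    (hg : ∀ i (x : (Y i).EdgePoint ((ℓX i).segment (ℓY i) t)),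
      g i (SeparationQuotient.mk x) = geodFraction (P i x.src) (P i x.tgt) x.pos)
    {b : ℝ} (hb : ∀ i v, dist (P i v) (recast ((hpos (φ.perm i)).zero_imp
      ((ℓX (φ.perm i)).segment (ℓY (φ.perm i)) t)) (F i v)) ≤ b) (i : ι)
    (x : (Y i).Realization ((ℓX i).segment (ℓY i) t)) :
    dist (sigma (ℓX (φ.perm i)) (ℓY (φ.perm i)) (hpos (φ.perm i)) t (g i x))
      (f i (sigma (ℓX i) (ℓY i) (hpos i) t x)) ≤ 6 * b + 2 * (t * C) := by
  obtain ⟨x, rfl⟩ := SeparationQuotient.surjective_mk x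
  have hTX := isTreeMetric (Y (φ.perm i)) (ℓX (φ.perm i))
  have hTt := isTreeMetric (Y (φ.perm i)) ((ℓX (φ.perm i)).segment (ℓY (φ.perm i)) t)
  set σ := sigma (ℓX (φ.perm i)) (ℓY (φ.perm i)) (hpos (φ.perm i)) t with hσ
  set Ft : (Y i).V → _ := fun v => recast ((hpos (φ.perm i)).zero_imp
      ((ℓX (φ.perm i)).segment (ℓY (φ.perm i)) t)) (F i v) with hFt
  have hσF : ∀ v, σ (Ft v) = f i (vertex (ℓX i) v) := by
    intro v
    rw [← hFf, hσ, sigma_eq_recast, hFt, recast_recast]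
  set y := g i (SeparationQuotient.mk x) with hy
  set q := f i (sigma (ℓX i) (ℓY i) (hpos i) t (SeparationQuotient.mk x)) with hq
  have ht0 := t.2.1
  have hs0 := x.pos.2.1
  have hs1 := x.pos.2.2
  -- the position of `q` on the image of its edge
  have hqpos : dist (f i (vertex (ℓX i) x.src)) q
        = x.pos * dist (f i (vertex (ℓX i) x.src)) (f i (vertex (ℓX i) x.tgt)) ∧
      dist q (f i (vertex (ℓX i) x.tgt))
        = (1 - x.pos) * dist (f i (vertex (ℓX i) x.src)) (f i (vertex (ℓX i) x.tgt)) ∧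
      dist (Ft x.src) (Ft x.tgt) ≤ (1 - t) * dist (f i (vertex (ℓX i) x.src))
        (f i (vertex (ℓX i) x.tgt)) + t * C := by
    rw [hq, sigma_eq_recast, recast_mk]
    rcases EdgePoint.eq_vertex_or_onDart x with ⟨h1, h2⟩ | ⟨h1, h2⟩
    · have e : (SeparationQuotient.mk (x.recast (ℓX i)) : (Y i).Realization (ℓX i))
          = vertex (ℓX i) x.src := EdgePoint.mk_eq_mk_of_coord h2
      rw [e, ← h1, dist_self, dist_self]
      refine ⟨by simp, by simp, ?_⟩
      rw [mul_zero, zero_add]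
      exact mul_nonneg ht0 hC0
    · have e : (SeparationQuotient.mk (x.recast (ℓX i)) : (Y i).Realization (ℓX i))
          = point (ℓX i) ⟨(x.src, x.tgt), h1⟩ x.pos := rfl
      rw [e]
      refine ⟨(hf.dist_vertex_point i ⟨(x.src, x.tgt), h1⟩ x.pos).1,
        (hf.dist_vertex_point i ⟨(x.src, x.tgt), h1⟩ x.pos).2, ?_⟩
      rw [hFt, dist_recast_segment (hpos (φ.perm i)) t, hFf, hFf]
      have := mul_le_mul_of_nonneg_left (hC i ⟨(x.src, x.tgt), h1⟩) ht0
      simp only at this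
      linarith
  obtain ⟨hq1, hq2, hD⟩ := hqpos
  set A := f i (vertex (ℓX i) x.src)
  set B := f i (vertex (ℓX i) x.tgt)
  have hb1 := hb i x.src
  have hb2 := hb i x.tgt
  change dist (P i x.src) (Ft x.src) ≤ b at hb1
  change dist (P i x.tgt) (Ft x.tgt) ≤ b at hb2
  have hP : dist (P i x.src) (P i x.tgt) ≤ 2 * b + ((1 - t) * dist A B + t * C) := by
    have := dist_triangle4 (P i x.src) (Ft x.src) (Ft x.tgt) (P i x.tgt)
    rw [dist_comm (Ft x.tgt) (P i x.tgt)] at this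
    linarith
  have hy1 : dist (P i x.src) y = x.pos * dist (P i x.src) (P i x.tgt) := by
    rw [hy, hg, dist_geodFraction_left hTt]
  have hy2 : dist y (P i x.tgt) = (1 - x.pos) * dist (P i x.src) (P i x.tgt) := by
    rw [hy, hg, dist_geodFraction_right hTt]
  have hb0 : 0 ≤ b := dist_nonneg.trans hb1
  have htC : 0 ≤ t * C := mul_nonneg ht0 hC0
  have contr : ∀ v, (1 - (t : ℝ)) * dist (σ y) (f i (vertex (ℓX i) v)) ≤ dist y (Ft v) := by
    intro v
    rw [← hσF]
    exact mul_dist_sigma_le _ _ _ _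
  have fin : ∀ (s D Z : ℝ), 0 ≤ s → s ≤ 1 →
      (1 - (t : ℝ)) * Z ≤ s * (2 * b + ((1 - t) * D + t * C)) + b →
      Z - s * D ≤ 6 * b + 2 * (t * C) := by
    intro s D Z hs hs' h
    have h1 : s * (2 * b + t * C) ≤ 2 * b + t * C :=
      mul_le_of_le_one_left (by positivity) hs'
    have h2 : (1 - (t : ℝ)) * (Z - s * D) ≤ 3 * b + t * C := by linarith
    by_contra! h3
    have h4 : (1 / 2) * (Z - s * D) ≤ (1 - (t : ℝ)) * (Z - s * D) :=
      mul_le_mul_of_nonneg_right (by linarith) (by linarith)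
    linarith
  have hqb : dist A q + dist q B = dist A B := by rw [hq1, hq2]; ring
  refine (hTX.dist_le_max hqb (σ y)).trans (max_le ?_ ?_)
  · rw [hq1]
    refine fin _ _ _ hs0 hs1 ((contr x.src).trans ?_)
    have t1 := dist_triangle y (P i x.src) (Ft x.src)
    rw [dist_comm y (P i x.src), hy1] at t1
    have := mul_le_mul_of_nonneg_left hP hs0
    linarith
  · rw [hq2]
    refine fin _ _ _ (by linarith) (by linarith) ((contr x.tgt).trans ?_)
    have t1 := dist_triangle y (P i x.tgt) (Ft x.tgt)
    rw [hy2] at t1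
    have := mul_le_mul_of_nonneg_left hP (by linarith : 0 ≤ 1 - (x.pos : ℝ))
    linarith

end Nearby

theorem theorem7p1 {ι : Type} [Fintype ι] {H : ι → Type u} [∀ i, Group (H i)]
    [∀ i, Nontrivial (H i)] (Γ : ∀ i, Splitting (H i)) (φ : AutGamma Γ)
    (Y : ∀ i, FreeTree (H i)) (hY : ∀ i, (Y i).InBordification (Γ i))
    (ℓX ℓY : ∀ i, (Y i).Lengths) (hpos : ∀ i, (ℓY i).Positive)
    (hcore : IsInvariantSubgraph φ ℓY
      (fun i => (Y i).coreEdges {e | (ℓX i).len e = 0}))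
    (f : ForestMap φ ℓX) (hf : f.IsOptimal) (ε : ℝ) (hε : 0 < ε) :
    ∃ tε : ℝ, 0 < tε ∧ ∀ t : unitInterval, (t : ℝ) < tε →
      ∃ g : ForestMap φ (fun i => (ℓX i).segment (ℓY i) t), g.IsOptimal ∧
        dInfty
          (fun i x => FreeTree.sigma (ℓX (φ.perm i)) (ℓY (φ.perm i)) (hpos (φ.perm i)) t (g i x))
          (fun i x => f i (FreeTree.sigma (ℓX i) (ℓY i) (hpos i) t x))
          < ENNReal.ofReal ε := by
  obtain ⟨h, hh, -⟩ := hcore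
  choose F hF hFf using fun i => ForestMap.exists_lift hpos hh hf.represents i
  obtain ⟨κ, hκ0, hκ⟩ := ForestMap.exists_displacement_bound hpos hf
  obtain ⟨C, hC0, hC⟩ := exists_uniform_bound fun i => FreeTree.exists_bound_of_invariant
    (c := fun d : (Y i).graph.Dart => dist (F i d.fst) (F i d.snd))
    (FreeTree.dist_smulDart (hF i))
  obtain ⟨M, hM0, hM⟩ := exists_uniform_bound fun i => FreeTree.exists_bound_of_invariant
    (c := fun d : (Y i).graph.Dart => (ℓX i).len d.edge) (FreeTree.len_smulDart (ℓX i))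
  obtain ⟨N, hN0, hN⟩ := exists_uniform_bound (α := fun _ : ι => Unit)
    (c := fun i _ => (Nat.card (Y i).Orb : ℝ))
    fun i => ⟨Nat.card (Y i).Orb, Nat.cast_nonneg _, fun _ => le_rfl⟩
  have hL0 : 0 ≤ (f.lip : ℝ) := f.lip.2
  -- the total error is `t * E`, up to a summand that comes from the choice of the optimal map
  set E := 6 * (N * (C + f.lip * κ * M)) + 2 * C with hE
  have hE0 : 0 ≤ E := by positivity
  refine ⟨min (1 / 2) (ε / (4 * (E + 1))), by positivity, fun t ht => ?_⟩
  obtain ⟨ht2, htE⟩ := lt_min_iff.1 ht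
  have ht0 := t.2.1
  suffices ∃ g : ForestMap φ (fun i => (ℓX i).segment (ℓY i) t), g.IsOptimal ∧ ∀ i x,
      dist (FreeTree.sigma (ℓX (φ.perm i)) (ℓY (φ.perm i)) (hpos (φ.perm i)) t (g i x))
        (f i (FreeTree.sigma (ℓX i) (ℓY i) (hpos i) t x)) ≤ ε / 2 by
    obtain ⟨g, hg, hd⟩ := this
    refine ⟨g, hg, lt_of_le_of_lt (b := ENNReal.ofReal (ε / 2)) ?_
      ((ENNReal.ofReal_lt_ofReal_iff hε).2 (half_lt_self hε))⟩
    refine iSup_le fun i => iSup_le fun x => ?_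
    rw [edist_dist]
    exact ENNReal.ofReal_le_ofReal (hd i x)
  have hexact : (∃ g : ForestMap φ (fun i => (ℓX i).segment (ℓY i) t), g.IsOptimal ∧ ∀ i x,
      FreeTree.sigma (ℓX (φ.perm i)) (ℓY (φ.perm i)) (hpos (φ.perm i)) t (g i x)
        = f i (FreeTree.sigma (ℓX i) (ℓY i) (hpos i) t x)) →
      ∃ g : ForestMap φ (fun i => (ℓX i).segment (ℓY i) t), g.IsOptimal ∧ ∀ i x,
      dist (FreeTree.sigma (ℓX (φ.perm i)) (ℓY (φ.perm i)) (hpos (φ.perm i)) t (g i x))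
        (f i (FreeTree.sigma (ℓX i) (ℓY i) (hpos i) t x)) ≤ ε / 2 := by
    rintro ⟨g, hg, heq⟩
    exact ⟨g, hg, fun i x => by rw [heq, dist_self]; positivity⟩
  rcases ht0.eq_or_lt with h0 | h0
  · exact hexact (exists_sigma_eq_self hpos hf (Subtype.ext h0.symm))
  have hpost : ∀ i, ((ℓX i).segment (ℓY i) t).Positive := fun i => (hpos i).segment h0
  let Ft : VertexMap φ (fun i => (ℓX i).segment (ℓY i) t) := fun i v =>
    FreeTree.recast ((hpos (φ.perm i)).zero_imp ((ℓX (φ.perm i)).segment (ℓY (φ.perm i)) t)) (F i v)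
  have hFt : ∀ i, IsEquivariant (φ.iso i) (Ft i) := by
    intro i a v
    change FreeTree.recast _ (F i (a • v)) = _ • FreeTree.recast _ (F i v)
    rw [hF i, FreeTree.recast_smul]
  have hne : ∃ g : ForestMap φ (fun i => (ℓX i).segment (ℓY i) t), g.Represents := by
    choose L hL using fun i => FreeTree.exists_edgeLip (hpost i) (hFt i)
    obtain ⟨g, hg, -⟩ := ForestMap.exists_straight_extension (L := Finset.univ.sup L) hFt
      (fun i d => (hL i d).trans (mul_le_mul_of_nonneg_right
        (by exact_mod_cast Finset.le_sup (Finset.mem_univ i)) ((hpost i) _ d.edge_mem).le))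
    exact ⟨g, hg⟩
  set Λ := ForestMap.displacement φ (fun i => (ℓX i).segment (ℓY i) t) with hΛ
  have hbound : (1 - t) * (f.lip : ℝ) ≤ Λ * ((1 - t) + t * κ) := by
    choose P hP hPL using ForestMap.exists_edgeLip_displacement hne
    obtain ⟨g, hg, hgL, -⟩ := ForestMap.exists_straight_extension hP hPL
    exact hκ t (by linarith) g hg _ hgL
  rcases (zero_le (a := Λ)).eq_or_lt with hΛ0 | hΛ0
  · refine hexact (exists_optimal_of_displacement_eq_zero hpos hf ?_ h0 hne hΛ0.symm)
    rw [← hΛ0, NNReal.coe_zero, zero_mul] at hbound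
    have : (f.lip : ℝ) ≤ 0 := by
      by_contra! hlt
      exact absurd hbound (not_le.2 (mul_pos (by linarith) hlt))
    exact_mod_cast le_antisymm this hL0
  obtain ⟨g, hg, P, hPF, hgx⟩ := ForestMap.exists_optimal_near hpost hFt hne hΛ0
    (ε := t * (C + f.lip * κ * M)) (η := ε / 24) (by positivity) (by positivity) (by
      intro i d
      change dist (FreeTree.recast _ (F i d.fst)) (FreeTree.recast _ (F i d.snd)) ≤
        Λ * ((1 - t) * (ℓX i).len d.edge + t * (ℓY i).len d.edge) + _
      rw [FreeTree.dist_recast_segment (hpos (φ.perm i)), hFf, hFf]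
      have e1 := ForestMap.edgeLip_of_hasLip (ForestMap.hasLip_lip hf.represents.1) i d
      have e2 := mul_le_mul_of_nonneg_left (hC i d) ht0
      have e3 := hM i d
      have e4 := (ℓX i).nonneg d.edge
      have e5 := mul_nonneg ht0 ((ℓY i).nonneg d.edge)
      have e6 := mul_le_mul_of_nonneg_left e1 (by linarith : 0 ≤ 1 - (t : ℝ))
      have e7 := mul_nonneg Λ.coe_nonneg e5
      simp only at e1 e2 e3 e6
      -- the displacement of `Y_t` may be larger or smaller than that of `X`
      have e8 : (1 - (t : ℝ)) * (f.lip * (ℓX i).len d.edge)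
          ≤ Λ * ((1 - t) * (ℓX i).len d.edge) + t * (f.lip * κ * M) := by
        rcases le_total (f.lip : ℝ) Λ with hle | hle
        · have i1 := mul_le_mul_of_nonneg_right hle
            (mul_nonneg (by linarith : 0 ≤ 1 - (t : ℝ)) e4)
          have i2 : 0 ≤ (t : ℝ) * (f.lip * κ * M) := by positivity
          linarith
        · have i1 := mul_le_mul_of_nonneg_right hbound e4
          have i2 : (Λ : ℝ) * (t * κ) * (ℓX i).len d.edge ≤ f.lip * (t * κ) * M := by
            have : (0 : ℝ) ≤ Λ := Λ.2
            gcongr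
          linarith
      linarith)
  refine ⟨g, hg, fun i x => ?_⟩
  have hb : ∀ i v, dist (P i v) (Ft i v) ≤ N * (t * (C + f.lip * κ * M)) + ε / 24 := by
    intro i v
    refine (hPF i v).trans ?_
    have := hN i ()
    gcongr
  refine (dist_sigma_le hpos hf.straight ht2.le hFf hC0 hC hgx hb i x).trans ?_
  have hlast : t * (E + 1) ≤ ε / 4 := by
    rw [lt_div_iff₀ (by positivity)] at htE
    linarith
  have : 6 * (N * (t * (C + f.lip * κ * M)) + ε / 24) + 2 * (t * C) = t * E + ε / 4 := by
    rw [hE]; ring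
  rw [this]
  linarith
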